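/- Let $K$ be an algebraically closed field and $R=K[x_0,\dots,x_r]$. For a closed scheme $X\subseteq\mathbb P^r$ let $I_X\subseteq R$ be its saturated ideal; $X$ is ACM if $R/I_X$ is a Cohen–Macaulay ring. For a finitely generated graded $R$-module $M$ let $\mathcal M$ be the associated coherent sheaf on $\mathbb P^r$. Let $s\ge 2$, $t\ge 1$, $s+t\le r$. Let $D\subset\mathbb P^r$ be an ACM scheme of codimension $s$, with minimal graded free resolution $$0\to H_s\xrightarrow{\varepsilon_s}H_{s-1}\to\cdots\xrightarrow{\varepsilon_2}H_1\xrightarrow{\varepsilon_1} I_D\to 0,\qquad H_0=R.$$ Let $f_1,\dots,f_t\in R$ be forms of degrees $d_1,\dots,d_t$ such that $S=V(f_1,\dots,f_t)$ has codimension $t$, and suppose that the scheme $X=D\cap S$ has codimension $s+t$. Let $F=\bigoplus_i R(-d_i)$, let $\bigwedge^\bullet F$ be the Koszul complex of $f_1,\dots,f_t$, let $(G_\bullet,\delta_\bullet)=H_\bullet\otimes\bigwedge^\bullet F$, so that $G_n=\bigoplus_{i+j=n}H_i\otimes\bigwedge^jF$, and let $G'_n=\bigoplus_{i+j=n,\ j\ne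 t}H_i\otimes\bigwedge^jF\subseteq G_n$. Put $N=\ker(\delta_t)\subseteq G_t$, $P=\delta_{t+1}(G'_{t+1})$ and $k=-\sum_i d_i$. Then $D$ is obtained from $X$ by the following construction: 1. $X$ is ACM of codimension $s+t$, with $3\le s+t\le r$, and $0\to G_{s+t}\to\cdots\to G_1\to I_X\to0$ is a minimal graded free resolution of $I_X$; thus $N$ is the $t$-th syzygy module of $X$. 2. $P$ is a graded submodule of $N$; $P$ and $N$ are torsion-free, $\mathrm{pd}(P)=s-2$ and $\mathrm{pd}(N)\le \mathrm{pd}(P)+1$. 3. The polynomial $-\chi(\mathcal N(T-k))+\chi(\mathcal P(T-k))+\binom{T+r}{r}$ in $T$ has degree $r-s$. 4. $\mathcal P$ is a maximal subsheaf of $\mathcal N$: it equals every coherent subsheaf of $\mathcal N$ that contains it and has the same rank. 5. There is an exact sequence of graded modules $0\to P\to N\to I_D(k)\to 0$ whose first map is the inclusion; hence also $0\to\mathcal P\to\mathcal N\to\mathcal I_D(k)\to0$ is exact. Moreover $\cdots\to G'_{t+2}\to G'_{t+1}\to P\to0$ is exact; in particular $P\cong\mathrm{coker}(G'_{t+2}\to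 G'_{t+1})$. -/

import Mathlib

open MvPolynomial

noncomputable section

namespace ProjACM

universe u

/-! ## The graded polynomial ring and closed subschemes of projective space -/

/-- The homogeneous coordinate ring `R = K[x_0, …, x_r]` of `ℙ^r`. -/
abbrev CoordRing (K : Type u) [Field K] (r : ℕ) : Type u := MvPolynomial (Fin (r + 1)) K

section Ring

variable {K : Type u} [Field K] {r : ℕ}

/-- The forms of degree `m : ℤ` in `R` (only `0` if `m < 0`): every monomial has degree `m`. -/
def forms (K : Type u) [Field K] (r : ℕ) (m : ℤ) : Submodule K (CoordRing K r) :=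
  restrictSupport K {α | (α.degree : ℤ) = m}

lemma mem_forms {m : ℤ} {g : CoordRing K r} :
    g ∈ forms K r m ↔ ∀ α ∈ g.support, (α.degree : ℤ) = m := Iff.rfl

lemma one_mem_forms : (1 : CoordRing K r) ∈ forms K r 0 := by
  classical
  rw [mem_forms]
  intro α hα
  have h : α ∈ (monomial 0 (1 : K) : CoordRing K r).support := hα
  rw [support_monomial, if_neg one_ne_zero, Finset.mem_singleton] at h
  simp [h]

lemma mul_mem_forms {m n : ℤ} {g h : CoordRing K r} (hg : g ∈ forms K r m)
    (hh : h ∈ forms K r n) : g * h ∈ forms K r (m + n) := by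
  classical
  rw [mem_forms] at *
  intro α hα
  obtain ⟨β, hβ, γ, hγ, rfl⟩ := Finset.mem_add.1 (support_mul g h hα)
  rw [← hg β hβ, ← hh γ hγ]
  simp

lemma isHomogeneous_mem_forms {n : ℕ} {g : CoordRing K r} (hg : g.IsHomogeneous n) :
    g ∈ forms K r n := by
  rw [mem_forms]
  intro α hα
  by_contra h
  exact mem_support_iff.1 hα (hg.coeff_eq_zero (by exact_mod_cast h))

attribute [local instance] MvPolynomial.gradedAlgebra

/-- A homogeneous ideal of `R`. -/
def IsHomogeneousIdeal (J : Ideal (CoordRing K r)) : Prop :=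
  J.IsHomogeneous (homogeneousSubmodule (Fin (r + 1)) K)

lemma IsHomogeneousIdeal.sup {I J : Ideal (CoordRing K r)} (hI : IsHomogeneousIdeal I)
    (hJ : IsHomogeneousIdeal J) : IsHomogeneousIdeal (I ⊔ J) :=
  Ideal.IsHomogeneous.sup hI hJ

lemma isHomogeneousIdeal_span {t : ℕ} {f : Fin t → CoordRing K r} {d : Fin t → ℕ}
    (hf : ∀ i, (f i).IsHomogeneous (d i)) : IsHomogeneousIdeal (Ideal.span (Set.range f)) := by
  refine Ideal.homogeneous_span _ _ ?_
  rintro _ ⟨i, rfl⟩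
  exact ⟨d i, hf i⟩

/-- The saturation of `J` with respect to the irrelevant ideal `(x_0, …, x_r)`: the elements
multiplied into `J` by a power of each variable. -/
def saturation (J : Ideal (CoordRing K r)) : Ideal (CoordRing K r) where
  carrier := {g | ∀ i, ∃ n : ℕ, X i ^ n * g ∈ J}
  zero_mem' := fun i => ⟨0, by simp⟩
  add_mem' := by
    intro a b ha hb i
    obtain ⟨m, hm⟩ := ha i
    obtain ⟨n, hn⟩ := hb i
    refine ⟨m + n, ?_⟩
    have h : X i ^ (m + n) * (a + b) = X i ^ n * (X i ^ m * a) + X i ^ m * (X i ^ n * b) := by ring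
    rw [h]
    exact J.add_mem (J.mul_mem_left _ hm) (J.mul_mem_left _ hn)
  smul_mem' := by
    intro c a ha i
    obtain ⟨m, hm⟩ := ha i
    refine ⟨m, ?_⟩
    rw [smul_eq_mul, mul_left_comm]
    exact J.mul_mem_left _ hm

lemma mem_saturation {J : Ideal (CoordRing K r)} {g : CoordRing K r} :
    g ∈ saturation J ↔ ∀ i, ∃ n : ℕ, X i ^ n * g ∈ J := Iff.rfl

lemma le_saturation (J : Ideal (CoordRing K r)) : J ≤ saturation J :=
  fun g hg _ => ⟨0, by simpa using hg⟩

lemma saturation_saturation (J : Ideal (CoordRing K r)) :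
    saturation (saturation J) = saturation J := by
  refine le_antisymm (fun g hg i => ?_) (le_saturation _)
  obtain ⟨m, hm⟩ := hg i
  obtain ⟨n, hn⟩ := hm i
  exact ⟨n + m, by rw [pow_add, mul_assoc]; exact hn⟩

lemma IsHomogeneousIdeal.saturation {J : Ideal (CoordRing K r)} (hJ : IsHomogeneousIdeal J) :
    IsHomogeneousIdeal (saturation J) := by
  intro m g hg i
  obtain ⟨n, hn⟩ := hg i
  refine ⟨n, ?_⟩
  have hX : (X i ^ n : CoordRing K r) ∈ homogeneousSubmodule (Fin (r + 1)) K n := by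
    simpa using (isHomogeneous_X K i).pow n
  have h := hJ (n + m) hn
  rwa [DirectSum.coe_decompose_mul_add_of_left_mem _ hX] at h

end Ring

/-- A closed subscheme of `ℙ^r` over `K`, given by its saturated homogeneous ideal `I_X`
(closed subschemes of `ℙ^r` correspond bijectively to such ideals). -/
structure ClosedSubscheme (K : Type u) [Field K] (r : ℕ) where
  /-- the saturated ideal `I_X` -/
  ideal : Ideal (CoordRing K r)
  homogeneous : IsHomogeneousIdeal ideal
  saturated : saturation ideal = ideal

/-- `depth A` of a local ring `A`: the supremum of the lengths of the `A`-regular sequences in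
the maximal ideal. -/
def localDepth (A : Type u) [CommRing A] [IsLocalRing A] : ℕ∞ :=
  ⨆ (l : List A) (_ : RingTheory.Sequence.IsRegular A l ∧
    ∀ a ∈ l, a ∈ IsLocalRing.maximalIdeal A), (l.length : ℕ∞)

/-- A (Noetherian) ring is Cohen–Macaulay if `depth A_𝔐 = dim A_𝔐` for each maximal ideal `𝔐`. -/
def IsCohenMacaulayRing (A : Type u) [CommRing A] : Prop :=
  ∀ (M : Ideal A) [M.IsMaximal],
    (localDepth (Localization.AtPrime M) : WithBot ℕ∞) = ringKrullDim (Localization.AtPrime M)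

namespace ClosedSubscheme

variable {K : Type u} [Field K] {r : ℕ}

/-- `V(f_1, …, f_t)` for forms `f_i` of degrees `d_i`. -/
def ofForms {t : ℕ} (f : Fin t → CoordRing K r) (d : Fin t → ℕ)
    (hf : ∀ i, (f i).IsHomogeneous (d i)) : ClosedSubscheme K r where
  ideal := saturation (Ideal.span (Set.range f))
  homogeneous := (isHomogeneousIdeal_span hf).saturation
  saturated := saturation_saturation _

/-- The scheme-theoretic intersection: its ideal sheaf is the sum of the two ideal sheaves. -/
def inter (D S : ClosedSubscheme K r) : ClosedSubscheme K r where
  ideal := saturation (D.ideal ⊔ S.ideal)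
  homogeneous := (D.homogeneous.sup S.homogeneous).saturation
  saturated := saturation_saturation _

/-- `X` has codimension `c` in `ℙ^r`, that is `dim X = r - c`, where
`dim X = dim (R / I_X) - 1`. In particular `X` is not empty. -/
def HasCodim (X : ClosedSubscheme K r) (c : ℕ) : Prop :=
  ringKrullDim (CoordRing K r ⧸ X.ideal) + (c : WithBot ℕ∞) = ((r + 1 : ℕ) : WithBot ℕ∞)

/-- `X` is arithmetically Cohen–Macaulay: `R / I_X` is a Cohen–Macaulay ring. -/
def IsACM (X : ClosedSubscheme K r) : Prop :=
  IsCohenMacaulayRing (CoordRing K r ⧸ X.ideal)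

end ClosedSubscheme

/-! ## Complexes of graded free modules -/

/-- A bounded complex of finitely generated graded free `R`-modules, with homogeneous bases: the
basis element `e_b` lies in homological degree `hdeg b` and has internal degree `deg b`, so the
module in homological degree `n` is `⨁_{hdeg b = n} R(-deg b)`. The differential is
`e_b ↦ ∑ a, d a b • e_a`; it lowers `hdeg` by one and preserves the internal degree. All the terms
are held in the single free module `ι → R`. -/
structure GradedFreeComplex (K : Type u) [Field K] (r : ℕ) where
  ι : Type
  [fintype : Fintype ι]
  [decEq : DecidableEq ι]
  hdeg : ι → ℕ
  deg : ι → ℤ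
  d : Matrix ι ι (CoordRing K r)
  d_hdeg : ∀ a b, d a b ≠ 0 → hdeg a + 1 = hdeg b
  d_deg : ∀ a b, d a b ∈ forms K r (deg b - deg a)
  d_sq : d * d = 0

attribute [instance] GradedFreeComplex.fintype GradedFreeComplex.decEq

section Graded

variable {K : Type u} [Field K] {r : ℕ} {ι : Type} [Fintype ι]

/-- The homogeneous elements of degree `n` in the graded free module `⨁_b R(-deg b)`. -/
def gradedPiece (K : Type u) [Field K] (r : ℕ) (deg : ι → ℤ) (n : ℤ) :
    Submodule K (ι → CoordRing K r) :=
  Submodule.pi Set.univ fun b => forms K r (n - deg b)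

/-- `M ⊆ ⨁_b R(-deg b)` is a graded submodule: it is generated by homogeneous elements. -/
def IsGradedSubmodule (deg : ι → ℤ) (M : Submodule (CoordRing K r) (ι → CoordRing K r)) : Prop :=
  Submodule.span (CoordRing K r) {v | v ∈ M ∧ ∃ n, v ∈ gradedPiece K r deg n} = M

/-- The homogeneous component `M_n` of a graded submodule `M`. -/
def component (deg : ι → ℤ) (M : Submodule (CoordRing K r) (ι → CoordRing K r)) (n : ℤ) :
    Submodule K (ι → CoordRing K r) :=
  M.restrictScalars K ⊓ gradedPiece K r deg n

/-- `q(n) = dim_K M_n` for all large `n`. The polynomial `q` is the Hilbert polynomial of `M`, that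
is `q(n) = χ(𝓜(n))` for the coherent sheaf `𝓜` on `ℙ^r` associated to `M`. -/
def IsHilbertPolynomial (deg : ι → ℤ) (M : Submodule (CoordRing K r) (ι → CoordRing K r))
    (q : Polynomial ℚ) : Prop :=
  ∀ᶠ n : ℤ in Filter.atTop, q.eval (n : ℚ) = Module.finrank K (component deg M n)

/-- The inclusion `𝓜 ⊆ 𝓜'` of the coherent sheaves associated to two graded submodules `M`, `M'` of
the same graded free module: on every chart `x_i ≠ 0` the localization of `M` at `x_i` is contained
in that of `M'`. -/
def SheafLE (M M' : Submodule (CoordRing K r) (ι → CoordRing K r)) : Prop :=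
  ∀ i : Fin (r + 1), ∀ v ∈ M, ∃ n : ℕ, (X i : CoordRing K r) ^ n • v ∈ M'

/-- The sheaf `𝓜` associated to `M` is a maximal subsheaf of the sheaf `𝓝` associated to `N`: it is
contained in `𝓝` and equals every coherent subsheaf of `𝓝` that contains it and has the same rank.
Every coherent subsheaf of `𝓝` is the sheaf associated to some graded submodule `M'` of `N`,
and its rank is the rank of `M'` over the domain `R`. -/
def IsMaximalSubsheaf (deg : ι → ℤ) (M N : Submodule (CoordRing K r) (ι → CoordRing K r)) : Prop :=
  SheafLE M N ∧ ∀ M' : Submodule (CoordRing K r) (ι → CoordRing K r),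
    IsGradedSubmodule deg M' → M' ≤ N → SheafLE M M' →
    Module.finrank (CoordRing K r) M' = Module.finrank (CoordRing K r) M → SheafLE M' M

/-- The polynomial `-χ(𝓝(T - k)) + χ(𝓟(T - k)) + binom(T + r, r)` has degree `r - s`. Here
`preHilbertPoly ℚ r 0` is the polynomial `binom(T + r, r) = (T + 1) ⋯ (T + r) / r!`. -/
def HilbertCondition (deg : ι → ℤ) (N P : Submodule (CoordRing K r) (ι → CoordRing K r))
    (s : ℕ) (k : ℤ) : Prop :=
  ∃ qN qP : Polynomial ℚ, IsHilbertPolynomial deg N qN ∧ IsHilbertPolynomial deg P qP ∧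
    (-(qN.comp (Polynomial.X - Polynomial.C (k : ℚ))) +
      qP.comp (Polynomial.X - Polynomial.C (k : ℚ)) +
      Polynomial.preHilbertPoly ℚ r 0).degree = ((r - s : ℕ) : WithBot ℕ)

/-- There is a short exact sequence `0 → P → N → I(k) → 0` of graded modules, whose first map is the
inclusion. -/
def HasExactSequence (deg : ι → ℤ) (P N : Submodule (CoordRing K r) (ι → CoordRing K r))
    (I : Ideal (CoordRing K r)) (k : ℤ) : Prop :=
  P ≤ N ∧ ∃ π : N →ₗ[CoordRing K r] CoordRing K r,
    LinearMap.range π = I ∧ LinearMap.ker π = P.comap N.subtype ∧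
    ∀ (n : ℤ) (v : N), (v : ι → CoordRing K r) ∈ gradedPiece K r deg n → π v ∈ forms K r (n + k)

/-- The projective dimension of a submodule, as an `R`-module. -/
def pd (M : Submodule (CoordRing K r) (ι → CoordRing K r)) : WithBot ℕ∞ :=
  CategoryTheory.projectiveDimension (ModuleCat.of (CoordRing K r) M)

end Graded

namespace GradedFreeComplex

variable {K : Type u} [Field K] {r : ℕ}

/-- The differential of the complex. -/
def δ (C : GradedFreeComplex K r) :
    (C.ι → CoordRing K r) →ₗ[CoordRing K r] (C.ι → CoordRing K r) :=
  C.d.mulVecLin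

/-- The free module spanned by the basis elements in `B`. -/
def supportedOn (C : GradedFreeComplex K r) (B : Set C.ι) :
    Submodule (CoordRing K r) (C.ι → CoordRing K r) :=
  Submodule.pi {b | b ∉ B} fun _ => ⊥

/-- The free module in homological degree `n`. -/
def term (C : GradedFreeComplex K r) (n : ℕ) : Submodule (CoordRing K r) (C.ι → CoordRing K r) :=
  C.supportedOn {b | C.hdeg b = n}

/-- The kernel of the differential `δ_n : C_n → C_{n-1}` (for `n ≥ 1`). -/
def syzygy (C : GradedFreeComplex K r) (n : ℕ) :
    Submodule (CoordRing K r) (C.ι → CoordRing K r) :=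
  C.term n ⊓ LinearMap.ker C.δ

/-- `0 → C_ℓ → ⋯ → C_1 → I → 0` is a minimal graded free resolution of the ideal `I`, where
`C_0 = R` and the augmentation is `C_1 → C_0 = R`: it is exact, and the entries of the differentials
lie in the irrelevant ideal. -/
structure IsMinimalFreeResolution (C : GradedFreeComplex K r) (I : Ideal (CoordRing K r))
    (ℓ : ℕ) : Prop where
  length : ∀ b, C.hdeg b ≤ ℓ
  minimal : ∀ a b, constantCoeff (C.d a b) = 0
  exact : ∀ n, 1 ≤ n → C.syzygy n = (C.term (n + 1)).map C.δ
  augmented : ∃ o : C.ι, (∀ b, C.hdeg b = 0 ↔ b = o) ∧ C.deg o = 0 ∧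
    (C.term 1).map (LinearMap.proj o ∘ₗ C.δ) = I

/-- The tensor product of two complexes: basis `e_a ⊗ e_b`, with
`e_a ⊗ e_b ↦ d e_a ⊗ e_b + (-1)^(hdeg a) e_a ⊗ d e_b`. -/
def tensor (C D : GradedFreeComplex K r) : GradedFreeComplex K r where
  ι := C.ι × D.ι
  hdeg x := C.hdeg x.1 + D.hdeg x.2
  deg x := C.deg x.1 + D.deg x.2
  d := Matrix.of fun x y =>
    (if x.2 = y.2 then C.d x.1 y.1 else 0) +
      (if x.1 = y.1 then (-1) ^ C.hdeg y.1 * D.d x.2 y.2 else 0)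
  d_hdeg := by
    rintro ⟨a, b⟩ ⟨a', b'⟩ h
    by_contra hne
    apply h
    simp only [Matrix.of_apply]
    have h1 : (if b = b' then C.d a a' else 0) = 0 := by
      split_ifs with hb
      · by_contra h0
        have := C.d_hdeg a a' h0
        subst hb
        exact hne (by dsimp only; omega)
      · rfl
    have h2 : (if a = a' then (-1) ^ C.hdeg a' * D.d b b' else 0) = 0 := by
      split_ifs with ha
      · by_contra h0
        have := D.d_hdeg b b' (right_ne_zero_of_mul h0)
        subst ha
        exact hne (by dsimp only; omega)
      · rfl
    rw [h1, h2, add_zero]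
  d_deg := by
    rintro ⟨a, b⟩ ⟨a', b'⟩
    simp only [Matrix.of_apply]
    refine Submodule.add_mem _ ?_ ?_
    · split_ifs with hb
      · subst hb
        have h := C.d_deg a a'
        rwa [show C.deg a' + D.deg b - (C.deg a + D.deg b) = C.deg a' - C.deg a by ring]
      · exact Submodule.zero_mem _
    · split_ifs with ha
      · subst ha
        have h := D.d_deg b b'
        rw [show C.deg a + D.deg b' - (C.deg a + D.deg b) = D.deg b' - D.deg b by ring]
        rcases neg_one_pow_eq_or (CoordRing K r) (C.hdeg a) with h1 | h1
        · rw [h1, one_mul]; exact h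
        · rw [h1, neg_one_mul]; exact Submodule.neg_mem _ h
      · exact Submodule.zero_mem _
  d_sq := by
    ext1 ⟨a, b⟩ ⟨a', b'⟩
    have hC : ∑ c, C.d a c * C.d c a' = 0 := by
      simpa [Matrix.mul_apply] using congrFun (congrFun C.d_sq a) a'
    have hD : ∑ c, D.d b c * D.d c b' = 0 := by
      simpa [Matrix.mul_apply] using congrFun (congrFun D.d_sq b) b'
    have hs : (-1 : CoordRing K r) ^ C.hdeg a * D.d b b' * C.d a a' +
        C.d a a' * ((-1) ^ C.hdeg a' * D.d b b') = 0 := by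
      by_cases h0 : C.d a a' = 0
      · simp [h0]
      · rw [← C.d_hdeg a a' h0, pow_succ]; ring
    simp only [Matrix.mul_apply, Matrix.of_apply, Matrix.zero_apply, Fintype.sum_prod_type,
      add_mul, mul_add, Finset.sum_add_distrib, ite_mul, mul_ite, zero_mul, mul_zero,
      Finset.sum_ite_eq, Finset.sum_ite_eq', Finset.mem_univ, if_true]
    have h1 : (∑ x, if b = b' then C.d a x * C.d x a' else 0) = 0 := by
      split_ifs
      · exact hC
      · simp
    rw [h1, zero_add, Finset.sum_comm]
    simp only [Finset.sum_ite_eq', Finset.mem_univ, if_true, Finset.sum_add_distrib,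
      Finset.sum_ite_eq]
    rw [← add_assoc, hs, zero_add]
    split_ifs
    · calc ∑ x, (-1 : CoordRing K r) ^ C.hdeg a' * D.d b x * ((-1) ^ C.hdeg a' * D.d x b') =
          (-1) ^ C.hdeg a' * (-1) ^ C.hdeg a' * ∑ x, D.d b x * D.d x b' := by
            rw [Finset.mul_sum]
            exact Finset.sum_congr rfl fun x _ => by ring
        _ = 0 := by rw [hD, mul_zero]
    · simp

/-- The Koszul complex of forms `f_1, …, f_t` of degrees `d_1, …, d_t`: the exterior algebra of
`⨁ R(-d_i)`, with the basis `e_T = e_{i_1} ∧ ⋯ ∧ e_{i_p}` for `T = {i_1 < ⋯ < i_p}`, and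
`e_T ↦ ∑_{i ∈ T} (-1)^{#{j ∈ T, j < i}} f_i e_{T \ {i}}`. -/
def koszul {t : ℕ} (f : Fin t → CoordRing K r) (d : Fin t → ℕ)
    (hf : ∀ i, (f i).IsHomogeneous (d i)) : GradedFreeComplex K r where
  ι := Finset (Fin t)
  hdeg T := T.card
  deg T := ∑ i ∈ T, (d i : ℤ)
  d := Matrix.of fun U T => ∑ i ∈ T, if U = T.erase i then (-1) ^ {j ∈ T | j < i}.card * f i else 0
  d_hdeg := by
    intro U T h
    obtain ⟨i, hi, h⟩ := Finset.exists_ne_zero_of_sum_ne_zero h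
    have hU : U = T.erase i := by
      by_contra hU
      simp [hU] at h
    rw [hU, Finset.card_erase_add_one hi]
  d_deg := by
    intro U T
    refine Submodule.sum_mem _ fun i hi => ?_
    split_ifs with hU
    · subst hU
      rw [← Finset.add_sum_erase T _ hi, add_sub_cancel_right]
      have h := isHomogeneous_mem_forms (hf i)
      rcases neg_one_pow_eq_or (CoordRing K r) ({j ∈ T | j < i}.card) with h1 | h1
      · rw [h1, one_mul]; exact h
      · rw [h1, neg_one_mul]; exact Submodule.neg_mem _ h
    · exact Submodule.zero_mem _
  d_sq := by
    ext1 U T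
    have hsgn : ∀ i ∈ T, ∀ j ∈ T, i ≠ j →
        ((-1 : CoordRing K r) ^ {x ∈ T.erase j | x < i}.card * f i) *
          ((-1) ^ {x ∈ T | x < j}.card * f j) +
        ((-1) ^ {x ∈ T.erase i | x < j}.card * f j) *
          ((-1) ^ {x ∈ T | x < i}.card * f i) = 0 := by
      have key : ∀ i ∈ T, ∀ j ∈ T, i < j →
          ((-1 : CoordRing K r) ^ {x ∈ T.erase j | x < i}.card * f i) *
            ((-1) ^ {x ∈ T | x < j}.card * f j) +
          ((-1) ^ {x ∈ T.erase i | x < j}.card * f j) *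
            ((-1) ^ {x ∈ T | x < i}.card * f i) = 0 := by
        intro i hi j hj hij
        have h1 : {x ∈ T.erase j | x < i} = {x ∈ T | x < i} := by
          ext x; simp only [Finset.mem_filter, Finset.mem_erase]; grind
        have h2 : {x ∈ T.erase i | x < j}.card + 1 = {x ∈ T | x < j}.card := by
          rw [Finset.filter_erase, Finset.card_erase_add_one]
          simp [hi, hij]
        rw [h1, ← h2, pow_succ]
        ring
      intro i hi j hj hij
      rcases lt_or_gt_of_ne hij with h | h
      · exact key i hi j hj h
      · rw [add_comm]; exact key j hj i hi h
    have hsum : ∀ V, (∑ i ∈ V, if U = V.erase i then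
          (-1 : CoordRing K r) ^ {j ∈ V | j < i}.card * f i else 0) *
          (∑ j ∈ T, if V = T.erase j then (-1) ^ {x ∈ T | x < j}.card * f j else 0) =
        ∑ j ∈ T, if V = T.erase j then (∑ i ∈ T.erase j, if U = (T.erase j).erase i then
          ((-1 : CoordRing K r) ^ {x ∈ T.erase j | x < i}.card * f i) *
          ((-1) ^ {x ∈ T | x < j}.card * f j) else 0) else 0 := by
      intro V
      rw [Finset.mul_sum]
      refine Finset.sum_congr rfl fun j _ => ?_
      split_ifs with hV
      · subst hV
        rw [Finset.sum_mul]
        exact Finset.sum_congr rfl fun i _ => by rw [ite_mul, zero_mul]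
      · rw [mul_zero]
    simp only [Matrix.mul_apply, Matrix.of_apply, Matrix.zero_apply, hsum]
    rw [Finset.sum_comm]
    simp only [Finset.sum_ite_eq', Finset.mem_univ, if_true]
    rw [Finset.sum_sigma']
    refine Finset.sum_involution (fun x _ => ⟨x.2, x.1⟩) ?_ ?_ ?_ ?_
    · rintro ⟨j, i⟩ h
      simp only [Finset.mem_sigma, Finset.mem_erase] at h
      dsimp only
      rw [Finset.erase_right_comm (a := i)]
      split_ifs
      · exact hsgn i h.2.2 j h.1 h.2.1
      · rw [add_zero]
    · rintro ⟨j, i⟩ h _ he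
      simp only [Finset.mem_sigma, Finset.mem_erase] at h
      exact h.2.1 (congrArg Sigma.fst he)
    · rintro ⟨j, i⟩ h
      simp only [Finset.mem_sigma, Finset.mem_erase] at h ⊢
      exact ⟨h.2.2, fun e => h.2.1 e.symm, h.1⟩
    · rintro ⟨j, i⟩ _
      rfl

/-- In the tensor product `G` of `H` with the Koszul complex of `f_1, …, f_t`, the direct sum
`G'_n` of the summands `H_i ⊗ ⋀^j F` of `G_n` with `i + j = n` and `j ≠ t`. -/
def koszulPart {t : ℕ} (H : GradedFreeComplex K r) (f : Fin t → CoordRing K r) (d : Fin t → ℕ)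
    (hf : ∀ i, (f i).IsHomogeneous (d i)) (n : ℕ) :
    Submodule (CoordRing K r) ((H.tensor (koszul f d hf)).ι → CoordRing K r) :=
  (H.tensor (koszul f d hf)).supportedOn
    {x : H.ι × Finset (Fin t) | H.hdeg x.1 + x.2.card = n ∧ x.2.card ≠ t}

end GradedFreeComplex

/-! ## The construction of an ACM scheme `D` containing an ACM scheme `X` -/

/-- `D`, of codimension `s`, is obtained from the ACM scheme `X` of codimension `c` by the
syzygy construction: `F` is the minimal free resolution of `I_X`, the module `N = ker δ_{c-s}` is
the `(c-s)`-th syzygy module of `X`, the graded module `P` is torsion-free of projective dimension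
`s - 2`, it is embedded in `N` so that its sheaf is a maximal subsheaf of that of `N`, the condition
on the Hilbert polynomials holds, and the cokernel of `P → N` is `I_D(k)`. -/
structure IsConstructedFrom {K : Type u} [Field K] {r : ℕ} (D X : ClosedSubscheme K r) (s c : ℕ)
    (F : GradedFreeComplex K r) (P : Submodule (CoordRing K r) (F.ι → CoordRing K r))
    (k : ℤ) : Prop where
  X_acm : X.IsACM
  X_codim : X.HasCodim c
  three_le : 3 ≤ c
  le_dim : c ≤ r
  two_le : 2 ≤ s
  lt_codim : s < c
  resolution : F.IsMinimalFreeResolution X.ideal c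
  N_graded : IsGradedSubmodule F.deg (F.syzygy (c - s))
  N_torsionFree : Module.IsTorsionFree (CoordRing K r) (F.syzygy (c - s))
  N_pd : pd (F.syzygy (c - s)) ≤ pd P + 1
  P_graded : IsGradedSubmodule F.deg P
  P_torsionFree : Module.IsTorsionFree (CoordRing K r) P
  P_pd : pd P = ((s - 2 : ℕ) : WithBot ℕ∞)
  hilbert : HilbertCondition F.deg (F.syzygy (c - s)) P s k
  maximal : IsMaximalSubsheaf F.deg P (F.syzygy (c - s))
  exactSequence : HasExactSequence F.deg P (F.syzygy (c - s)) D.ideal k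
  D_acm : D.IsACM
  D_codim : D.HasCodim s

end ProjACM
end

open ProjACM

noncomputable section

namespace ProjACM

universe u

/-! ### Grade through vanishing of Ext, and dimension shifting -/

section HomologicalAlgebra

open CategoryTheory CategoryTheory.Abelian

variable {R : Type u} [CommRing R]

/-! Regularity. The resolution `H` has length `s`, so dimension shifting gives `R/I_D` grade at
least `r+1-s` at every closed point (`extVanishes_quotient`). Cutting by the `t` forms lowers the
dimension by `t`, the largest possible drop. If some `f_j` were a zero divisor modulo `I_D` and the
earlier forms, it would lie in an associated prime, and by unmixedness the remaining forms could not
lower the dimension far enough (`IsHomogeneousIdeal.regular_of_ringKrullDim_lt`). So the forms are a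
regular sequence on `R/I_D` (`mem_partialIdeal_of_mul_mem`).

Resolution of `X`. Adding one form at a time is a mapping cone, so `G = H ⊗ Koszul` is exact in
positive degrees (`exists_koszulδ_eq`). It resolves `I_D + (f)`. That ideal has grade at least
`r+1-s-t ≥ 1`, hence is saturated and equals `I_X`. The same grade bound at all points shows that
`X` is ACM.

The sequence `0 → P → N → I_D(k) → 0`. The components with `j = t` form the quotient complex `H ⊗
⋀^t F`, a shifted and twisted copy of `H`, with kernel `G'`. By exactness `N = δ(G_{t+1})`, and its
coordinate at the generator of `H_0 ⊗ ⋀^t F` runs through `I_D` (`map_proj_map_tensor_δ`). If that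
coordinate vanishes, the top component of the chain is a cycle of `H`, hence a boundary; subtracting
a boundary of `G` moves the chain into `G'` (`exists_mem_koszulLower`). So the kernel is `P`, and
the same correction makes `G'` exact from degree `t+1` on.

Consequences. `G'` gives a minimal resolution of `P` of length `s-2`, its last term containing `H_s
⊗ ⋀^{t-1} F ≠ 0`. Additivity turns the polynomial in item 3 into the Hilbert polynomial of `R/I_D`,
whose degree is found by cutting with regular linear forms. Maximality holds because `N/P` is an
ideal in a domain, so enlarging `P` inside `N` raises the rank. -/

/-- `Ext^i(R/I, M) = 0` for all `i < n`: the grade of `I` on `M` is at least `n`. -/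
def ExtVanishes (I : Ideal R) (M : Type u) [AddCommGroup M] [Module R M] (n : ℕ) : Prop :=
  ∀ i < n, Subsingleton (Ext (ModuleCat.of R (R ⧸ I)) (ModuleCat.of R M) i)

variable {I : Ideal R} {A B C M : Type u} [AddCommGroup A] [Module R A] [AddCommGroup B]
  [Module R B] [AddCommGroup C] [Module R C] [AddCommGroup M] [Module R M]

lemma ExtVanishes.mono {m n : ℕ} (h : ExtVanishes I M n) (hmn : m ≤ n) : ExtVanishes I M m :=
  fun i hi => h i (hi.trans_le hmn)

lemma ExtVanishes.of_subsingleton [Subsingleton M] (n : ℕ) : ExtVanishes I M n := by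
  intro i _
  have h0 : Limits.IsZero (ModuleCat.of R M) := ModuleCat.isZero_of_subsingleton _
  refine ⟨fun a b => ?_⟩
  have h (c : Ext (ModuleCat.of R (R ⧸ I)) (ModuleCat.of R M) i) : c = 0 := by
    rw [← c.comp_mk₀_id, (Limits.IsZero.iff_id_eq_zero _).1 h0, Ext.mk₀_zero, Ext.comp_zero]
  rw [h a, h b]

/-- The short complex of modules attached to an exact pair of linear maps. -/
abbrev shortComplexOfExact (f : A →ₗ[R] B) (g : B →ₗ[R] C)
    (h : LinearMap.range f = LinearMap.ker g) :
    ShortComplex (ModuleCat.{u} R) :=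
  ShortComplex.mk (ModuleCat.ofHom f) (ModuleCat.ofHom g) (by
    rw [← ModuleCat.ofHom_comp, LinearMap.range_le_ker_iff.1 h.le]; rfl)

lemma shortExact_shortComplexOfExact {f : A →ₗ[R] B} {g : B →ₗ[R] C}
    (h : LinearMap.range f = LinearMap.ker g) (hf : Function.Injective f)
    (hg : Function.Surjective g) : (shortComplexOfExact f g h).ShortExact where
  exact := (ShortComplex.ShortExact.moduleCat_exact_iff_function_exact _).2
    (LinearMap.exact_iff.2 h.symm)
  mono_f := (ModuleCat.mono_iff_injective _).2 hf
  epi_g := (ModuleCat.epi_iff_surjective _).2 hg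

/-- Long exact sequence: `Ext^i(B) → Ext^i(C) → Ext^{i+1}(A)`. -/
lemma ExtVanishes.of_exact {n : ℕ} {f : A →ₗ[R] B} {g : B →ₗ[R] C}
    (h : LinearMap.range f = LinearMap.ker g) (hf : Function.Injective f)
    (hg : Function.Surjective g) (hB : ExtVanishes I B n) (hA : ExtVanishes I A (n + 1)) :
    ExtVanishes I C n := by
  intro i hi
  have hS := shortExact_shortComplexOfExact h hf hg
  refine ⟨fun a b => ?_⟩
  have key (c : Ext (ModuleCat.of R (R ⧸ I)) (ModuleCat.of R C) i) : c = 0 := by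
    obtain ⟨x, hx⟩ := Ext.covariant_sequence_exact₃ _ hS c (n₁ := i + 1) rfl
      ((hA (i + 1) (by omega)).elim _ _)
    rw [← hx, (hB i hi).elim x 0, Ext.zero_comp]
  rw [key a, key b]

/-- Apply `of_exact` to multiplication by `a` on `R/J`, whose cokernel is `R/J'`. The element `a`
need not lie in `I`. -/
lemma ExtVanishes.quotient_of_regular {n : ℕ} {J J' : Ideal R} {a : R}
    (h : ExtVanishes I (R ⧸ J) (n + 1)) (ha : ∀ g, a * g ∈ J → g ∈ J)
    (hJ' : J' = J ⊔ Ideal.span {a}) : ExtVanishes I (R ⧸ J') n := by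
  have hle : J ≤ J' := hJ' ▸ le_sup_left
  refine ExtVanishes.of_exact (A := R ⧸ J) (B := R ⧸ J) (f := a • LinearMap.id)
    (g := Submodule.factor hle) ?_ ?_ (Submodule.factor_surjective hle) (h.mono (by omega)) h
  · ext x
    obtain ⟨x, rfl⟩ := Submodule.Quotient.mk_surjective _ x
    rw [LinearMap.mem_ker]
    have h1 : (Submodule.factor hle) (Submodule.Quotient.mk x) = Submodule.Quotient.mk x := rfl
    rw [h1, Submodule.Quotient.mk_eq_zero, hJ', LinearMap.mem_range]
    constructor
    · rintro ⟨y, hy⟩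
      obtain ⟨y, rfl⟩ := Submodule.Quotient.mk_surjective _ y
      have h2 : Submodule.Quotient.mk (a * y) = (Submodule.Quotient.mk x : R ⧸ J) := hy
      rw [Submodule.Quotient.eq] at h2
      have h3 : x = -(a * y - x) + y * a := by ring
      rw [h3]
      exact Submodule.add_mem_sup (J.neg_mem h2) (Ideal.mul_mem_left _ _ (Ideal.subset_span rfl))
    · intro hx
      obtain ⟨j, hj, c, hc, rfl⟩ := Submodule.mem_sup.1 hx
      obtain ⟨c, rfl⟩ := Ideal.mem_span_singleton'.1 hc
      refine ⟨Submodule.Quotient.mk c, ?_⟩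
      change Submodule.Quotient.mk (a * c) = (Submodule.Quotient.mk _ : R ⧸ J)
      rw [Submodule.Quotient.eq]
      have h3 : a * c - (j + c * a) = - j := by ring
      rw [h3]
      exact J.neg_mem hj
  · rw [← LinearMap.ker_eq_bot, LinearMap.ker_eq_bot']
    intro x hx
    obtain ⟨x, rfl⟩ := Submodule.Quotient.mk_surjective _ x
    have h2 : (Submodule.Quotient.mk (a * x) : R ⧸ J) = 0 := hx
    rw [Submodule.Quotient.mk_eq_zero] at h2 ⊢
    exact ha x h2

lemma notMem_associatedPrimes_of_extVanishes [IsNoetherianRing R] [I.IsMaximal] {n : ℕ}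
    (h : ExtVanishes I M n) (hn : 1 ≤ n) : I ∉ associatedPrimes R M := by
  intro hI
  have h0 := h 0 hn
  have h1 : Subsingleton ((R ⧸ I) →ₗ[R] M) :=
    ((Ext.addEquiv₀ (X := ModuleCat.of R (R ⧸ I)) (Y := ModuleCat.of R M)).trans
      ModuleCat.homAddEquiv).symm.subsingleton
  obtain ⟨f, hf⟩ := (isAssociatedPrime_iff_exists_injective_linearMap I M).1
    (AssociatedPrimes.mem_iff.1 hI) |>.2
  have h2 : f 1 = f 0 := by rw [Subsingleton.elim f 0]; rfl
  exact one_ne_zero (hf h2)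

/-- Exactness in the middle of `0 → W ∩ ker δ → W → δ W → 0`. -/
lemma exact_inclusion_submoduleMap (δ : M →ₗ[R] M) {W Z : Submodule R M}
    (hZ : W ⊓ LinearMap.ker δ = Z) :
    LinearMap.range (Submodule.inclusion (hZ ▸ inf_le_left : Z ≤ W)) =
      LinearMap.ker (δ.submoduleMap W) := by
  rw [Submodule.range_inclusion]
  ext ⟨x, hx⟩
  rw [Submodule.mem_comap, LinearMap.mem_ker, ← hZ, Subtype.ext_iff]
  simp [hx]

/-! ### Dimension shifting along an exact chain of submodules with one differential -/

section Chain

variable {δ : M →ₗ[R] M} {F : ℕ → Submodule R M} {n₀ L : ℕ}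

/-- Descending induction from the zero module at `L + 1`: each step back through the chain costs one
unit of grade. -/
lemma extVanishes_map_of_chain {N : ℕ} (hF : ∀ n, ExtVanishes I (F n) N)
    (hex : ∀ n, n₀ ≤ n → F n ⊓ LinearMap.ker δ = (F (n + 1)).map δ)
    (hL : F (L + 1) = ⊥) (m n : ℕ) (hn : n₀ ≤ n) (hm : n + m = L + 1) :
    ExtVanishes I ((F n).map δ) (N + 1 - m) := by
  induction m generalizing n with
  | zero =>
    obtain rfl : n = L + 1 := by omega
    rw [hL, Submodule.map_bot]
    exact .of_subsingleton _
  | succ m ih =>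
    -- For `m > N` the truncated difference is `0` and the claim is empty.
    by_cases hmN : m ≤ N
    · refine ExtVanishes.of_exact (exact_inclusion_submoduleMap δ (hex n hn))
        (Submodule.inclusion_injective _) (δ.submoduleMap_surjective _)
        ((hF n).mono (by omega)) ?_
      have := ih (n + 1) (by omega) (by omega)
      rwa [show N + 1 - (m + 1) + 1 = N + 1 - m by omega]
    · intro i hi
      omega

lemma hasProjectiveDimensionLT_map_of_chain (hF : ∀ n, Module.Projective R (F n))
    (hex : ∀ n, n₀ ≤ n → F n ⊓ LinearMap.ker δ = (F (n + 1)).map δ)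
    (hL : F (L + 1) = ⊥) (m n : ℕ) (hn : n₀ ≤ n) (hm : n + m = L + 1) :
    HasProjectiveDimensionLT (ModuleCat.of R ((F n).map δ)) m := by
  induction m generalizing n with
  | zero =>
    obtain rfl : n = L + 1 := by omega
    rw [hL, Submodule.map_bot]
    exact (ModuleCat.isZero_of_subsingleton _).hasProjectiveDimensionLT_zero
  | succ m ih =>
    have hS := shortExact_shortComplexOfExact (exact_inclusion_submoduleMap δ (hex n hn))
        (Submodule.inclusion_injective _) (δ.submoduleMap_surjective _)
    have := hF n
    have hP : Projective (ModuleCat.of R (F n)) := inferInstance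
    exact hS.hasProjectiveDimensionLT_X₃ m (ih (n + 1) (by omega) (by omega))
      (hasProjectiveDimensionLT_of_ge _ 1 _ (by omega))

/-- Over a domain, the kernel of a minimal surjection onto a projective module vanishes. -/
lemma subsingleton_of_projective_of_range_le_smul [IsDomain R] [Module.Finite R A]
    [Module.IsTorsionFree R A] [Module.Projective R C] (hI : I ≠ ⊤) {f : A →ₗ[R] B} {g : B →ₗ[R] C}
    (h : LinearMap.range f = LinearMap.ker g) (hf : Function.Injective f)
    (hg : Function.Surjective g) (hmin : LinearMap.range f ≤ I • ⊤) : Subsingleton A := by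
  obtain ⟨σ, hσ⟩ := Module.projective_lifting_property g LinearMap.id hg
  have hσ' (c) : g (σ c) = c := LinearMap.congr_fun hσ c
  let φ : B →ₗ[R] LinearMap.range f := LinearMap.codRestrict _ (LinearMap.id - σ ∘ₗ g) (by
    intro b
    rw [h, LinearMap.mem_ker]
    simp [hσ'])
  let ρ : B →ₗ[R] A := (LinearEquiv.ofInjective f hf).symm.toLinearMap ∘ₗ φ
  have hρ (a : A) : ρ (f a) = a := by
    have h1 : g (f a) = 0 := by
      rw [← LinearMap.mem_ker, ← h]
      exact ⟨a, rfl⟩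
    have h2 : φ (f a) = LinearEquiv.ofInjective f hf a := by
      ext
      simp [φ, h1]
    simp [ρ, h2]
  -- The splitting `σ` gives a retraction `ρ` of `f`; it carries `I • B` into `I • A`, so minimality
  -- yields `A = I • A`. By Nakayama some `x ≡ 1` modulo `I` kills `A`; as `I ≠ ⊤`, `x ≠ 0`, and
  -- torsion-freeness gives `A = 0`.
  have htop : (⊤ : Submodule R A) ≤ I • ⊤ := by
    intro a _
    have h1 : ρ (f a) ∈ (I • (⊤ : Submodule R B)).map ρ :=
      Submodule.mem_map_of_mem (hmin ⟨a, rfl⟩)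
    rw [hρ, Submodule.map_smul''] at h1
    exact Submodule.smul_mono le_rfl le_top h1
  obtain ⟨x, hx, hx0⟩ := Submodule.exists_sub_one_mem_and_smul_eq_zero_of_fg_of_le_smul I
    (⊤ : Submodule R A) Module.Finite.fg_top htop
  have hx1 : x ≠ 0 := by
    rintro rfl
    rw [zero_sub] at hx
    exact hI ((Ideal.eq_top_iff_one I).2 (by simpa using I.neg_mem hx))
  refine subsingleton_of_forall_eq 0 fun a => ?_
  exact (smul_eq_zero_iff_right hx1).1 (hx0 a trivial)

/-- Minimality makes the bound of `hasProjectiveDimensionLT_map_of_chain` sharp. Shifting leads to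
the last step, where projectivity of `δ(F (L-1))` would force `δ(F L) = 0`; but `δ` is injective on
the nonzero module `F L`. -/
lemma not_hasProjectiveDimensionLT_map_of_chain [IsDomain R] [Module.IsTorsionFree R M]
    [IsNoetherian R M] (hI : I ≠ ⊤) (hF : ∀ n, Module.Projective R (F n))
    (hex : ∀ n, n₀ ≤ n → F n ⊓ LinearMap.ker δ = (F (n + 1)).map δ)
    (hmin : ∀ n, n₀ ≤ n → (F (n + 1)).map δ ≤ I • F n)
    (hL : F (L + 1) = ⊥) (hL0 : F L ≠ ⊥) (m n : ℕ) (hn : n₀ ≤ n) (hm : n + m = L) :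
    ¬ HasProjectiveDimensionLT (ModuleCat.of R ((F n).map δ)) m := by
  have hZ (hL' : n₀ ≤ L) : ¬ Subsingleton ((F L).map δ) := by
    intro h
    apply hL0
    rw [Submodule.subsingleton_iff_eq_bot, ← le_bot_iff, Submodule.map_le_iff_le_comap] at h
    have := hex L hL'
    rw [hL, Submodule.map_bot] at this
    exact eq_bot_iff.2 (this ▸ le_inf le_rfl h)
  induction m using Nat.strong_induction_on generalizing n with
  | _ m ih =>
    intro hpd
    have hex' := exact_inclusion_submoduleMap δ (hex n hn)
    have hinj := Submodule.inclusion_injective (hex n hn ▸ inf_le_left : (F (n + 1)).map δ ≤ F n)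
    have hsurj := δ.submoduleMap_surjective (F n)
    have := hF n
    match m, hpd with
    | 0, hpd =>
      obtain rfl : n = L := by omega
      exact hZ hn (ModuleCat.isZero_iff_subsingleton.1
        (isZero_of_hasProjectiveDimensionLT_zero (ModuleCat.of R ((F n).map δ))))
    | 1, hpd =>
      obtain rfl : L = n + 1 := by omega
      have h1 : Projective (ModuleCat.of R ((F n).map δ)) := inferInstance
      have h2 : Module.Projective R ((F n).map δ) := (IsProjective.iff_projective _).2 h1
      refine hZ (by omega) (subsingleton_of_projective_of_range_le_smul hI hex' hinj hsurj ?_)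
      rw [Submodule.range_inclusion]
      intro x hx
      have h3 : (x : M) ∈ I • F n := hmin n hn hx
      have h4 : (I • (⊤ : Submodule R (F n))).map (F n).subtype = I • F n := by
        rw [Submodule.map_smul'', Submodule.map_top, Submodule.range_subtype]
      rw [← h4] at h3
      obtain ⟨y, hy, hyx⟩ := h3
      rwa [← Subtype.ext hyx]
    | m + 2, hpd =>
      have hS := shortExact_shortComplexOfExact hex' hinj hsurj
      have hP : Projective (ModuleCat.of R (F n)) := inferInstance
      exact ih (m + 1) (by omega) (n + 1) (by omega) (by omega)
        ((hS.hasProjectiveDimensionLT_X₃_iff m hP).1 hpd)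

end Chain

end HomologicalAlgebra

/-! ### Regular sequences, depth and points of affine space -/

section Depth

open CategoryTheory CategoryTheory.Abelian RingTheory.Sequence

lemma support_quotient_self {R : Type u} [CommRing R] (I : Ideal R) :
    Module.support R (R ⧸ I) = PrimeSpectrum.zeroLocus I := by
  rw [Module.support_eq_zeroLocus, Ideal.annihilator_quotient]

/-- Rees's theorem, the direction from Ext to regular sequences. -/
lemma ExtVanishes.exists_isWeaklyRegular {R : Type u} [CommRing R] [IsNoetherianRing R]
    {I : Ideal R} {M : Type u} [AddCommGroup M] [Module R M] [Module.Finite R M] {n : ℕ}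
    (h : ExtVanishes I M n) (hI : I • (⊤ : Submodule R M) < ⊤) :
    ∃ l : List R, l.length = n ∧ (∀ a ∈ l, a ∈ I) ∧ IsWeaklyRegular M l := by
  obtain ⟨l, h1, h2, h3⟩ := ModuleCat.exists_isRegular_of_exists_subsingleton_ext I n
    (ModuleCat.of R M) hI (ModuleCat.of R (R ⧸ I)) (support_quotient_self I) h
  exact ⟨l, h1, h2, h3.1⟩

lemma localDepth_le_ringKrullDim (A : Type u) [CommRing A] [IsLocalRing A] [IsNoetherianRing A] :
    (localDepth A : WithBot ℕ∞) ≤ ringKrullDim A := by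
  obtain ⟨d, hd⟩ : ∃ d : ℕ∞, ringKrullDim A = d :=
    ⟨_, (WithBot.coe_unbot _ ringKrullDim_ne_bot).symm⟩
  rw [hd, WithBot.coe_le_coe, localDepth]
  refine iSup₂_le fun l hl => ?_
  have h1 := ringKrullDim_add_length_eq_ringKrullDim_of_isRegular l hl.1
  have h2 : Nontrivial (A ⧸ Ideal.ofList l) := by
    refine Ideal.Quotient.nontrivial_iff.2 fun h => hl.1.2 ?_
    rw [h]; simp
  have h3 : (0 : WithBot ℕ∞) ≤ ringKrullDim (A ⧸ Ideal.ofList l) :=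
    ringKrullDim_nonneg_of_nontrivial
  rw [hd] at h1
  rw [← WithBot.coe_le_coe, ← h1]
  exact le_add_of_nonneg_left h3

lemma smul_top_quotient_lt_top {R : Type u} [CommRing R] {m J : Ideal R} [m.IsPrime] (hJ : J ≤ m) :
    m • (⊤ : Submodule R (R ⧸ J)) < ⊤ := by
  rw [lt_top_iff_ne_top]
  intro htop
  have h1 : (m • (⊤ : Submodule R (R ⧸ J))) ≤ Submodule.map J.mkQ m := by
    rw [Submodule.smul_le]
    intro a ha b _
    obtain ⟨b, rfl⟩ := Submodule.Quotient.mk_surjective _ b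
    exact ⟨a * b, m.mul_mem_right _ ha, rfl⟩
  have h2 : (Submodule.Quotient.mk 1 : R ⧸ J) ∈ Submodule.map J.mkQ m := h1 (by rw [htop]; trivial)
  obtain ⟨b, hb, hb1⟩ := h2
  have h3 : b - 1 ∈ m := hJ ((Submodule.Quotient.eq J).1 hb1)
  exact Ideal.IsPrime.ne_top' ((Ideal.eq_top_iff_one m).2
    (by simpa using m.sub_mem hb h3))

/-- Grade at least the dimension at all maximal ideals makes `R/J` Cohen–Macaulay. -/
lemma isCohenMacaulayRing_quotient {R : Type u} [CommRing R] [IsNoetherianRing R] {J : Ideal R}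
    {e : ℕ} (hdim : ringKrullDim (R ⧸ J) ≤ e)
    (h : ∀ m : Ideal R, m.IsMaximal → J ≤ m → ExtVanishes m (R ⧸ J) e) :
    IsCohenMacaulayRing (R ⧸ J) := by
  intro M hM
  have hmax : (M.comap (Ideal.Quotient.mk J)).IsMaximal :=
    Ideal.comap_isMaximal_of_surjective _ Ideal.Quotient.mk_surjective
  have hJ : J ≤ M.comap (Ideal.Quotient.mk J) := by
    intro x hx
    rw [Ideal.mem_comap, Ideal.Quotient.eq_zero_iff_mem.2 hx]
    exact M.zero_mem
  obtain ⟨l, hl, hlm, hreg⟩ := (h _ hmax hJ).exists_isWeaklyRegular (smul_top_quotient_lt_top hJ)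
  have hreg' : IsWeaklyRegular (R ⧸ J) (l.map (algebraMap R (R ⧸ J))) :=
    (isWeaklyRegular_map_algebraMap_iff _ _ _).2 hreg
  have hmem : ∀ a ∈ l.map (algebraMap R (R ⧸ J)), a ∈ M := by
    intro a ha
    obtain ⟨b, hb, rfl⟩ := List.mem_map.1 ha
    exact hlm b hb
  have hreg2 := hreg'.isRegular_of_isLocalization_of_mem (Localization.AtPrime M) M hmem
  refine le_antisymm (localDepth_le_ringKrullDim _) ?_
  -- The chain is `dim A_M = ht M ≤ dim R/J ≤ e ≤ depth A_M`, the last inequality from the localized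
  -- regular sequence.
  rw [IsLocalization.AtPrime.ringKrullDim_eq_height M]
  refine ((Ideal.height_le_ringKrullDim_of_ne_top hM.ne_top).trans hdim).trans ?_
  have h3 : (e : ℕ∞) ≤ localDepth (Localization.AtPrime M) := by
    refine le_iSup₂_of_le _ ⟨hreg2, ?_⟩ ?_
    · intro a ha
      obtain ⟨b, hb, rfl⟩ := List.mem_map.1 ha
      exact (IsLocalization.AtPrime.to_map_mem_maximal_iff _ M b).2 (hmem b hb)
    · simp [hl]
  exact_mod_cast WithBot.coe_le_coe.2 h3

section PolynomialRing

variable {K : Type u} [Field K] {r : ℕ}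

/-- The maximal ideal of the point `a`. -/
def pointIdeal (a : Fin (r + 1) → K) : Ideal (CoordRing K r) := RingHom.ker (eval a)

lemma X_sub_C_mem_pointIdeal (a : Fin (r + 1) → K) (i : Fin (r + 1)) :
    X i - C (a i) ∈ pointIdeal a := by
  simp [pointIdeal, RingHom.mem_ker]

/-- Substituting `a_i` for the first `k` variables is an endomorphism `φ` of `R` whose kernel is
generated by the first `k` elements, since `φ` is the identity modulo them. As `φ` sends the next
element to the nonzero `X_k - a_k` of a domain, that element is regular. -/
lemma isWeaklyRegular_X_sub_C (a : Fin (r + 1) → K) :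
    IsWeaklyRegular (CoordRing K r) (List.ofFn fun i => (X i - C (a i) : CoordRing K r)) := by
  set l := List.ofFn fun i => (X i - C (a i) : CoordRing K r) with hl
  refine ⟨fun k hk => ?_⟩
  have hk' : k < r + 1 := by simpa [hl] using hk
  let φ : CoordRing K r →ₐ[K] CoordRing K r :=
    aeval fun i => if (i : ℕ) < k then C (a i) else X i
  have hφX (i : Fin (r + 1)) : φ (X i) = if (i : ℕ) < k then C (a i) else X i := by simp [φ]
  have hφC (c : K) : φ (C c) = C c := φ.commutes c
  have hmem (i : Fin (r + 1)) (hi : (i : ℕ) < k) :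
      (X i - C (a i) : CoordRing K r) ∈ Ideal.ofList (l.take k) := by
    refine Ideal.subset_span ?_
    refine List.mem_take_iff_getElem.2 ⟨i, by rw [hl, List.length_ofFn]; omega,
      by simp only [hl, List.getElem_ofFn]⟩
  have hker : Ideal.ofList (l.take k) = RingHom.ker φ.toRingHom := by
    apply le_antisymm
    · refine Ideal.span_le.2 fun x hx => ?_
      obtain ⟨i, hi, rfl⟩ := List.mem_take_iff_getElem.1 hx
      have hi' : i < k := by simp at hi; omega
      have hi2 : i < r + 1 := by omega
      simp only [hl, List.getElem_ofFn]
      change φ _ = 0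
      rw [map_sub, hφX, hφC, if_pos hi', sub_self]
    · intro g hg
      have h1 : (Ideal.Quotient.mkₐ K (Ideal.ofList (l.take k))).comp φ =
          Ideal.Quotient.mkₐ K (Ideal.ofList (l.take k)) := by
        refine algHom_ext fun i => ?_
        rw [AlgHom.comp_apply, hφX]
        split_ifs with hi
        · have := Ideal.Quotient.eq.2 (hmem i hi)
          exact this.symm
        · rfl
      have h2 := DFunLike.congr_fun h1 g
      have h3 : φ g = 0 := hg
      rw [AlgHom.comp_apply, h3, map_zero] at h2
      exact Ideal.Quotient.eq_zero_iff_mem.1 h2.symm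
  rw [isSMulRegular_quotient_iff_mem_of_smul_mem]
  intro g hg
  rw [smul_eq_mul, Ideal.mul_top, hker] at hg ⊢
  have h1 : φ (l[k] * g) = 0 := hg
  have h2 : φ l[k] = X ⟨k, hk'⟩ - C (a ⟨k, hk'⟩) := by
    simp only [hl, List.getElem_ofFn]
    rw [map_sub, hφX, hφC, if_neg (by simp)]
  rw [map_mul, h2, mul_eq_zero] at h1
  refine h1.resolve_left fun h0 => ?_
  have h3 := congrArg (coeff (Finsupp.single (⟨k, hk'⟩ : Fin (r + 1)) 1)) h0
  have h4 : (0 : Fin (r + 1) →₀ ℕ) ≠ Finsupp.single (⟨k, hk'⟩ : Fin (r + 1)) 1 := by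
    exact (Finsupp.single_ne_zero.2 one_ne_zero).symm
  simp [coeff_C, coeff_X, h4] at h3

/-- The other direction of Rees's theorem, applied to the `r + 1` elements `X_i - a_i`. -/
lemma extVanishes_pointIdeal_of_free (a : Fin (r + 1) → K) (M : Type u) [AddCommGroup M]
    [Module (CoordRing K r) M] [Module.Free (CoordRing K r) M] [Module.Finite (CoordRing K r) M] :
    ExtVanishes (pointIdeal a) M (r + 1) := by
  rcases subsingleton_or_nontrivial M with hM | hM
  · exact .of_subsingleton _
  have hne : pointIdeal a ≠ ⊤ := by
    rw [Ne, Ideal.eq_top_iff_one]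
    simp [pointIdeal, RingHom.mem_ker]
  have hlt : pointIdeal a • (⊤ : Submodule (CoordRing K r) M) < ⊤ := by
    rw [lt_top_iff_ne_top]
    intro htop
    let b := Module.Free.chooseBasis (CoordRing K r) M
    have : Nonempty (Module.Free.ChooseBasisIndex (CoordRing K r) M) := b.index_nonempty
    let i := Classical.arbitrary (Module.Free.ChooseBasisIndex (CoordRing K r) M)
    have h1 : b i ∈ pointIdeal a • (⊤ : Submodule (CoordRing K r) M) := by rw [htop]; trivial
    have h2 := Submodule.mem_map_of_mem (f := b.coord i) h1
    rw [Submodule.map_smul''] at h2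
    have h3 := Submodule.smul_mono (le_refl (pointIdeal a)) le_top h2
    rw [smul_eq_mul, Ideal.mul_top, Module.Basis.coord_apply, Module.Basis.repr_self,
      Finsupp.single_eq_same] at h3
    exact hne ((Ideal.eq_top_iff_one _).2 h3)
  set l := List.ofFn fun i => (X i - C (a i) : CoordRing K r) with hl
  have hmem : ∀ x ∈ l, x ∈ pointIdeal a := by
    intro x hx
    obtain ⟨i, rfl⟩ := (List.mem_ofFn' _ _).1 hx
    exact X_sub_C_mem_pointIdeal a i
  have hreg : IsWeaklyRegular M l :=
    ((TensorProduct.rid (CoordRing K r) M).isWeaklyRegular_congr l).1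
      (isWeaklyRegular_X_sub_C a).isWeaklyRegular_lTensor
  have hreg' : IsRegular M l := by
    refine ⟨hreg, fun htop => hlt.ne (top_le_iff.1 ?_)⟩
    exact htop.le.trans (Submodule.smul_mono (Ideal.span_le.2 hmem) le_rfl)
  have := ModuleCat.subsingleton_ext_of_exists_isRegular (pointIdeal a)
    (ModuleCat.of (CoordRing K r) (CoordRing K r ⧸ pointIdeal a))
    (support_quotient_self _).subset (ModuleCat.of (CoordRing K r) M) hlt l hmem hreg'
  simpa [hl, ExtVanishes] using this

/-- Nullstellensatz: the Cohen–Macaulay property need only be tested at points. -/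
lemma exists_eq_pointIdeal [IsAlgClosed K] (m : Ideal (CoordRing K r)) [hm : m.IsMaximal] :
    ∃ a, m = pointIdeal a := by
  obtain ⟨a, rfl⟩ := isMaximal_iff_eq_vanishingIdeal_singleton.1 hm
  refine ⟨a, ?_⟩
  ext p
  rw [mem_vanishingIdeal_singleton_iff]
  simp [pointIdeal, RingHom.mem_ker, aeval_eq_eval]

/-- The irrelevant ideal `(x_0, …, x_r)`. -/
def irrelevantIdeal (K : Type u) [Field K] (r : ℕ) : Ideal (CoordRing K r) :=
  RingHom.ker (constantCoeff : CoordRing K r →+* K)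

lemma mem_irrelevantIdeal {g : CoordRing K r} :
    g ∈ irrelevantIdeal K r ↔ constantCoeff g = 0 := Iff.rfl

instance isMaximal_irrelevantIdeal : (irrelevantIdeal K r).IsMaximal :=
  RingHom.ker_isMaximal_of_surjective _ fun c => ⟨C c, constantCoeff_C _ c⟩

lemma irrelevantIdeal_eq_pointIdeal : irrelevantIdeal K r = pointIdeal 0 := by
  ext p
  rw [mem_irrelevantIdeal, pointIdeal, RingHom.mem_ker, constantCoeff_eq]
  simp [eval_zero, constantCoeff_eq]

lemma irrelevantIdeal_le {J : Ideal (CoordRing K r)} (h : ∀ i, X i ∈ J) :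
    irrelevantIdeal K r ≤ J := by
  intro g hg
  rw [mem_irrelevantIdeal] at hg
  rw [g.as_sum]
  refine Submodule.sum_mem _ fun α hα => ?_
  have hα0 : α ≠ 0 := by
    rintro rfl
    exact mem_support_iff.1 hα hg
  obtain ⟨i, hi⟩ := Finsupp.ne_iff.1 hα0
  rw [← mul_one (coeff α g), ← C_mul_monomial]
  refine J.mul_mem_left _ ?_
  have h1 : α = Finsupp.single i 1 + (α - Finsupp.single i 1) := by
    rw [add_tsub_cancel_of_le]
    rw [Finsupp.single_le_iff]
    exact Nat.one_le_iff_ne_zero.2 hi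
  rw [h1, ← one_mul (1 : K), ← monomial_mul]
  exact J.mul_mem_right _ (h i)

end PolynomialRing

end Depth

/-! ### Associated primes and dimension of modules of given grade -/

section AssociatedPrimes

open RingTheory.Sequence

variable {R : Type u} [CommRing R] [IsNoetherianRing R]

/-- A prime inside `m` that is minimal over the annihilator of `z` is associated to `R z`. -/
lemma exists_mem_associatedPrimes_le {M : Type u} [AddCommGroup M] [Module R M]
    {m : Ideal R} [m.IsPrime] {z : M} (hz : ∀ u : R, u • z = 0 → u ∈ m) :
    ∃ q ∈ associatedPrimes R M, q ≤ m ∧ ∀ u : R, u • z = 0 → u ∈ q := by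
  have hann : Module.annihilator R (R ∙ z) ≤ m := by
    intro u hu
    exact hz u ((Submodule.mem_annihilator_span_singleton z u).1 hu)
  obtain ⟨q, hq, hqm⟩ := Ideal.exists_minimalPrimes_le hann
  refine ⟨q, ?_, hqm, fun u hu => hq.1.2 ((Submodule.mem_annihilator_span_singleton z u).2 hu)⟩
  exact associatedPrimes.subset_of_injective (Submodule.injective_subtype _)
    (Module.associatedPrimes.minimalPrimes_annihilator_subset_associatedPrimes R (R ∙ z) hq)

/-- An associated prime `p ⊆ m` of `M` is contained in an associated prime `q ⊆ m` of `M/aM`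
containing `a`, if `a ∈ m` is regular on `M`. -/
lemma exists_mem_associatedPrimes_quotSMulTop {M : Type u} [AddCommGroup M] [Module R M]
    [Module.Finite R M] {m p : Ideal R} [m.IsPrime] {a : R} (ha : a ∈ m) (hreg : IsSMulRegular M a)
    (hp : p ∈ associatedPrimes R M) (hpm : p ≤ m) :
    ∃ q ∈ associatedPrimes R (QuotSMulTop a M), p ≤ q ∧ a ∈ q ∧ q ≤ m := by
  obtain ⟨hpp, x, hx⟩ := (isAssociatedPrime_iff (I := p) (M := M)).1 (AssociatedPrimes.mem_iff.1 hp)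
  -- The argument takes place in the submodule `N` of elements killed by `p`, which contains `x`.
  -- Any associated prime found from a class of `N/aN` then contains `p`.
  have hx' (u : R) : u ∈ p ↔ u • x = 0 := by
    rw [hx, Submodule.mem_colon_singleton, Submodule.mem_bot]
  let N : Submodule R M := Submodule.torsionBySet R M p
  have hN {y : M} : y ∈ N ↔ ∀ c ∈ p, c • y = 0 := by
    rw [Submodule.mem_torsionBySet_iff]
    exact ⟨fun h c hc => h ⟨c, hc⟩, fun h c => h c.1 c.2⟩
  have hxN : x ∈ N := hN.2 fun c hc => (hx' c).1 hc
  -- Nakayama: `m` lies in `supp N` and contains `a`, so it lies in `supp (N/aN)`.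
  have hsupp : (⟨m, inferInstance⟩ : PrimeSpectrum R) ∈ Module.support R (QuotSMulTop a N) := by
    rw [Module.support_quotSMulTop]
    refine ⟨Module.mem_support_iff_exists_annihilator.2 ⟨⟨x, hxN⟩, fun u hu => ?_⟩,
      by simpa using ha⟩
    rw [Submodule.mem_annihilator_span_singleton, Subtype.ext_iff] at hu
    exact hpm ((hx' u).2 hu)
  obtain ⟨y, hy⟩ := Module.mem_support_iff_exists_annihilator.1 hsupp
  obtain ⟨⟨y, hyN⟩, rfl⟩ := Submodule.Quotient.mk_surjective _ y
  -- `N/aN` embeds in `M/aM`: if `u y = a w`, then `p` kills `a w`, hence kills `w` because `a` is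
  -- regular.
  have hy' (u : R) (hu : u • (Submodule.Quotient.mk y : QuotSMulTop a M) = 0) : u ∈ m := by
    refine hy ((Submodule.mem_annihilator_span_singleton _ _).2 ?_)
    rw [← Submodule.Quotient.mk_smul, Submodule.Quotient.mk_eq_zero,
      Submodule.mem_smul_pointwise_iff_exists] at hu ⊢
    obtain ⟨w, -, hw⟩ := hu
    have hwN : w ∈ N := by
      refine hN.2 fun c hc => hreg ?_
      change a • c • w = a • 0
      rw [smul_comm, hw, smul_comm, hN.1 hyN c hc, smul_zero, smul_zero]
    exact ⟨⟨w, hwN⟩, trivial, Subtype.ext hw⟩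
  obtain ⟨q, hq, hqm, hqy⟩ := exists_mem_associatedPrimes_le hy'
  refine ⟨q, hq, fun c hc => hqy c ?_, hqy a ?_, hqm⟩
  · rw [← Submodule.Quotient.mk_smul, hN.1 hyN c hc, Submodule.Quotient.mk_zero]
  · rw [← Submodule.Quotient.mk_smul, Submodule.Quotient.mk_eq_zero]
    exact Submodule.smul_mem_pointwise_smul _ _ _ trivial

/-- Each regular element `a` leads from `p` to an associated prime `q` of the quotient with `a ∈ q \
p`, a strict step in a chain of primes below `m`. The prime `p₀` stays fixed while `p` moves, so all
heights are taken in the same ring `R/p₀`. -/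
lemma length_add_height_map_le {M : Type u} [AddCommGroup M] [Module R M]
    [Module.Finite R M] {m p p₀ : Ideal R} [m.IsPrime] {l : List R} (hl : ∀ a ∈ l, a ∈ m)
    (hreg : IsWeaklyRegular M l) (hp : p ∈ associatedPrimes R M) (hp₀ : p₀ ≤ p) (hpm : p ≤ m) :
    (l.length : ℕ∞) + (p.map (Ideal.Quotient.mk p₀)).height ≤
      (m.map (Ideal.Quotient.mk p₀)).height := by
  induction l generalizing M p with
  | nil => simpa using Ideal.height_mono (Ideal.map_mono hpm)
  | cons a l ih =>
    rw [isWeaklyRegular_cons_iff] at hreg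
    have ham : a ∈ m := hl a List.mem_cons_self
    obtain ⟨q, hq, hpq, haq, hqm⟩ := exists_mem_associatedPrimes_quotSMulTop ham hreg.1 hp hpm
    have hpP : p.IsPrime := IsAssociatedPrime.isPrime hp
    have hqP : q.IsPrime := IsAssociatedPrime.isPrime hq
    have hap : a ∉ p := by
      intro hap
      have := biUnion_associatedPrimes_eq_compl_regular R M
      have h1 : a ∈ ⋃ p ∈ associatedPrimes R M, (p : Set R) := Set.mem_biUnion hp hap
      rw [this] at h1
      exact h1 hreg.1
    have hker (I : Ideal R) (hI : p₀ ≤ I) : RingHom.ker (Ideal.Quotient.mk p₀) ≤ I := by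
      rwa [Ideal.mk_ker]
    have h1 := Ideal.map_isPrime_of_surjective Ideal.Quotient.mk_surjective (hker p hp₀)
    have h2 := Ideal.map_isPrime_of_surjective Ideal.Quotient.mk_surjective
      (hker q (hp₀.trans hpq))
    have hlt : p.map (Ideal.Quotient.mk p₀) < q.map (Ideal.Quotient.mk p₀) := by
      refine lt_of_le_of_ne (Ideal.map_mono hpq) fun heq => hap ?_
      have h3 := Ideal.mem_map_of_mem (Ideal.Quotient.mk p₀) haq
      rw [← heq, ← Ideal.mem_comap,
        Ideal.comap_map_of_surjective _ Ideal.Quotient.mk_surjective] at h3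
      refine (sup_le le_rfl ?_ : p ⊔ _ ≤ p) h3
      change RingHom.ker _ ≤ p
      exact hker p hp₀
    have h4 := ih (fun b hb => hl b (List.mem_cons_of_mem _ hb)) hreg.2 hq (hp₀.trans hpq) hqm
    refine le_trans ?_ h4
    rw [List.length_cons, Nat.cast_add, Nat.cast_one, add_assoc, add_comm 1]
    gcongr
    exact Ideal.height_add_one_le_of_lt_of_isPrime hlt

/-- If `R/J` has grade at least `n` at `m`, then cutting down an associated prime `p ⊆ m` of `R/J`
by a finite subset `S` of `m` leaves dimension at least `n - #S`. -/
lemma le_ringKrullDim_quotient_add_card {m J J' p : Ideal R} [m.IsPrime] {n : ℕ}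
    (h : ExtVanishes m (R ⧸ J) n) (hJ : J ≤ m) (hp : p ∈ associatedPrimes R (R ⧸ J)) (hpm : p ≤ m)
    (S : Finset R) (hS : (S : Set R) ⊆ m) (hJ' : J' ≤ p ⊔ Ideal.span S) :
    (n : WithBot ℕ∞) ≤ ringKrullDim (R ⧸ J') + S.card := by
  classical
  obtain ⟨l, rfl, hlm, hreg⟩ := h.exists_isWeaklyRegular (smul_top_quotient_lt_top hJ)
  have h1 := length_add_height_map_le hlm hreg hp le_rfl hpm
  have h2 : (l.length : ℕ∞) ≤ (m.map (Ideal.Quotient.mk p)).height := le_trans le_self_add h1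
  have hpr : (m.map (Ideal.Quotient.mk p)).IsPrime :=
    Ideal.map_isPrime_of_surjective Ideal.Quotient.mk_surjective (by rwa [Ideal.mk_ker])
  -- Krull's height theorem in `R/p`: killing the images of `S`, which lie in `m/p`, costs at most
  -- `#S`.
  have h3 := Ideal.height_le_ringKrullDim_quotient_add_encard
    (p := m.map (Ideal.Quotient.mk p)) (S.image (Ideal.Quotient.mk p) : Set (R ⧸ p)) (by
      rw [Finset.coe_image, Set.image_subset_iff]
      exact fun x hx => Ideal.mem_map_of_mem _ (hS hx))
  refine (WithBot.coe_le_coe.2 h2).trans (h3.trans ?_)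
  gcongr
  · let φ : R →+* (R ⧸ p) ⧸ Ideal.span (S.image (Ideal.Quotient.mk p) : Set (R ⧸ p)) :=
      (Ideal.Quotient.mk _).comp (Ideal.Quotient.mk p)
    have hφ : ∀ a ∈ J', φ a = 0 := by
      intro a ha
      have h4 : p ⊔ Ideal.span S ≤ RingHom.ker φ := by
        refine sup_le (fun b hb => ?_) (Ideal.span_le.2 fun b hb => ?_)
        · rw [RingHom.mem_ker, RingHom.comp_apply, Ideal.Quotient.eq_zero_iff_mem.2 hb, map_zero]
        · rw [SetLike.mem_coe, RingHom.mem_ker, RingHom.comp_apply, Ideal.Quotient.eq_zero_iff_mem]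
          exact Ideal.subset_span (by simpa using ⟨b, hb, rfl⟩)
      exact h4 (hJ' ha)
    exact ringKrullDim_le_of_surjective (Ideal.Quotient.lift J' φ hφ)
      (Ideal.Quotient.lift_surjective_of_surjective _ _
        (Ideal.Quotient.mk_surjective.comp Ideal.Quotient.mk_surjective))
  · have : (S.image (Ideal.Quotient.mk p) : Set (R ⧸ p)).encard ≤ (S.card : ℕ∞) := by
      rw [Set.encard_coe_eq_coe_finsetCard]
      exact_mod_cast Finset.card_image_le
    exact_mod_cast WithBot.coe_le_coe.2 this

/-- Grade is at most dimension: the case `S = ∅`, for an associated prime coming from the class of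
`1`. -/
lemma le_ringKrullDim_quotient {m J : Ideal R} [m.IsPrime] {n : ℕ}
    (h : ExtVanishes m (R ⧸ J) n) (hJ : J ≤ m) : (n : WithBot ℕ∞) ≤ ringKrullDim (R ⧸ J) := by
  obtain ⟨q, hq, hqm, hqz⟩ := exists_mem_associatedPrimes_le (M := R ⧸ J) (m := m)
    (z := Submodule.Quotient.mk 1) (fun u hu => by
      rw [← Submodule.Quotient.mk_smul, Submodule.Quotient.mk_eq_zero, smul_eq_mul, mul_one] at hu
      exact hJ hu)
  have h1 : J ≤ q := fun u hu => hqz u (by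
    rw [← Submodule.Quotient.mk_smul, Submodule.Quotient.mk_eq_zero, smul_eq_mul, mul_one]
    exact hu)
  simpa using le_ringKrullDim_quotient_add_card h hJ hq hqm ∅ (by simp) (h1.trans le_sup_left)

end AssociatedPrimes

/-! ### Homogeneous ideals, unmixedness and saturation -/

section Homogeneous

attribute [local instance] MvPolynomial.gradedAlgebra

variable {K : Type u} [Field K] {r : ℕ} {J : Ideal (CoordRing K r)}

lemma IsHomogeneousIdeal.homogeneousComponent_mem (hJ : IsHomogeneousIdeal J) {g : CoordRing K r}
    (hg : g ∈ J) (n : ℕ) : homogeneousComponent n g ∈ J := by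
  have := hJ n hg
  rwa [← MvPolynomial.decomposition.decompose'_apply]

lemma homogeneousComponent_mul_of_isHomogeneous {f : CoordRing K r} {d : ℕ} (hf : f.IsHomogeneous d)
    (n : ℕ) (g : CoordRing K r) :
    homogeneousComponent (d + n) (f * g) = f * homogeneousComponent n g := by
  have h := DirectSum.coe_decompose_mul_add_of_left_mem
    (homogeneousSubmodule (Fin (r + 1)) K) (b := g) (j := n) hf
  rw [← MvPolynomial.decomposition.decompose'_apply, ← MvPolynomial.decomposition.decompose'_apply]
  exact h

lemma IsHomogeneousIdeal.le_irrelevantIdeal (hJ : IsHomogeneousIdeal J) (hne : J ≠ ⊤) :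
    J ≤ irrelevantIdeal K r := by
  intro g hg
  by_contra h
  rw [mem_irrelevantIdeal, constantCoeff_eq] at h
  have h1 := hJ.homogeneousComponent_mem hg 0
  rw [homogeneousComponent_zero] at h1
  exact hne (Ideal.eq_top_of_isUnit_mem J h1 ((isUnit_iff_ne_zero.2 h).map C))

/-- A form that is a zero divisor modulo a homogeneous ideal `J` kills an element of `R/J` whose
annihilator consists of elements of the irrelevant ideal. -/
lemma IsHomogeneousIdeal.exists_annihilator_le (hJ : IsHomogeneousIdeal J) {f : CoordRing K r}
    {d : ℕ} (hf : f.IsHomogeneous d) {g : CoordRing K r} (hfg : f * g ∈ J) (hg : g ∉ J) :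
    ∃ z : CoordRing K r ⧸ J, f • z = 0 ∧ ∀ u : CoordRing K r, u • z = 0 →
      u ∈ irrelevantIdeal K r := by
  obtain ⟨n, hn⟩ : ∃ n, homogeneousComponent n g ∉ J := by
    by_contra! h
    apply hg
    rw [← sum_homogeneousComponent g]
    exact Submodule.sum_mem _ fun i _ => h i
  refine ⟨Submodule.Quotient.mk (homogeneousComponent n g), ?_, fun u hu => ?_⟩
  · rw [← Submodule.Quotient.mk_smul, Submodule.Quotient.mk_eq_zero, smul_eq_mul,
      ← homogeneousComponent_mul_of_isHomogeneous hf]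
    exact hJ.homogeneousComponent_mem hfg _
  · rw [← Submodule.Quotient.mk_smul, Submodule.Quotient.mk_eq_zero, smul_eq_mul] at hu
    -- The degree `n` component of `u g_n` is `u_0 g_n`; were the constant `u_0` nonzero, `g_n`
    -- would lie in `J`.
    have h1 := hJ.homogeneousComponent_mem hu (n + 0)
    rw [mul_comm,
      homogeneousComponent_mul_of_isHomogeneous (homogeneousComponent_isHomogeneous n g),
      homogeneousComponent_zero] at h1
    by_contra h
    rw [mem_irrelevantIdeal, constantCoeff_eq] at h
    exact hn ((Ideal.mul_unit_mem_iff_mem J ((isUnit_iff_ne_zero.2 h).map C)).1 h1)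

/-- Unmixedness: if `R/J` has grade at least `n` at the irrelevant ideal and `J + (f) + (S)` cuts
the dimension below `n - #S`, then the form `f` is regular modulo `J`. -/
lemma IsHomogeneousIdeal.regular_of_ringKrullDim_lt (hJ : IsHomogeneousIdeal J)
    (hJm : J ≤ irrelevantIdeal K r) {n : ℕ}
    (hext : ExtVanishes (irrelevantIdeal K r) (CoordRing K r ⧸ J) n) {f : CoordRing K r} {d : ℕ}
    (hf : f.IsHomogeneous d) (S : Finset (CoordRing K r))
    (hS : (S : Set (CoordRing K r)) ⊆ (irrelevantIdeal K r : Set (CoordRing K r)))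
    {J' : Ideal (CoordRing K r)} (hJ' : J' ≤ J ⊔ Ideal.span {f} ⊔ Ideal.span S)
    (hdim : ringKrullDim (CoordRing K r ⧸ J') + S.card < n) (g : CoordRing K r)
    (hfg : f * g ∈ J) : g ∈ J := by
  by_contra hg
  -- If `f` is a zero divisor, homogeneity puts it in an associated prime `p` inside the irrelevant
  -- ideal. Then `J'` lies in `p + (S)`, whose quotient has dimension at least `n - #S`.
  obtain ⟨z, hfz, hz⟩ := hJ.exists_annihilator_le hf hfg hg
  obtain ⟨p, hp, hpm, hpz⟩ := exists_mem_associatedPrimes_le hz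
  have hJp : J ≤ p := by
    intro u hu
    refine hpz u ?_
    obtain ⟨z, rfl⟩ := Submodule.Quotient.mk_surjective _ z
    rw [← Submodule.Quotient.mk_smul, Submodule.Quotient.mk_eq_zero]
    exact J.mul_mem_right _ hu
  have hfp : Ideal.span {f} ≤ p := (Ideal.span_singleton_le_iff_mem p).2 (hpz f hfz)
  exact hdim.not_ge (le_ringKrullDim_quotient_add_card hext hJm hp hpm S hS
    (hJ'.trans (sup_le_sup_right (sup_le hJp hfp) _)))

/-- Noetherianity makes the exponents in the definition of `saturation` uniform. -/
lemma pow_irrelevantIdeal_mul_saturation_le (J : Ideal (CoordRing K r)) :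
    ∃ n : ℕ, irrelevantIdeal K r ^ n * saturation J ≤ J := by
  have hfg : (irrelevantIdeal K r).FG := IsNoetherian.noetherian _
  have hfg' : (saturation J).FG := IsNoetherian.noetherian _
  have h1 : irrelevantIdeal K r ≤ (J.colon (saturation J)).radical := by
    refine irrelevantIdeal_le fun i => ?_
    obtain ⟨s, hs⟩ := hfg'
    have h2 : ∃ n : ℕ, ∀ g ∈ s, X i ^ n * g ∈ J := by
      have h3 (g : CoordRing K r) (hg : g ∈ s) : ∃ n : ℕ, X i ^ n * g ∈ J := by
        have : g ∈ saturation J := hs ▸ Submodule.subset_span hg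
        exact this i
      choose! n hn using h3
      refine ⟨s.sup n, fun g hg => ?_⟩
      rw [← Nat.sub_add_cancel (Finset.le_sup hg : n g ≤ s.sup n), pow_add, mul_assoc]
      exact J.mul_mem_left _ (hn g hg)
    obtain ⟨n, hn⟩ := h2
    refine ⟨n, ?_⟩
    rw [Submodule.mem_colon]
    intro g hg
    rw [SetLike.mem_coe, ← hs] at hg
    induction hg using Submodule.span_induction with
    | mem g hg => exact hn g hg
    | zero => simp
    | add x y _ _ hx hy => rw [smul_add]; exact J.add_mem hx hy
    | smul a x _ hx => rw [smul_comm]; exact J.mul_mem_left _ hx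
  obtain ⟨n, hn⟩ := Ideal.exists_pow_le_of_le_radical_of_fg h1 hfg
  refine ⟨n, Ideal.mul_le.2 fun a ha b hb => ?_⟩
  exact (Submodule.mem_colon.1 (hn ha)) b hb

/-- Positive grade provides an element of the irrelevant ideal regular on `R/J`; a power of it
carries the saturation into `J`. -/
lemma saturation_eq_of_extVanishes
    (hext : ExtVanishes (irrelevantIdeal K r) (CoordRing K r ⧸ J) 1)
    (hJm : J ≤ irrelevantIdeal K r) : saturation J = J := by
  refine le_antisymm (fun g hg => ?_) (le_saturation J)
  obtain ⟨n, hn⟩ := pow_irrelevantIdeal_mul_saturation_le J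
  obtain ⟨l, hl, hlm, hreg⟩ := hext.exists_isWeaklyRegular (smul_top_quotient_lt_top hJm)
  obtain ⟨a, rfl⟩ := List.length_eq_one_iff.1 hl
  rw [RingTheory.Sequence.isWeaklyRegular_singleton_iff] at hreg
  have h1 : a ^ n * g ∈ J := hn (Ideal.mul_mem_mul (Ideal.pow_mem_pow (hlm a (by simp)) n) hg)
  exact mem_of_isSMulRegular_quotient_of_smul_mem (hreg.pow n) h1

/-- The two zero loci can differ only at the irrelevant ideal, and `hJm` puts it in both. For `J`
primary to that ideal the saturation would be the whole ring. -/
lemma ringKrullDim_quotient_saturation (hJm : saturation J ≤ irrelevantIdeal K r) :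
    ringKrullDim (CoordRing K r ⧸ saturation J) = ringKrullDim (CoordRing K r ⧸ J) := by
  have h : PrimeSpectrum.zeroLocus (saturation J : Set (CoordRing K r)) =
      PrimeSpectrum.zeroLocus (J : Set (CoordRing K r)) := by
    refine Set.Subset.antisymm (PrimeSpectrum.zeroLocus_anti_mono (le_saturation J)) fun p hp => ?_
    obtain ⟨n, hn⟩ := pow_irrelevantIdeal_mul_saturation_le J
    have h1 : irrelevantIdeal K r ^ n * saturation J ≤ p.asIdeal := hn.trans hp
    rcases (p.2.mul_le).1 h1 with h2 | h2
    · exact hJm.trans (p.2.le_of_pow_le h2)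
    · exact h2
  rw [ringKrullDim_quotient, ringKrullDim_quotient, h]

end Homogeneous

/-! ### Free submodules spanned by part of a basis -/

section SupportedOn

variable {R ι : Type*} [CommRing R]

/-- The functions `ι → R` supported on `B`. -/
def supportedOn (R : Type*) [CommRing R] (B : Set ι) : Submodule R (ι → R) :=
  Submodule.pi {b | b ∉ B} fun _ => ⊥

lemma mem_supportedOn {B : Set ι} {v : ι → R} :
    v ∈ supportedOn R B ↔ ∀ b ∉ B, v b = 0 := by
  simp [supportedOn, Submodule.mem_pi]

lemma supportedOn_mono {B B' : Set ι} (h : B ⊆ B') : supportedOn R B ≤ supportedOn R B' :=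
  fun _ hv => mem_supportedOn.2 fun b hb => mem_supportedOn.1 hv b fun hb' => hb (h hb')

end SupportedOn

/-! ### The differential of `H ⊗ Koszul` in coordinates -/

namespace GradedFreeComplex

variable {K : Type u} [Field K] {r : ℕ}

section General

variable (C : GradedFreeComplex K r)

lemma mem_term {n : ℕ} {v : C.ι → CoordRing K r} :
    v ∈ C.term n ↔ ∀ b, C.hdeg b ≠ n → v b = 0 := ProjACM.mem_supportedOn

lemma δ_apply (v : C.ι → CoordRing K r) (a : C.ι) : C.δ v a = ∑ b, C.d a b * v b := rfl

lemma δ_δ (v : C.ι → CoordRing K r) : C.δ (C.δ v) = 0 := by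
  change C.d.mulVec (C.d.mulVec v) = 0
  rw [Matrix.mulVec_mulVec, C.d_sq, Matrix.zero_mulVec]

lemma δ_mem_term {n : ℕ} {v : C.ι → CoordRing K r} (hv : v ∈ C.term (n + 1)) :
    C.δ v ∈ C.term n := by
  rw [mem_term] at hv ⊢
  intro a ha
  rw [δ_apply]
  refine Finset.sum_eq_zero fun b _ => ?_
  by_cases h : C.d a b = 0
  · rw [h, zero_mul]
  · rw [hv b, mul_zero]
    have := C.d_hdeg a b h
    omega

lemma tensor_δ_apply (C D : GradedFreeComplex K r) (v : (C.tensor D).ι → CoordRing K r)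
    (a : C.ι) (b : D.ι) :
    (C.tensor D).δ v (a, b) =
      C.δ (fun a' => v (a', b)) a + (-1) ^ C.hdeg a * D.δ (fun b' => v (a, b')) b := by
  change ∑ x : C.ι × D.ι, ((if b = x.2 then C.d a x.1 else 0) +
      (if a = x.1 then (-1) ^ C.hdeg x.1 * D.d b x.2 else 0)) * v x =
    ∑ a', C.d a a' * v (a', b) + (-1) ^ C.hdeg a * ∑ b', D.d b b' * v (a, b')
  rw [Fintype.sum_prod_type]
  simp only [add_mul, Finset.sum_add_distrib, ite_mul, zero_mul]
  congr 1
  · simp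
  · rw [Finset.sum_comm]
    simp [Finset.mul_sum, mul_assoc]

end General

variable {t : ℕ} {f : Fin t → CoordRing K r} {d : Fin t → ℕ} {hf : ∀ i, (f i).IsHomogeneous (d i)}

/-- Reindexing by the target: `T` becomes `insert i U`. The sign is unchanged, as removing `i` does
not affect the elements below `i`. -/
lemma koszul_δ_apply (w : Finset (Fin t) → CoordRing K r) (U : Finset (Fin t)) :
    (koszul f d hf).δ w U =
      ∑ i ∈ Uᶜ, (-1) ^ {j ∈ U | j < i}.card * f i * w (insert i U) := by
  change ∑ T : Finset (Fin t), (∑ i ∈ T, if U = T.erase i then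
    (-1) ^ {j ∈ T | j < i}.card * f i else 0) * w T = _
  have h1 (T : Finset (Fin t)) : (∑ i ∈ T, if U = T.erase i then
      (-1 : CoordRing K r) ^ {j ∈ T | j < i}.card * f i else 0) * w T =
      ∑ i, if i ∈ Uᶜ ∧ T = insert i U then (-1) ^ {j ∈ U | j < i}.card * f i * w (insert i U)
        else 0 := by
    rw [Finset.sum_mul, ← Finset.sum_subset (Finset.subset_univ T)]
    · refine Finset.sum_congr rfl fun i hi => ?_
      by_cases hU : U = T.erase i
      · have hT : T = insert i U := by rw [hU, Finset.insert_erase hi]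
        have hiU : i ∈ Uᶜ := by simp [hU]
        rw [if_pos hU, if_pos ⟨hiU, hT⟩, ← hT]
        congr 3
        rw [hU]
        congr 1
        ext x
        simp only [Finset.mem_filter, Finset.mem_erase]
        grind
      · rw [if_neg hU, if_neg, zero_mul]
        rintro ⟨hiU, rfl⟩
        exact hU (Finset.erase_insert (by simpa using hiU)).symm
    · rintro i - hi
      rw [if_neg]
      rintro ⟨-, rfl⟩
      exact hi (Finset.mem_insert_self i U)
  simp only [h1]
  rw [Finset.sum_comm]
  simp only [ite_and]
  rw [← Finset.sum_subset (Finset.subset_univ Uᶜ)]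
  · exact Finset.sum_congr rfl fun i hi => by simp [Finset.mem_compl.1 hi]
  · intro i _ hi
    simp [Finset.mem_compl] at hi
    simp [hi]

/-- The module underlying the tensor product of `H` with a Koszul complex on `t` elements. -/
abbrev KoszulModule (H : GradedFreeComplex K r) (t : ℕ) : Type u :=
  H.ι × Finset (Fin t) → CoordRing K r

/-- The differential of the tensor product of `H` with the Koszul complex of `f`. -/
def koszulδ (H : GradedFreeComplex K r) (f : Fin t → CoordRing K r) :
    H.KoszulModule t →ₗ[CoordRing K r] H.KoszulModule t where
  toFun v x := H.δ (fun b => v (b, x.2)) x.1 + (-1) ^ H.hdeg x.1 *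
    ∑ i ∈ x.2ᶜ, (-1) ^ {j ∈ x.2 | j < i}.card * f i * v (x.1, insert i x.2)
  map_add' v w := by
    funext x
    have h : H.δ (fun b => (v + w) (b, x.2)) x.1 =
        H.δ (fun b => v (b, x.2)) x.1 + H.δ (fun b => w (b, x.2)) x.1 :=
      congrFun (map_add H.δ (fun b => v (b, x.2)) fun b => w (b, x.2)) x.1
    rw [h]
    simp only [Pi.add_apply, mul_add, Finset.sum_add_distrib]
    ring
  map_smul' c v := by
    funext x
    have h : H.δ (fun b => (c • v) (b, x.2)) x.1 = c * H.δ (fun b => v (b, x.2)) x.1 :=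
      congrFun (map_smul H.δ c fun b => v (b, x.2)) x.1
    rw [h]
    simp only [Pi.smul_apply, smul_eq_mul, RingHom.id_apply, mul_add, Finset.mul_sum]
    congr 1
    exact Finset.sum_congr rfl fun i _ => by ring

variable {H : GradedFreeComplex K r}

lemma koszulδ_apply (v : H.KoszulModule t) (a : H.ι) (U : Finset (Fin t)) :
    H.koszulδ f v (a, U) = H.δ (fun b => v (b, U)) a +
      (-1) ^ H.hdeg a * ∑ i ∈ Uᶜ, (-1) ^ {j ∈ U | j < i}.card * f i * v (a, insert i U) := rfl

-- This passes to a differential on explicit pairs `(a, T)`, so that later computations need not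
-- unfold the index type of `tensor`.
variable (d hf) in
lemma tensor_koszul_δ (v : H.KoszulModule t) :
    (H.tensor (koszul f d hf)).δ v = H.koszulδ f v := by
  funext x
  refine (tensor_δ_apply H (koszul f d hf) v x.1 x.2).trans ?_
  exact congrArg (H.δ (fun b => v (b, x.2)) x.1 + (-1) ^ H.hdeg x.1 * ·)
    (koszul_δ_apply (hf := hf) (fun T => v (x.1, T)) x.2)

variable (H t) in
/-- The homogeneous component of homological degree `n`. -/
def koszulTerm (n : ℕ) : Submodule (CoordRing K r) (H.KoszulModule t) :=
  ProjACM.supportedOn _ {x | H.hdeg x.1 + x.2.card = n}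

variable (H t) in
/-- The part of the tensor product of `H` with the Koszul complex that involves only the first `j`
elements. -/
def koszulTrunc (j : ℕ) : Submodule (CoordRing K r) (H.KoszulModule t) :=
  ProjACM.supportedOn _ {x | ∀ i ∈ x.2, (i : ℕ) < j}

lemma mem_koszulTrunc {j : ℕ} {v : H.KoszulModule t} :
    v ∈ H.koszulTrunc t j ↔ ∀ (a : H.ι) (T : Finset (Fin t)), (∃ i ∈ T, j ≤ i) → v (a, T) = 0 := by
  rw [koszulTrunc, mem_supportedOn]
  constructor
  · rintro h a T ⟨i, hi, hij⟩
    exact h (a, T) fun h' => (h' i hi).not_ge hij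
  · rintro h ⟨a, T⟩ hT
    refine h a T ?_
    by_contra! h'
    exact hT h'

lemma mem_koszulTerm {n : ℕ} {v : H.KoszulModule t} :
    v ∈ H.koszulTerm t n ↔
      ∀ (a : H.ι) (T : Finset (Fin t)), H.hdeg a + T.card ≠ n → v (a, T) = 0 := by
  rw [koszulTerm, mem_supportedOn]
  exact ⟨fun h a T => h (a, T), fun h x => h x.1 x.2⟩

lemma δ_mem_koszulTrunc {j : ℕ} {v : H.KoszulModule t}
    (hv : v ∈ H.koszulTrunc t j) :
    H.koszulδ f v ∈ H.koszulTrunc t j := by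
  rw [mem_koszulTrunc] at hv ⊢
  rintro a T ⟨i, hi, hij⟩
  rw [koszulδ_apply]
  have h1 : (fun b => v (b, T)) = 0 := funext fun b => hv b T ⟨i, hi, hij⟩
  rw [h1, map_zero, Pi.zero_apply, zero_add, Finset.sum_eq_zero, mul_zero]
  intro k _
  rw [hv a _ ⟨i, Finset.mem_insert_of_mem hi, hij⟩, mul_zero]

/-- Exterior multiplication by the `j`-th basis element. -/
def koszulShift (j : Fin t) (v : H.KoszulModule t) :
    H.KoszulModule t :=
  fun x => if j ∈ x.2 then v (x.1, x.2.erase j) else 0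

lemma koszulShift_apply (j : Fin t) (v : H.KoszulModule t) (a : H.ι)
    (T : Finset (Fin t)) :
    koszulShift j v (a, T) = if j ∈ T then v (a, T.erase j) else 0 := rfl

lemma koszulShift_mem_koszulTrunc {j : Fin t} {v : H.KoszulModule t}
    (hv : v ∈ H.koszulTrunc t j) :
    koszulShift j v ∈ H.koszulTrunc t (j + 1) := by
  rw [mem_koszulTrunc] at hv ⊢
  rintro a T ⟨i, hi, hij⟩
  rw [koszulShift_apply]
  split_ifs with h
  · have hne : i ≠ j := by rintro rfl; omega
    exact hv a _ ⟨i, Finset.mem_erase.2 ⟨hne, hi⟩, by omega⟩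
  · rfl

lemma koszulShift_mem_term {j : Fin t} {n : ℕ}
    {v : H.KoszulModule t}
    (hv : v ∈ H.koszulTerm t n) :
    koszulShift j v ∈ H.koszulTerm t (n + 1) := by
  rw [mem_koszulTerm] at hv ⊢
  intro a T hT
  rw [koszulShift_apply]
  split_ifs with h
  · refine hv a _ ?_
    have := Finset.card_erase_add_one h
    omega
  · rfl

/-- Mapping cone formula. Only indices below `j` occur in `w`, so `e_j` is wedged on last: the old
terms keep their signs, and removing `e_j` passes all earlier factors, giving the total degree sign
`(-1)^n`. -/
lemma δ_koszulShift {j : Fin t} {n : ℕ} {w : H.KoszulModule t}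
    (hw : w ∈ H.koszulTrunc t j) (hwn : w ∈ H.koszulTerm t n) :
    H.koszulδ f (koszulShift j w) =
      koszulShift j (H.koszulδ f w) + ((-1) ^ n * f j) • w := by
  rw [mem_koszulTrunc] at hw
  rw [mem_koszulTerm] at hwn
  funext ⟨a, U⟩
  rw [koszulδ_apply, Pi.add_apply, Pi.smul_apply, smul_eq_mul, koszulShift_apply]
  by_cases hj : j ∈ U
  · rw [if_pos hj, hw a U ⟨j, hj, le_rfl⟩, mul_zero, add_zero, koszulδ_apply]
    simp only [koszulShift_apply, if_pos hj]
    congr 2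
    rw [Finset.compl_erase, Finset.sum_insert (by simpa using hj), Finset.insert_erase hj,
      hw a U ⟨j, hj, le_rfl⟩, mul_zero, zero_add]
    refine Finset.sum_congr rfl fun i hi => ?_
    have hij : i ≠ j := by rintro rfl; simp [hj] at hi
    rw [if_pos (Finset.mem_insert_of_mem hj), Finset.erase_insert_of_ne hij]
    by_cases hlt : (j : ℕ) ≤ i
    · rw [hw a _ ⟨i, Finset.mem_insert_self _ _, hlt⟩, mul_zero, mul_zero]
    · congr 4
      ext x
      simp only [Finset.mem_filter, Finset.mem_erase]
      refine ⟨fun h => ⟨⟨?_, h.1⟩, h.2⟩, fun h => ⟨h.1.2, h.2⟩⟩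
      rintro rfl
      exact hlt (Fin.le_def.1 h.2.le)
  · rw [if_neg hj]
    have h1 : (fun b => koszulShift j w (b, U)) = 0 :=
      funext fun b => by rw [koszulShift_apply, if_neg hj]; rfl
    rw [h1, map_zero, Pi.zero_apply, zero_add, zero_add,
      Finset.sum_eq_single_of_mem j (by simpa using hj), koszulShift_apply,
      if_pos (Finset.mem_insert_self j U), Finset.erase_insert hj]
    · by_cases h0 : w (a, U) = 0
      · rw [h0]; simp
      · have hn : H.hdeg a + U.card = n := by
          by_contra h; exact h0 (hwn a U h)
        have hU : {x ∈ U | x < j} = U := by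
          refine Finset.filter_true_of_mem fun x hx => ?_
          by_contra h
          exact h0 (hw a U ⟨x, hx, by simpa using h⟩)
        rw [hU, ← hn, pow_add]
        ring
    · intro i _ hij
      rw [koszulShift_apply, if_neg, mul_zero]
      simp [hj, hij.symm]

end GradedFreeComplex

/-! ### Exactness of `H ⊗ Koszul` and its top Koszul component -/

namespace GradedFreeComplex

variable {K : Type u} [Field K] {r t : ℕ} {f : Fin t → CoordRing K r} {d : Fin t → ℕ}
  {H : GradedFreeComplex K r}

lemma koszulδ_koszulδ (hf : ∀ i, (f i).IsHomogeneous (d i)) (v : H.KoszulModule t) :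
    H.koszulδ f (H.koszulδ f v) = 0 := by
  have h1 : H.koszulδ f (H.koszulδ f v) = (H.tensor (koszul f d hf)).δ (H.koszulδ f v) :=
    (tensor_koszul_δ d hf _).symm
  have h2 : (H.tensor (koszul f d hf)).δ (H.koszulδ f v) =
      (H.tensor (koszul f d hf)).δ ((H.tensor (koszul f d hf)).δ v) :=
    congrArg (H.tensor (koszul f d hf)).δ (tensor_koszul_δ d hf v).symm
  exact h1.trans (h2.trans ((H.tensor (koszul f d hf)).δ_δ v))

lemma koszulδ_mem_koszulTerm (hf : ∀ i, (f i).IsHomogeneous (d i)) {n : ℕ} {v : H.KoszulModule t}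
    (hv : v ∈ H.koszulTerm t (n + 1)) : H.koszulδ f v ∈ H.koszulTerm t n := by
  rw [← tensor_koszul_δ d hf]
  exact (H.tensor (koszul f d hf)).δ_mem_term hv

/-- The inclusion of `H` as the summand of index `T`. -/
def koszulIncl (T : Finset (Fin t)) (x : H.ι → CoordRing K r) : H.KoszulModule t :=
  fun y => if y.2 = T then x y.1 else 0

lemma koszulIncl_apply (T : Finset (Fin t)) (x : H.ι → CoordRing K r) (a : H.ι)
    (U : Finset (Fin t)) : koszulIncl T x (a, U) = if U = T then x a else 0 := rfl

lemma koszulIncl_mem_koszulTerm {T : Finset (Fin t)} {x : H.ι → CoordRing K r} {n : ℕ}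
    (hx : x ∈ H.term n) : koszulIncl T x ∈ H.koszulTerm t (n + T.card) := by
  rw [mem_koszulTerm]
  intro a U h
  rw [koszulIncl_apply]
  split_ifs with hU
  · subst hU
    exact (H.mem_term.1 hx) a (by omega)
  · rfl

lemma koszulIncl_empty_mem_koszulTrunc (x : H.ι → CoordRing K r) (j : ℕ) :
    koszulIncl ∅ x ∈ H.koszulTrunc t j := by
  rw [mem_koszulTrunc]
  rintro a T ⟨i, hi, -⟩
  rw [koszulIncl_apply, if_neg]
  rintro rfl
  simp at hi

lemma koszulδ_koszulIncl_empty (x : H.ι → CoordRing K r) :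
    H.koszulδ f (koszulIncl ∅ x) = koszulIncl ∅ (H.δ x) := by
  funext ⟨a, U⟩
  rw [koszulδ_apply, Finset.sum_eq_zero, mul_zero, add_zero, koszulIncl_apply]
  · split_ifs with hU
    · simp only [koszulIncl_apply, if_pos hU]
    · simp only [koszulIncl_apply, if_neg hU]
      exact congrFun (map_zero H.δ) a
  · intro i _
    rw [koszulIncl_apply, if_neg (Finset.insert_ne_empty _ _), mul_zero]

/-- The ideal generated by `I` and the first `j` members of `f`. -/
def partialIdeal (I : Ideal (CoordRing K r)) (f : Fin t → CoordRing K r) (j : ℕ) :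
    Ideal (CoordRing K r) :=
  I ⊔ Ideal.span (f '' {i | (i : ℕ) < j})

lemma koszulδ_apply_empty (v : H.KoszulModule t) (a : H.ι) :
    H.koszulδ f v (a, ∅) =
      H.δ (fun b => v (b, ∅)) a + (-1) ^ H.hdeg a * ∑ i, f i * v (a, {i}) := by
  rw [koszulδ_apply]
  simp

variable {o : H.ι} {I : Ideal (CoordRing K r)}

/-- Boundaries in degree `0` of the truncated complex; this turns ideal membership in `hreg` into
being a boundary. -/
lemma map_koszulTrunc_inf_koszulTerm_one (ho : ∀ b, H.hdeg b = 0 ↔ b = o)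
    (hI : (H.term 1).map (LinearMap.proj o ∘ₗ H.δ) = I) (j : ℕ) :
    (H.koszulTrunc t j ⊓ H.koszulTerm t 1).map (LinearMap.proj (o, ∅) ∘ₗ H.koszulδ f) =
      partialIdeal I f j := by
  have ho0 : H.hdeg o = 0 := (ho o).2 rfl
  apply le_antisymm
  · rintro _ ⟨w, ⟨hwj, hw1⟩, rfl⟩
    rw [SetLike.mem_coe, mem_koszulTrunc] at hwj
    rw [SetLike.mem_coe, mem_koszulTerm] at hw1
    rw [LinearMap.comp_apply, LinearMap.proj_apply, koszulδ_apply_empty, ho0, pow_zero, one_mul]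
    refine Submodule.add_mem_sup ?_ (Submodule.sum_mem _ fun i _ => ?_)
    · rw [← hI]
      refine ⟨fun b => w (b, ∅), H.mem_term.2 fun b hb => hw1 b ∅ (by simpa using hb), rfl⟩
    · by_cases hi : (i : ℕ) < j
      · exact Ideal.mul_mem_right _ _ (Ideal.subset_span ⟨i, hi, rfl⟩)
      · rw [hwj o {i} ⟨i, by simp, by omega⟩, mul_zero]
        exact Submodule.zero_mem _
  · refine sup_le ?_ (Ideal.span_le.2 ?_)
    · rw [← hI]
      rintro _ ⟨x, hx, rfl⟩
      refine ⟨koszulIncl ∅ x, ⟨koszulIncl_empty_mem_koszulTrunc x j,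
        by simpa using koszulIncl_mem_koszulTerm (T := (∅ : Finset (Fin t))) hx⟩, ?_⟩
      rw [LinearMap.comp_apply, LinearMap.proj_apply, koszulδ_koszulIncl_empty, koszulIncl_apply,
        if_pos rfl]
      rfl
    · rintro _ ⟨i, hi, rfl⟩
      refine ⟨koszulIncl {i} (Pi.single o 1), ⟨?_, ?_⟩, ?_⟩
      · rw [SetLike.mem_coe, mem_koszulTrunc]
        rintro a T ⟨k, hk, hkj⟩
        rw [koszulIncl_apply, if_neg]
        rintro rfl
        rw [Finset.mem_singleton] at hk
        subst hk
        exact absurd hi (by simpa using hkj)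
      · have h : (Pi.single o 1 : H.ι → CoordRing K r) ∈ H.term 0 := by
          rw [mem_term]
          intro b hb
          rw [Pi.single_eq_of_ne]
          rintro rfl
          exact hb ho0
        have := koszulIncl_mem_koszulTerm (T := {i}) h
        rwa [Finset.card_singleton, zero_add] at this
      · rw [LinearMap.comp_apply, LinearMap.proj_apply, koszulδ_apply_empty, ho0, pow_zero, one_mul]
        have h1 : (fun b => koszulIncl {i} (Pi.single o 1 : H.ι → CoordRing K r) (b, ∅)) = 0 := by
          funext b
          rw [koszulIncl_apply, if_neg (Finset.singleton_ne_empty i).symm]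
          rfl
        rw [h1, map_zero, Pi.zero_apply, zero_add, Finset.sum_eq_single i]
        · simp [koszulIncl_apply]
        · intro k _ hk
          rw [koszulIncl_apply, if_neg (by simpa using hk), mul_zero]
        · simp

/-- The mapping cone decomposition: separate the terms with and without `e_j`. Its uniqueness is
`koszulShift_eq_zero`. -/
lemma koszulδ_add_smul_eq {j : Fin t} {n : ℕ} {v : H.KoszulModule t}
    (hv : v ∈ H.koszulTrunc t (j + 1)) (hvn : v ∈ H.koszulTerm t n) (hn : 1 ≤ n) :
    ∃ v₀ ∈ H.koszulTrunc t j ⊓ H.koszulTerm t n, ∃ v₁ ∈ H.koszulTrunc t j ⊓ H.koszulTerm t (n - 1),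
      v = v₀ + koszulShift j v₁ := by
  rw [mem_koszulTrunc] at hv
  rw [mem_koszulTerm] at hvn
  refine ⟨fun x => if j ∈ x.2 then 0 else v x, ⟨?_, ?_⟩,
    fun x => if j ∈ x.2 then 0 else v (x.1, insert j x.2), ⟨?_, ?_⟩, ?_⟩
  · rw [SetLike.mem_coe, mem_koszulTrunc]
    rintro a T ⟨i, hi, hij⟩
    dsimp only
    split_ifs with hj
    · rfl
    · have : i ≠ j := by rintro rfl; exact hj hi
      exact hv a T ⟨i, hi, by have := Fin.val_ne_of_ne this; omega⟩
  · rw [SetLike.mem_coe, mem_koszulTerm]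
    intro a T h
    dsimp only
    split_ifs with hj
    · rfl
    · exact hvn a T h
  · rw [SetLike.mem_coe, mem_koszulTrunc]
    rintro a T ⟨i, hi, hij⟩
    dsimp only
    split_ifs with hj
    · rfl
    · have : i ≠ j := by rintro rfl; exact hj hi
      exact hv a _ ⟨i, Finset.mem_insert_of_mem hi, by have := Fin.val_ne_of_ne this; omega⟩
  · rw [SetLike.mem_coe, mem_koszulTerm]
    intro a T h
    dsimp only
    split_ifs with hj
    · rfl
    · refine hvn a _ ?_
      rw [Finset.card_insert_of_notMem hj]
      omega
  · funext ⟨a, T⟩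
    rw [Pi.add_apply, koszulShift_apply]
    by_cases hj : j ∈ T
    · simp [hj]
    · simp [hj]

lemma koszulShift_eq_zero {j : Fin t} {v w : H.KoszulModule t} (hv : v ∈ H.koszulTrunc t j)
    (hw : w ∈ H.koszulTrunc t j) (h : w + koszulShift j v = 0) : v = 0 ∧ w = 0 := by
  rw [mem_koszulTrunc] at hv hw
  have h1 : v = 0 := by
    funext ⟨a, T⟩
    by_cases hj : j ∈ T
    · exact hv a T ⟨j, hj, le_rfl⟩
    · have h2 := congrFun h (a, insert j T)
      rw [Pi.add_apply, hw a _ ⟨j, Finset.mem_insert_self j T, le_rfl⟩, koszulShift_apply,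
        if_pos (Finset.mem_insert_self j T), Finset.erase_insert hj, zero_add] at h2
      exact h2
  refine ⟨h1, ?_⟩
  subst h1
  rw [← h]
  funext ⟨a, T⟩
  rw [Pi.add_apply, koszulShift_apply]
  simp

/-- The tensor product of a resolution of `R/I` with the Koszul complex of a sequence that is
regular on `R/I` is exact in positive degrees. -/
theorem exists_koszulδ_eq (hf : ∀ i, (f i).IsHomogeneous (d i))
    (ho : ∀ b, H.hdeg b = 0 ↔ b = o) (hI : (H.term 1).map (LinearMap.proj o ∘ₗ H.δ) = I)
    (hex : ∀ n, 1 ≤ n → H.syzygy n = (H.term (n + 1)).map H.δ)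
    (hreg : ∀ (j : Fin t) (g : CoordRing K r), f j * g ∈ partialIdeal I f j →
      g ∈ partialIdeal I f j) (j : ℕ) (hj : j ≤ t) {n : ℕ} (hn : 1 ≤ n) {v : H.KoszulModule t}
    (hvj : v ∈ H.koszulTrunc t j) (hvn : v ∈ H.koszulTerm t n) (hv : H.koszulδ f v = 0) :
    ∃ w ∈ H.koszulTrunc t j ⊓ H.koszulTerm t (n + 1), H.koszulδ f w = v := by
  induction j generalizing n v with
  | zero =>
    rw [mem_koszulTrunc] at hvj
    have hvi : v = koszulIncl ∅ fun b => v (b, ∅) := by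
      funext ⟨a, U⟩
      rw [koszulIncl_apply]
      split_ifs with hU
      · rw [hU]
      · obtain ⟨i, hi⟩ := Finset.nonempty_iff_ne_empty.2 hU
        exact hvj a U ⟨i, hi, Nat.zero_le _⟩
    have hx : (fun b => v (b, ∅)) ∈ H.syzygy n := by
      refine ⟨H.mem_term.2 fun b hb => mem_koszulTerm.1 hvn b ∅ (by simpa using hb), ?_⟩
      rw [SetLike.mem_coe, LinearMap.mem_ker]
      rw [hvi, koszulδ_koszulIncl_empty] at hv
      funext a
      have := congrFun hv (a, ∅)
      rwa [koszulIncl_apply, if_pos rfl] at this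
    rw [hex n hn] at hx
    obtain ⟨y, hy, hyx⟩ := hx
    refine ⟨koszulIncl ∅ y, ⟨koszulIncl_empty_mem_koszulTrunc y 0,
      by simpa using koszulIncl_mem_koszulTerm (T := (∅ : Finset (Fin t))) hy⟩, ?_⟩
    rw [koszulδ_koszulIncl_empty, hyx, ← hvi]
  | succ j ih =>
    -- Writing `v = v₀ + v₁ ∧ e_j`, the cycle condition splits into `δ v₁ = 0` and `δ v₀ ± f_j v₁ =
    -- 0`.
    obtain ⟨v₀, ⟨hv₀j, hv₀n⟩, v₁, ⟨hv₁j, hv₁n⟩, rfl⟩ :=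
      koszulδ_add_smul_eq (j := ⟨j, hj⟩) hvj hvn hn
    dsimp only at hv₀j hv₁j
    obtain ⟨n, rfl⟩ : ∃ m, n = m + 1 := ⟨n - 1, by omega⟩
    rw [Nat.add_sub_cancel] at hv₁n
    rw [map_add, δ_koszulShift hv₁j hv₁n, add_comm (koszulShift _ _), ← add_assoc] at hv
    obtain ⟨hδ₁, hδ₀⟩ := koszulShift_eq_zero (j := ⟨j, hj⟩) (δ_mem_koszulTrunc hv₁j)
      (Submodule.add_mem _ (δ_mem_koszulTrunc hv₀j) (Submodule.smul_mem _ _ hv₁j)) hv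
    obtain ⟨w₁, ⟨hw₁j, hw₁n⟩, hw₁⟩ :
        ∃ w ∈ H.koszulTrunc t j ⊓ H.koszulTerm t (n + 1), H.koszulδ f w = v₁ := by
      -- In degree `0` exactness is not available for `v₁`. There `f_j v₁ = -δ v₀` is a boundary, so
      -- regularity of `f_j` makes `v₁` one.
      rcases Nat.eq_zero_or_pos n with rfl | hn'
      · have hmem : f ⟨j, hj⟩ * v₁ (o, ∅) ∈ partialIdeal I f j := by
          rw [← map_koszulTrunc_inf_koszulTerm_one ho hI]
          refine ⟨-v₀, Submodule.neg_mem _ ⟨hv₀j, hv₀n⟩, ?_⟩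
          have h1 := congrFun hδ₀ (o, ∅)
          rw [Pi.add_apply, Pi.smul_apply, smul_eq_mul, pow_zero, one_mul, Pi.zero_apply] at h1
          rw [LinearMap.comp_apply, LinearMap.proj_apply, map_neg, Pi.neg_apply]
          exact neg_eq_of_add_eq_zero_right h1
        have hmem' := hreg ⟨j, hj⟩ _ hmem
        rw [← map_koszulTrunc_inf_koszulTerm_one ho hI] at hmem'
        obtain ⟨w, hw, hwv⟩ := hmem'
        refine ⟨w, hw, ?_⟩
        have hw0 := mem_koszulTerm.1 (koszulδ_mem_koszulTerm hf hw.2)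
        have hv₁n' := mem_koszulTerm.1 hv₁n
        funext ⟨a, T⟩
        by_cases h : H.hdeg a + T.card = 0
        · obtain ⟨ha, hT⟩ := Nat.add_eq_zero_iff.1 h
          obtain rfl := (ho a).1 ha
          obtain rfl := Finset.card_eq_zero.1 hT
          exact hwv
        · rw [hw0 a T h, hv₁n' a T h]
      · exact ih (by omega) hn' hv₁j hv₁n hδ₁
    -- The subtracted term is the contribution of `δ (w₁ ∧ e_j)` outside `e_j`; removing it makes
    -- `v₀` a cycle of the shorter complex.
    have hz : H.koszulδ f (v₀ - ((-1) ^ (n + 1) * f ⟨j, hj⟩) • w₁) = 0 := by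
      rw [map_sub, map_smul, hw₁, ← hδ₀, pow_succ]
      rw [mul_neg_one, neg_mul, neg_smul, sub_neg_eq_add]
    obtain ⟨w₀, ⟨hw₀j, hw₀n⟩, hw₀⟩ := ih (by omega) hn
      (Submodule.sub_mem _ hv₀j (Submodule.smul_mem _ _ hw₁j))
      (Submodule.sub_mem _ hv₀n (Submodule.smul_mem _ _ hw₁n)) hz
    refine ⟨w₀ + koszulShift ⟨j, hj⟩ w₁,
      ⟨Submodule.add_mem _ ?_ ?_, Submodule.add_mem _ hw₀n ?_⟩, ?_⟩
    · exact supportedOn_mono (fun x hx i hi => (hx i hi).trans (Nat.lt_succ_self j)) hw₀j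
    · exact koszulShift_mem_koszulTrunc (j := ⟨j, hj⟩) hw₁j
    · exact koszulShift_mem_term hw₁n
    · rw [map_add, δ_koszulShift (j := ⟨j, hj⟩) hw₁j hw₁n, hw₀, hw₁]
      abel

/-- The component of top Koszul degree. -/
def koszulTop (v : H.KoszulModule t) : H.ι → CoordRing K r := fun a => v (a, Finset.univ)

/-- No index can be inserted into the full set, so taking the top component is a chain map to `H`,
without sign. -/
lemma koszulTop_koszulδ (v : H.KoszulModule t) :
    koszulTop (H.koszulδ f v) = H.δ (koszulTop v) := by
  funext a
  rw [koszulTop, koszulδ_apply, Finset.compl_univ, Finset.sum_empty, mul_zero, add_zero]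
  rfl

lemma koszulTop_koszulIncl (x : H.ι → CoordRing K r) :
    koszulTop (koszulIncl (t := t) Finset.univ x) = x := by
  funext a
  rw [koszulTop, koszulIncl_apply, if_pos rfl]

lemma koszulTop_mem_term {n m : ℕ} {v : H.KoszulModule t} (hv : v ∈ H.koszulTerm t n)
    (hm : n = m + t) : koszulTop v ∈ H.term m := by
  rw [mem_term]
  intro b hb
  refine mem_koszulTerm.1 hv b _ ?_
  rw [Finset.card_univ, Fintype.card_fin]
  omega

variable (H t) in
/-- The part of homological degree `n` that is not of top Koszul degree. -/
def koszulLower (n : ℕ) : Submodule (CoordRing K r) (H.KoszulModule t) :=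
  ProjACM.supportedOn _ {x | H.hdeg x.1 + x.2.card = n ∧ x.2.card ≠ t}

lemma mem_koszulLower {n : ℕ} {v : H.KoszulModule t} :
    v ∈ H.koszulLower t n ↔ v ∈ H.koszulTerm t n ∧ koszulTop v = 0 := by
  rw [koszulLower, mem_supportedOn, mem_koszulTerm]
  constructor
  · refine fun h => ⟨fun a T hT => h (a, T) fun h' => hT h'.1,
      funext fun a => h (a, _) fun h' => ?_⟩
    exact h'.2 (by simp)
  · rintro ⟨h1, h2⟩ ⟨a, T⟩ hT
    by_cases hc : H.hdeg a + T.card = n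
    · have hTt : T.card = t := by
        by_contra h
        exact hT ⟨hc, h⟩
      have hTu : T = Finset.univ := by
        rw [← Finset.card_eq_iff_eq_univ, hTt, Fintype.card_fin]
      subst hTu
      exact congrFun h2 a
    · exact h1 a T hc

/-- A chain whose top component is a cycle has the same boundary as a chain with vanishing top
component. -/
lemma exists_mem_koszulLower (hf : ∀ i, (f i).IsHomogeneous (d i))
    (hex : ∀ n, 1 ≤ n → H.syzygy n = (H.term (n + 1)).map H.δ)
    {n : ℕ} (hn : t + 1 ≤ n) {w : H.KoszulModule t} (hw : w ∈ H.koszulTerm t n)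
    (hδ : H.δ (koszulTop w) = 0) : ∃ w' ∈ H.koszulLower t n, H.koszulδ f w' = H.koszulδ f w := by
  obtain ⟨m, rfl⟩ : ∃ m, n = m + t := ⟨n - t, by omega⟩
  have h1 : koszulTop w ∈ H.syzygy m := ⟨koszulTop_mem_term hw rfl, hδ⟩
  -- Here `m ≥ 1`, so `H` is exact at the top component: it equals `δ u`. Subtracting the boundary
  -- of `u ⊗ e_univ` removes it and leaves `δ w` unchanged.
  rw [hex m (by omega)] at h1
  obtain ⟨u, hu, huw⟩ := h1
  have h2 : koszulIncl Finset.univ u ∈ H.koszulTerm t (m + t + 1) := by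
    have := koszulIncl_mem_koszulTerm (T := (Finset.univ : Finset (Fin t))) hu
    rwa [Finset.card_univ, Fintype.card_fin, Nat.add_right_comm] at this
  refine ⟨w - H.koszulδ f (koszulIncl Finset.univ u), mem_koszulLower.2 ⟨?_, ?_⟩, ?_⟩
  · exact Submodule.sub_mem _ hw (koszulδ_mem_koszulTerm hf h2)
  · have h3 : koszulTop (w - H.koszulδ f (koszulIncl Finset.univ u)) =
        koszulTop w - koszulTop (H.koszulδ f (koszulIncl Finset.univ u)) := rfl
    rw [h3, koszulTop_koszulδ, koszulTop_koszulIncl, huw, sub_self]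
  · rw [map_sub, koszulδ_koszulδ hf, sub_zero]

lemma koszulδ_mem_koszulLower (hf : ∀ i, (f i).IsHomogeneous (d i)) {n : ℕ}
    {v : H.KoszulModule t} (hv : v ∈ H.koszulLower t (n + 1)) :
    H.koszulδ f v ∈ H.koszulLower t n := by
  rw [mem_koszulLower] at hv ⊢
  refine ⟨koszulδ_mem_koszulTerm hf hv.1, ?_⟩
  rw [koszulTop_koszulδ, hv.2, map_zero]

end GradedFreeComplex

/-! ### Forms, Hilbert functions and regular linear forms -/

section Forms

variable {K : Type u} [Field K] {r : ℕ}

/-- The projection of `R` onto the forms of degree `m`. -/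
def formPart (m : ℤ) : CoordRing K r →ₗ[K] CoordRing K r :=
  if 0 ≤ m then homogeneousComponent m.toNat else 0

lemma coeff_formPart (m : ℤ) (g : CoordRing K r) (α : Fin (r + 1) →₀ ℕ) :
    coeff α (formPart m g) = if (α.degree : ℤ) = m then coeff α g else 0 := by
  rw [formPart]
  by_cases hm : 0 ≤ m
  · obtain ⟨n, rfl⟩ := Int.eq_ofNat_of_zero_le hm
    rw [if_pos hm, Int.toNat_natCast, coeff_homogeneousComponent]
    simp
  · rw [if_neg hm, LinearMap.zero_apply, coeff_zero, if_neg]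
    omega

lemma mem_forms_iff_coeff {m : ℤ} {g : CoordRing K r} :
    g ∈ forms K r m ↔ ∀ α, (α.degree : ℤ) ≠ m → coeff α g = 0 := by
  rw [mem_forms]
  refine forall_congr' fun α => ?_
  rw [mem_support_iff, not_imp_comm]

lemma formPart_mem_forms (m : ℤ) (g : CoordRing K r) : formPart m g ∈ forms K r m := by
  rw [mem_forms_iff_coeff]
  intro α h
  rw [coeff_formPart, if_neg h]

lemma formPart_of_mem_forms {m : ℤ} {g : CoordRing K r} (hg : g ∈ forms K r m) :
    formPart m g = g := by
  ext α
  rw [coeff_formPart]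
  split_ifs with h
  · rfl
  · exact (mem_forms_iff_coeff.1 hg α h).symm

lemma formPart_mul {m k n : ℤ} {c : CoordRing K r} (hc : c ∈ forms K r k) (g : CoordRing K r)
    (hn : n = k + m) : formPart n (c * g) = c * formPart m g := by
  classical
  subst hn
  ext α
  rw [coeff_formPart, coeff_mul, coeff_mul]
  split_ifs with h
  · refine Finset.sum_congr rfl fun x hx => ?_
    rw [coeff_formPart]
    by_cases hx0 : coeff x.1 c = 0
    · rw [hx0, zero_mul, zero_mul]
    · have h1 : (x.1.degree : ℤ) = k := by
        by_contra h2
        exact hx0 (mem_forms_iff_coeff.1 hc _ h2)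
      rw [← Finset.HasAntidiagonal.mem_antidiagonal.1 hx, map_add] at h
      rw [if_pos (by push_cast at h; omega)]
  · refine (Finset.sum_eq_zero fun x hx => ?_).symm
    rw [coeff_formPart]
    by_cases hx0 : coeff x.1 c = 0
    · rw [hx0, zero_mul]
    · have h1 : (x.1.degree : ℤ) = k := by
        by_contra h2
        exact hx0 (mem_forms_iff_coeff.1 hc _ h2)
      rw [← Finset.HasAntidiagonal.mem_antidiagonal.1 hx, map_add] at h
      rw [if_neg (by push_cast at h; omega), mul_zero]

lemma formPart_mem {J : Ideal (CoordRing K r)} (hJ : IsHomogeneousIdeal J) {g : CoordRing K r}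
    (hg : g ∈ J) (m : ℤ) : formPart m g ∈ J := by
  rw [formPart]
  split_ifs
  · exact hJ.homogeneousComponent_mem hg _
  · exact J.zero_mem

instance finite_forms (m : ℤ) : Module.Finite K (forms K r m) := by
  have hfin : {α : Fin (r + 1) →₀ ℕ | (α.degree : ℤ) = m}.Finite := by
    refine ((Finset.univ : Finset (Fin (r + 1))).finsuppAntidiag m.toNat).finite_toSet.subset ?_
    intro α hα
    rw [Finset.mem_coe, Finset.mem_finsuppAntidiag]
    refine ⟨?_, Finset.subset_univ _⟩
    have h : ((Finset.univ.sum α : ℕ) : ℤ) = m := by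
      rw [← Finsupp.degree_eq_sum]
      exact hα
    omega
  have := hfin.to_subtype
  exact Module.Finite.of_basis (basisRestrictSupport K _)

lemma finrank_forms (n : ℕ) : Module.finrank K (forms K r n) = (n + r).choose r := by
  have h : {α : Fin (r + 1) →₀ ℕ | (α.degree : ℤ) = n} =
      ((Finset.univ : Finset (Fin (r + 1))).finsuppAntidiag n : Set (Fin (r + 1) →₀ ℕ)) := by
    ext α
    rw [Finset.mem_coe, Finset.mem_finsuppAntidiag, Set.mem_ofPred_eq, Finsupp.degree_eq_sum,
      Nat.cast_inj]
    exact ⟨fun h => ⟨h, Finset.subset_univ _⟩, fun h => h.1⟩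
  rw [forms, Module.finrank_eq_nat_card_basis (basisRestrictSupport K _), h, Nat.card_coe_set_eq,
    Set.ncard_coe_finset, Finset.card_finsuppAntidiag_nat_eq_choose]
  rw [Finset.card_univ, Fintype.card_fin, show r + 1 + n - 1 = n + r by omega,
    ← Nat.choose_symm_add]

lemma eval_preHilbertPoly_eq_finrank_forms {n : ℤ} (hn : 0 ≤ n) :
    (Polynomial.preHilbertPoly ℚ r 0).eval (n : ℚ) = Module.finrank K (forms K r n) := by
  obtain ⟨n, rfl⟩ := Int.eq_ofNat_of_zero_le hn
  rw [Int.cast_natCast, Polynomial.preHilbertPoly_eq_choose_sub_add ℚ r (Nat.zero_le n),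
    finrank_forms, Nat.sub_zero]

/-- The forms of degree `m` in the ideal `J`. -/
def idealForms (J : Ideal (CoordRing K r)) (m : ℤ) : Submodule K (CoordRing K r) :=
  J.restrictScalars K ⊓ forms K r m

instance finite_idealForms (J : Ideal (CoordRing K r)) (m : ℤ) :
    Module.Finite K (idealForms J m) :=
  Submodule.finiteDimensional_of_le (inf_le_right : idealForms J m ≤ forms K r m)

/-- The Hilbert function `dim_K (R/J)_m`. -/
def hilbertFunction (J : Ideal (CoordRing K r)) (m : ℤ) : ℚ :=
  Module.finrank K (forms K r m) - Module.finrank K (idealForms J m)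

variable {J : Ideal (CoordRing K r)} {l : CoordRing K r}

/-- Dimension count for `0 → (R/J)(-1) → R/J → R/(J + l) → 0`, made inside `R_m`: the sum is `J_m +
l R_{m-1}` and the intersection is `l J_{m-1}`. -/
lemma hilbertFunction_sup_span (hJ : IsHomogeneousIdeal J) (hl : l ∈ forms K r 1) (hl0 : l ≠ 0)
    (hreg : ∀ g, l * g ∈ J → g ∈ J) (m : ℤ) :
    hilbertFunction (J ⊔ Ideal.span {l}) m = hilbertFunction J m - hilbertFunction J (m - 1) := by
  let μ : CoordRing K r →ₗ[K] CoordRing K r := LinearMap.mulLeft K l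
  have hμ : Function.Injective μ := fun a b h => mul_left_cancel₀ hl0 h
  have hsup : idealForms (J ⊔ Ideal.span {l}) m = idealForms J m ⊔ (forms K r (m - 1)).map μ := by
    apply le_antisymm
    · rintro g ⟨hgJ, hgm⟩
      obtain ⟨a, ha, b, hb, rfl⟩ := Submodule.mem_sup.1 (show g ∈ J ⊔ Ideal.span {l} from hgJ)
      obtain ⟨b, rfl⟩ := Ideal.mem_span_singleton'.1 hb
      rw [← formPart_of_mem_forms hgm, map_add, mul_comm b l,
        formPart_mul (m := m - 1) hl b (by ring)]
      exact Submodule.add_mem_sup ⟨formPart_mem hJ ha m, formPart_mem_forms m a⟩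
        ⟨_, formPart_mem_forms (m - 1) b, rfl⟩
    · refine sup_le (fun g hg => ⟨Ideal.mem_sup_left hg.1, hg.2⟩) ?_
      rintro _ ⟨b, hb, rfl⟩
      refine ⟨Ideal.mem_sup_right (Ideal.mul_mem_right _ _ (Ideal.subset_span rfl)), ?_⟩
      have := mul_mem_forms hl hb
      rwa [add_sub_cancel] at this
  have hinf : idealForms J m ⊓ (forms K r (m - 1)).map μ = (idealForms J (m - 1)).map μ := by
    apply le_antisymm
    · rintro _ ⟨hg, b, hb, rfl⟩
      exact ⟨b, ⟨hreg b hg.1, hb⟩, rfl⟩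
    · rintro _ ⟨b, hb, rfl⟩
      refine ⟨⟨J.mul_mem_left _ hb.1, ?_⟩, b, hb.2, rfl⟩
      have := mul_mem_forms hl hb.2
      rwa [add_sub_cancel] at this
  have h1 := Submodule.finrank_sup_add_finrank_inf_eq (idealForms J m) ((forms K r (m - 1)).map μ)
  rw [← hsup, hinf, (Submodule.equivMapOfInjective μ hμ _).symm.finrank_eq,
    (Submodule.equivMapOfInjective μ hμ _).symm.finrank_eq] at h1
  have h2 : (Module.finrank K (idealForms (J ⊔ Ideal.span {l}) m) : ℚ) +
      Module.finrank K (idealForms J (m - 1)) =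
      Module.finrank K (idealForms J m) + Module.finrank K (forms K r (m - 1)) := by
    exact_mod_cast h1
  rw [hilbertFunction, hilbertFunction, hilbertFunction]
  linarith

lemma hilbertFunction_pos {m : ℤ} {g : CoordRing K r} (hg : g ∈ forms K r m) (hgJ : g ∉ J) :
    0 < hilbertFunction J m := by
  have hlt : idealForms J m < forms K r m :=
    lt_of_le_of_ne inf_le_right fun h => hgJ ((h ▸ hg : g ∈ idealForms J m).1)
  rw [hilbertFunction, sub_pos]
  exact_mod_cast Submodule.finrank_lt_finrank_of_lt hlt

lemma hilbertFunction_eq_zero {m : ℤ} (h : forms K r m ≤ J.restrictScalars K) :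
    hilbertFunction J m = 0 := by
  rw [hilbertFunction, idealForms, inf_eq_right.2 h, sub_self]

attribute [local instance] MvPolynomial.gradedAlgebra

/-- The homogeneous core of a prime `p ⊇ J` is a prime between `J` and the irrelevant ideal. In
dimension zero it is maximal, hence equal to the irrelevant ideal, which therefore lies in `p`. -/
lemma IsHomogeneousIdeal.le_radical_of_ringKrullDim_le_zero (hJ : IsHomogeneousIdeal J)
    (hdim : ringKrullDim (CoordRing K r ⧸ J) ≤ 0) : irrelevantIdeal K r ≤ J.radical := by
  rw [Ideal.radical_eq_sInf]
  refine le_sInf ?_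
  rintro p ⟨hJp, hp⟩
  have hq := hp.homogeneousCore (𝒜 := homogeneousSubmodule (Fin (r + 1)) K)
  set q := (p.homogeneousCore (homogeneousSubmodule (Fin (r + 1)) K)).toIdeal with hq_def
  have hqp : q ≤ p := Ideal.toIdeal_homogeneousCore_le _ p
  have hJq : J ≤ q := by
    have h := Ideal.homogeneousCore_mono (homogeneousSubmodule (Fin (r + 1)) K) hJp
    have h' : (J.homogeneousCore (homogeneousSubmodule (Fin (r + 1)) K)).toIdeal ≤ q := h
    rwa [hJ.toIdeal_homogeneousCore_eq_self] at h'
  have hqm : q ≤ irrelevantIdeal K r := IsHomogeneousIdeal.le_irrelevantIdeal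
    (p.homogeneousCore (homogeneousSubmodule (Fin (r + 1)) K)).isHomogeneous hq.ne_top
  have hKD : Ring.KrullDimLE 0 (CoordRing K r ⧸ J) := Ring.krullDimLE_iff.2 hdim
  have hprime := Ideal.map_isPrime_of_surjective (f := Ideal.Quotient.mk J) (I := q)
    Ideal.Quotient.mk_surjective (by rwa [Ideal.mk_ker])
  have hmax := Ideal.isMaximal_of_isPrime (q.map (Ideal.Quotient.mk J))
  have hcomap : (q.map (Ideal.Quotient.mk J)).comap (Ideal.Quotient.mk J) = q := by
    rw [Ideal.comap_map_of_surjective _ Ideal.Quotient.mk_surjective, sup_eq_left]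
    change RingHom.ker _ ≤ q
    rwa [Ideal.mk_ker]
  have hmax' : q.IsMaximal := by
    rw [← hcomap]
    exact Ideal.comap_isMaximal_of_surjective _ Ideal.Quotient.mk_surjective
  rw [← hmax'.eq_of_le isMaximal_irrelevantIdeal.ne_top hqm]
  exact hqp

lemma IsHomogeneousIdeal.exists_forms_le (hJ : IsHomogeneousIdeal J)
    (hdim : ringKrullDim (CoordRing K r ⧸ J) ≤ 0) :
    ∃ N : ℕ, ∀ m : ℤ, N ≤ m → forms K r m ≤ J.restrictScalars K := by
  obtain ⟨N, hN⟩ := Ideal.exists_pow_le_of_le_radical_of_fg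
    (hJ.le_radical_of_ringKrullDim_le_zero hdim) (IsNoetherian.noetherian _)
  refine ⟨N, fun m hm g hg => hN ?_⟩
  have h1 : idealOfVars (Fin (r + 1)) K ≤ irrelevantIdeal K r := by
    refine Ideal.span_le.2 ?_
    rintro _ ⟨i, rfl⟩
    exact constantCoeff_X _ _
  refine Ideal.pow_right_mono h1 N ((mem_pow_idealOfVars_iff N g).2 fun α hα => ?_)
  have := mem_forms.1 hg α hα
  omega

/-- Prime avoidance in degree one: each associated prime meets the linear forms in a proper
subspace, and finitely many of those do not cover a space over an infinite field. -/
lemma exists_linear_form_regular [Infinite K]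
    (hm : irrelevantIdeal K r ∉ associatedPrimes (CoordRing K r) (CoordRing K r ⧸ J)) :
    ∃ l ∈ forms K r 1, l ∈ irrelevantIdeal K r ∧ ∀ g, l * g ∈ J → g ∈ J := by
  classical
  let φ : (Fin (r + 1) → K) →ₗ[K] CoordRing K r :=
    ∑ i, (LinearMap.proj i).smulRight (X i : CoordRing K r)
  have hφ (c) : φ c = ∑ i, c i • (X i : CoordRing K r) := by simp [φ]
  have hfin := associatedPrimes.finite (CoordRing K r) (CoordRing K r ⧸ J)
  let s : Finset (Subspace K (Fin (r + 1) → K)) :=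
    hfin.toFinset.image fun p => (p.restrictScalars K).comap φ
  have hs : ⊤ ∉ s := by
    intro h
    obtain ⟨p, hp, hptop⟩ := Finset.mem_image.1 h
    rw [Set.Finite.mem_toFinset] at hp
    have h1 : irrelevantIdeal K r ≤ p := irrelevantIdeal_le fun i => by
      have h2 : (Pi.single i 1 : Fin (r + 1) → K) ∈ (p.restrictScalars K).comap φ := by
        rw [hptop]; trivial
      have h3 : φ (Pi.single i 1) ∈ p := h2
      rw [hφ, Finset.sum_eq_single i] at h3
      · simpa using h3
      · intro k _ hk; rw [Pi.single_eq_of_ne hk, zero_smul]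
      · simp
    exact hm ((isMaximal_irrelevantIdeal.eq_of_le (IsAssociatedPrime.isPrime hp).ne_top h1) ▸ hp)
  have hne := Subspace.biUnion_ne_univ_of_top_notMem hs
  obtain ⟨c, hc⟩ := (Set.ne_univ_iff_exists_notMem _).1 hne
  have hX (i : Fin (r + 1)) : (X i : CoordRing K r) ∈ forms K r 1 :=
    isHomogeneous_mem_forms (isHomogeneous_X K i)
  have hreg : φ c ∈ {a : CoordRing K r | IsSMulRegular (CoordRing K r ⧸ J) a} := by
    rw [← Set.notMem_compl_iff, ← biUnion_associatedPrimes_eq_compl_regular]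
    intro h
    obtain ⟨p, hp, hcp⟩ := Set.mem_iUnion₂.1 h
    refine hc (Set.mem_iUnion₂.2 ⟨_, Finset.mem_image.2 ⟨p, hfin.mem_toFinset.2 hp, rfl⟩, hcp⟩)
  refine ⟨φ c, ?_, ?_, fun g hg => mem_of_isSMulRegular_quotient_of_smul_mem hreg hg⟩
  · rw [hφ]
    exact Submodule.sum_mem _ fun i _ => Submodule.smul_mem _ _ (hX i)
  · rw [hφ]
    refine Submodule.sum_mem _ fun i _ => ?_
    rw [smul_eq_C_mul]
    exact Ideal.mul_mem_left _ _ (constantCoeff_X _ _)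

end Forms

/-! ### The degree of the Hilbert polynomial -/

section Degree

/-- The leading terms cancel, and the coefficient of degree `m = deg q - 1` of the difference is `(m
+ 1)` times the leading coefficient, nonzero in characteristic zero. -/
lemma _root_.Polynomial.degree_sub_comp_X_sub_one {q : Polynomial ℚ} (hq : q.natDegree ≠ 0) :
    (q - q.comp (Polynomial.X - Polynomial.C 1)).degree = ((q.natDegree - 1 : ℕ) : WithBot ℕ) := by
  obtain ⟨m, hm⟩ : ∃ m, q.natDegree = m + 1 := Nat.exists_eq_succ_of_ne_zero hq
  have hT : q.comp (Polynomial.X - Polynomial.C 1) = Polynomial.taylor (-1) q := by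
    rw [Polynomial.taylor_apply, Polynomial.C_neg, sub_eq_add_neg]
  rw [hT, hm, Nat.add_sub_cancel]
  have h1 : (q - Polynomial.taylor (-1) q).coeff m = (m + 1) * q.coeff (m + 1) := by
    rw [Polynomial.coeff_sub, Polynomial.taylor_coeff]
    have hd : (Polynomial.hasseDeriv m q).natDegree < 2 := by
      have := Polynomial.natDegree_hasseDeriv_le q m
      omega
    rw [Polynomial.eval_eq_sum_range' hd, Finset.sum_range_succ, Finset.sum_range_one,
      Polynomial.hasseDeriv_coeff, Polynomial.hasseDeriv_coeff, zero_add, add_comm 1 m,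
      Nat.choose_self, Nat.choose_succ_self_right]
    push_cast
    ring
  have h2 : q.coeff (m + 1) ≠ 0 := by
    rw [← hm, Polynomial.coeff_natDegree, Polynomial.leadingCoeff_ne_zero]
    rintro rfl
    exact hq Polynomial.natDegree_zero
  refine le_antisymm ?_ (Polynomial.le_degree_of_ne_zero ?_)
  · rw [Polynomial.degree_le_iff_coeff_zero]
    intro k hk
    have hk' : m < k := by exact_mod_cast hk
    rw [Polynomial.coeff_sub]
    rcases Nat.eq_or_lt_of_le (Nat.succ_le_of_lt hk') with h | h
    · have h3 := Polynomial.coeff_taylor_natDegree (-1 : ℚ) q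
      rw [hm] at h3
      subst h
      rw [Nat.succ_eq_add_one, h3, Polynomial.leadingCoeff, hm, sub_self]
    · rw [Polynomial.coeff_eq_zero_of_natDegree_lt (by omega),
        Polynomial.coeff_eq_zero_of_natDegree_lt (by rw [Polynomial.natDegree_taylor]; omega),
        sub_zero]
  · rw [h1]
    exact mul_ne_zero (by positivity) h2

lemma _root_.Polynomial.eq_of_eventually_eval_eq {p q : Polynomial ℚ}
    (h : ∀ᶠ n : ℤ in Filter.atTop, p.eval (n : ℚ) = q.eval (n : ℚ)) : p = q := by
  obtain ⟨N, hN⟩ := Filter.eventually_atTop.1 h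
  refine Polynomial.eq_of_infinite_eval_eq p q ?_
  refine ((Set.Ici_infinite N).image (f := fun n : ℤ => (n : ℚ))
    (Int.cast_injective.injOn)).mono ?_
  rintro _ ⟨n, hn, rfl⟩
  exact hN n hn

variable {K : Type u} [Field K] [Infinite K] {r : ℕ}

/-- The Hilbert polynomial of `R/J` has degree `e - 1` if `R/J` has dimension and grade `e`. -/
theorem IsHomogeneousIdeal.degree_hilbertPolynomial {e : ℕ} {J : Ideal (CoordRing K r)}
    (hJ : IsHomogeneousIdeal J) (hJm : J ≤ irrelevantIdeal K r)
    (hext : ExtVanishes (irrelevantIdeal K r) (CoordRing K r ⧸ J) e)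
    (hdim : ringKrullDim (CoordRing K r ⧸ J) ≤ e) {q : Polynomial ℚ}
    (hq : ∀ᶠ n : ℤ in Filter.atTop, q.eval (n : ℚ) = hilbertFunction J n) :
    (e = 0 → q = 0) ∧ (1 ≤ e → q.degree = ((e - 1 : ℕ) : WithBot ℕ)) := by
  induction e generalizing J q with
  | zero =>
    refine ⟨fun _ => ?_, fun h => absurd h (by norm_num)⟩
    obtain ⟨N, hN⟩ := hJ.exists_forms_le (by simpa using hdim)
    refine Polynomial.eq_of_eventually_eval_eq ?_
    filter_upwards [hq, Filter.eventually_ge_atTop (N : ℤ)] with n hn hnN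
    rw [hn, hilbertFunction_eq_zero (hN n hnN), Polynomial.eval_zero]
  | succ e ih =>
    refine ⟨fun h => absurd h (by simp), fun _ => ?_⟩
    obtain ⟨l, hl1, hlm, hreg⟩ := exists_linear_form_regular
      (notMem_associatedPrimes_of_extVanishes hext (by omega))
    have hone : (1 : CoordRing K r) ∉ J := fun h =>
      isMaximal_irrelevantIdeal.ne_top ((Ideal.eq_top_iff_one _).2 (hJm h))
    have hl0 : l ≠ 0 := by
      rintro rfl
      exact hone (hreg 1 (by simp))
    have hlpow (n : ℕ) : l ^ n ∉ J := by
      induction n with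
      | zero => simpa using hone
      | succ n ihn => exact fun h => ihn (hreg _ (by rwa [pow_succ'] at h))
    have hlpowf (n : ℕ) : l ^ n ∈ forms K r n := by
      induction n with
      | zero => simpa using one_mem_forms
      | succ n ihn =>
        rw [pow_succ]
        exact_mod_cast mul_mem_forms ihn hl1
    have hl1' : l.IsHomogeneous 1 := by
      rw [IsHomogeneous, IsWeightedHomogeneous]
      intro α hα
      have h := mem_forms.1 hl1 α (mem_support_iff.2 hα)
      rw [← show α.degree = Finsupp.weight 1 α from
        DFunLike.congr_fun Finsupp.degree_eq_weight_one α]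
      exact_mod_cast h
    have hJ' : IsHomogeneousIdeal (J ⊔ Ideal.span {l}) := by
      have := isHomogeneousIdeal_span (t := 1) (f := fun _ => l) (d := fun _ => 1) (fun _ => hl1')
      rw [Set.range_const] at this
      exact hJ.sup this
    have hJm' : J ⊔ Ideal.span {l} ≤ irrelevantIdeal K r :=
      sup_le hJm ((Ideal.span_singleton_le_iff_mem _).2 hlm)
    have hdim' : ringKrullDim (CoordRing K r ⧸ (J ⊔ Ideal.span {l})) ≤ e := by
      have hnzd : Ideal.Quotient.mk J l ∈ nonZeroDivisors (CoordRing K r ⧸ J) := by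
        rw [mem_nonZeroDivisors_iff_right]
        intro x hx
        obtain ⟨x, rfl⟩ := Ideal.Quotient.mk_surjective x
        rw [← map_mul, Ideal.Quotient.eq_zero_iff_mem, mul_comm] at hx
        exact Ideal.Quotient.eq_zero_iff_mem.2 (hreg x hx)
      have h1 := ringKrullDim_quotient_succ_le_of_nonZeroDivisor hnzd
      have h2 : ringKrullDim ((CoordRing K r ⧸ J) ⧸ Ideal.span {Ideal.Quotient.mk J l}) =
          ringKrullDim (CoordRing K r ⧸ (J ⊔ Ideal.span {l})) := by
        rw [← Set.image_singleton, ← Ideal.map_span]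
        exact ringKrullDim_eq_of_ringEquiv (DoubleQuot.quotQuotEquivQuotSup J (Ideal.span {l}))
      rw [h2] at h1
      have h3 := h1.trans hdim
      rw [Nat.cast_add, Nat.cast_one] at h3
      exact (ENat.WithBot.add_le_add_one_right_iff).1 h3
    have hext' := hext.quotient_of_regular hreg rfl
    have hq' : ∀ᶠ n : ℤ in Filter.atTop,
        (q - q.comp (Polynomial.X - Polynomial.C 1)).eval (n : ℚ) =
          hilbertFunction (J ⊔ Ideal.span {l}) n := by
      have hshift := (Filter.tendsto_atTop_add_const_right Filter.atTop (-1 : ℤ)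
        Filter.tendsto_id).eventually hq
      filter_upwards [hq, hshift] with n h1 h2
      rw [hilbertFunction_sup_span hJ hl1 hl0 hreg, Polynomial.eval_sub, Polynomial.eval_comp, h1]
      congr 1
      rw [id, ← sub_eq_add_neg] at h2
      rw [← h2]
      simp
    obtain ⟨ih0, ih1⟩ := ih hJ' hJm' hext' hdim' hq'
    -- The powers of `l` stay outside `J`, so the Hilbert function is positive in every nonnegative
    -- degree. This settles `e = 0`, where the difference of `q` vanishes and cannot tell `q = 0`
    -- from a nonzero constant.
    have hq0 : q ≠ 0 := by
      rintro rfl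
      obtain ⟨N, hN⟩ := Filter.eventually_atTop.1 hq
      have h1 := hN (max N 0) (le_max_left _ _)
      obtain ⟨k, hk⟩ := Int.eq_ofNat_of_zero_le (le_max_right N 0)
      rw [hk, Polynomial.eval_zero] at h1
      exact (hilbertFunction_pos (hlpowf k) (hlpow k)).ne h1
    rw [Polynomial.degree_eq_natDegree hq0, Nat.add_sub_cancel]
    -- The difference of `q` has degree `e - 1`, or is zero if `e = 0`. A constant `q` forces `e =
    -- 0`; a nonconstant `q` has a nonzero difference and forces `e ≥ 1`.
    by_cases hd : q.natDegree = 0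
    · have hz : q - q.comp (Polynomial.X - Polynomial.C 1) = 0 := by
        rw [Polynomial.eq_C_of_natDegree_eq_zero hd, Polynomial.C_comp, sub_self]
      rcases Nat.eq_zero_or_pos e with rfl | he
      · rw [hd]
      · have := ih1 he
        rw [hz, Polynomial.degree_zero] at this
        exact absurd this.symm (WithBot.natCast_ne_bot _)
    · have h1 := Polynomial.degree_sub_comp_X_sub_one hd
      rcases Nat.eq_zero_or_pos e with rfl | he
      · rw [ih0 rfl, Polynomial.degree_zero] at h1
        exact absurd h1.symm (WithBot.natCast_ne_bot _)
      · rw [ih1 he] at h1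
        have h2 : e - 1 = q.natDegree - 1 := by exact_mod_cast h1
        have h3 : q.natDegree = e := by omega
        rw [h3]

end Degree

lemma _root_.LinearMap.finrank_map_add_finrank_inf_ker {K V W : Type*} [Field K] [AddCommGroup V]
    [Module K V] [AddCommGroup W] [Module K W] (φ : V →ₗ[K] W) (U : Submodule K V)
    [Module.Finite K U] :
    Module.finrank K (U.map φ) + Module.finrank K (U ⊓ LinearMap.ker φ : Submodule K V) =
      Module.finrank K U := by
  have h := LinearMap.finrank_range_add_finrank_ker (φ.domRestrict U)
  rw [LinearMap.range_domRestrict, LinearMap.ker_domRestrict] at h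
  rw [← h, ← Submodule.map_comap_subtype, Submodule.finrank_map_subtype_eq]

/-! ### Consequences of a coordinate projection with image `I` and kernel `P` -/

section GradedPieces

variable {K : Type u} [Field K] {r : ℕ} {ι : Type} {deg : ι → ℤ}

lemma mem_gradedPiece {n : ℤ} {v : ι → CoordRing K r} :
    v ∈ gradedPiece K r deg n ↔ ∀ b, v b ∈ forms K r (n - deg b) := by
  simp [gradedPiece, Submodule.mem_pi]

lemma IsGradedSubmodule.of_le_span {M : Submodule (CoordRing K r) (ι → CoordRing K r)}
    (h : M ≤ Submodule.span (CoordRing K r) {v | v ∈ M ∧ ∃ n, v ∈ gradedPiece K r deg n}) :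
    IsGradedSubmodule deg M :=
  le_antisymm (Submodule.span_le.2 fun _ hv => hv.1) h

variable (deg) in
/-- The projection of a graded free module onto its homogeneous elements of degree `n`. -/
def piecePart (n : ℤ) : (ι → CoordRing K r) →ₗ[K] (ι → CoordRing K r) :=
  LinearMap.pi fun b => formPart (n - deg b) ∘ₗ LinearMap.proj b

lemma piecePart_apply (n : ℤ) (v : ι → CoordRing K r) (b : ι) :
    piecePart deg n v b = formPart (n - deg b) (v b) := rfl

lemma piecePart_mem_gradedPiece (n : ℤ) (v : ι → CoordRing K r) :
    piecePart deg n v ∈ gradedPiece K r deg n :=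
  mem_gradedPiece.2 fun _ => formPart_mem_forms _ _

lemma piecePart_of_mem {n : ℤ} {v : ι → CoordRing K r} (hv : v ∈ gradedPiece K r deg n) :
    piecePart deg n v = v :=
  funext fun b => formPart_of_mem_forms (mem_gradedPiece.1 hv b)

lemma piecePart_mem_supportedOn {B : Set ι} {v : ι → CoordRing K r}
    (hv : v ∈ supportedOn (CoordRing K r) B) (n : ℤ) :
    piecePart deg n v ∈ supportedOn (CoordRing K r) B := by
  rw [mem_supportedOn] at hv ⊢
  intro b hb
  rw [piecePart_apply, hv b hb, map_zero]

variable {N P : Submodule (CoordRing K r) (ι → CoordRing K r)} {I : Ideal (CoordRing K r)} {b : ι}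

/-- Applied with `b = (o, univ)`: the map `N → I_D(k)` is a coordinate, and the twist is `-deg b`.
-/
lemma hasExactSequence_of_proj (hI : N.map (LinearMap.proj b) = I)
    (hP : N ⊓ LinearMap.ker (LinearMap.proj b) = P) : HasExactSequence deg P N I (-deg b) := by
  refine ⟨hP ▸ inf_le_left, (LinearMap.proj b).domRestrict N, ?_, ?_, fun n v hv => ?_⟩
  · rw [LinearMap.range_domRestrict, hI]
  · ext v
    rw [← hP]
    exact ⟨fun h => ⟨v.2, h⟩, fun h => h.2⟩
  · rw [← sub_eq_add_neg]
    exact mem_gradedPiece.1 hv b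

variable [Fintype ι]

instance finite_gradedPiece (n : ℤ) : Module.Finite K (gradedPiece K r deg n) := by
  let φ : gradedPiece K r deg n →ₗ[K] ∀ b, forms K r (n - deg b) :=
    LinearMap.pi fun b => LinearMap.codRestrict _ (LinearMap.proj b ∘ₗ Submodule.subtype _)
      fun v => mem_gradedPiece.1 v.2 b
  refine Module.Finite.of_injective φ fun v w h => Subtype.ext (funext fun b => ?_)
  exact congrArg Subtype.val (congrFun h b)

instance finite_component (M : Submodule (CoordRing K r) (ι → CoordRing K r)) (n : ℤ) :
    Module.Finite K (component deg M n) :=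
  Submodule.finiteDimensional_of_le (inf_le_right : component deg M n ≤ gradedPiece K r deg n)

variable (deg) in
/-- A homogeneous element of the graded free module on `B` is a family of forms. -/
def componentSupportedOnEquiv (B : Set ι) [DecidablePred (· ∈ B)] (n : ℤ) :
    component deg (supportedOn (CoordRing K r) B) n ≃ₗ[K] ∀ b : B, forms K r (n - deg b) where
  toFun v b := ⟨v.1 b, mem_gradedPiece.1 v.2.2 b⟩
  map_add' _ _ := rfl
  map_smul' _ _ := rfl
  invFun w := ⟨fun b => if h : b ∈ B then w ⟨b, h⟩ else 0, by
    refine ⟨mem_supportedOn.2 fun b hb => dif_neg hb, mem_gradedPiece.2 fun b => ?_⟩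
    dsimp only
    split_ifs with h
    · exact (w ⟨b, h⟩).2
    · exact Submodule.zero_mem _⟩
  left_inv v := by
    refine Subtype.ext (funext fun b => ?_)
    by_cases h : b ∈ B
    · simp [h]
    · simp [h, mem_supportedOn.1 v.2.1 b h]
  right_inv w := by
    funext b
    exact Subtype.ext (dif_pos b.2)

lemma exists_isHilbertPolynomial_supportedOn (B : Set ι) :
    ∃ q, IsHilbertPolynomial deg (supportedOn (CoordRing K r) B) q := by
  classical
  refine ⟨∑ b : B, (Polynomial.preHilbertPoly ℚ r 0).comp
    (Polynomial.X - Polynomial.C (deg b : ℚ)), ?_⟩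
  have h : ∀ᶠ n : ℤ in Filter.atTop, ∀ b : B, deg b ≤ n :=
    Filter.eventually_all.2 fun b => Filter.eventually_ge_atTop _
  filter_upwards [h] with n hn
  rw [(componentSupportedOnEquiv deg B n).finrank_eq, Module.finrank_pi_fintype,
    Polynomial.eval_finsetSum, Nat.cast_sum]
  refine Finset.sum_congr rfl fun b _ => ?_
  rw [← eval_preHilbertPoly_eq_finrank_forms (sub_nonneg.2 (hn b)), Polynomial.eval_comp]
  simp

/-- Rank–nullity in degree `n`; `hN` lets a form of `I` be lifted to a homogeneous element of `N`.
-/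
lemma finrank_idealForms_add_finrank_component (hI : N.map (LinearMap.proj b) = I)
    (hP : N ⊓ LinearMap.ker (LinearMap.proj b) = P) (hN : ∀ v ∈ N, ∀ n, piecePart deg n v ∈ N)
    (n : ℤ) : Module.finrank K (idealForms I (n - deg b)) + Module.finrank K (component deg P n) =
      Module.finrank K (component deg N n) := by
  let φ : (ι → CoordRing K r) →ₗ[K] CoordRing K r := LinearMap.proj b
  rw [← LinearMap.finrank_map_add_finrank_inf_ker φ (component deg N n)]
  have h1 : (component deg N n).map φ = idealForms I (n - deg b) := by
    apply le_antisymm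
    · rintro _ ⟨v, hv, rfl⟩
      exact ⟨hI ▸ ⟨v, hv.1, rfl⟩, mem_gradedPiece.1 hv.2 b⟩
    · rintro g ⟨hg, hgn⟩
      rw [← hI] at hg
      obtain ⟨v, hv, rfl⟩ := hg
      exact ⟨piecePart deg n v, ⟨hN v hv n, piecePart_mem_gradedPiece n v⟩,
        formPart_of_mem_forms hgn⟩
  have h2 : component deg N n ⊓ LinearMap.ker φ = component deg P n := by
    ext v
    rw [← hP]
    exact and_right_comm
  rw [h1, h2]

/-- Additivity identifies the polynomial with the Hilbert polynomial of `R/I`, of degree `(r + 1 -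
s) - 1`. -/
lemma hilbertCondition_of_proj [Infinite K] {s : ℕ} (hI : N.map (LinearMap.proj b) = I)
    (hP : N ⊓ LinearMap.ker (LinearMap.proj b) = P) (hN : ∀ v ∈ N, ∀ n, piecePart deg n v ∈ N)
    (hqN : ∃ q, IsHilbertPolynomial deg N q) (hqP : ∃ q, IsHilbertPolynomial deg P q)
    (hIh : IsHomogeneousIdeal I) (hIm : I ≤ irrelevantIdeal K r)
    (hext : ExtVanishes (irrelevantIdeal K r) (CoordRing K r ⧸ I) (r + 1 - s))
    (hdim : ringKrullDim (CoordRing K r ⧸ I) ≤ (r + 1 - s : ℕ)) (hs : s ≤ r) :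
    HilbertCondition deg N P s (-deg b) := by
  obtain ⟨qN, hqN⟩ := hqN
  obtain ⟨qP, hqP⟩ := hqP
  refine ⟨qN, qP, hqN, hqP, ?_⟩
  have hshift := Filter.tendsto_atTop_add_const_right Filter.atTop (deg b) Filter.tendsto_id
  rw [(hIh.degree_hilbertPolynomial hIm hext hdim ?_).2 (by omega)]
  · congr 1
    omega
  filter_upwards [hshift.eventually hqN, hshift.eventually hqP, Filter.eventually_ge_atTop 0]
    with n h1 h2 h3
  have h4 := finrank_idealForms_add_finrank_component (deg := deg) hI hP hN (n + deg b)
  rw [add_sub_cancel_right] at h4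
  rw [id] at h1 h2
  rw [hilbertFunction, ← eval_preHilbertPoly_eq_finrank_forms h3]
  have h5 : ((n + deg b : ℤ) : ℚ) = n - (-deg b : ℤ) := by push_cast; ring
  rw [h5, ← h4] at h1
  rw [h5] at h2
  simp only [Polynomial.eval_add, Polynomial.eval_neg, Polynomial.eval_comp, Polynomial.eval_sub,
    Polynomial.eval_X, Polynomial.eval_C, h1, h2]
  push_cast
  ring

/-- An element of `M` outside `P` has nonzero `b`-coordinate, so `M` has larger rank than the kernel
of that coordinate on `M`. But `x_0^n P` lies in this kernel for large `n`, so `M` would have larger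
rank than `P`. -/
lemma isMaximalSubsheaf_of_proj (hP : N ⊓ LinearMap.ker (LinearMap.proj b) = P) :
    IsMaximalSubsheaf deg P N := by
  classical
  refine ⟨fun i v hv => ⟨0, by rw [pow_zero, one_smul, ← hP] at *; exact hv.1⟩,
    fun M _ hMN hPM hrank => ?_⟩
  suffices h : M ≤ P from fun i v hv => ⟨0, by rw [pow_zero, one_smul]; exact h hv⟩
  intro v hv
  by_contra hvP
  have hvb : v b ≠ 0 := fun h => hvP (hP ▸ ⟨hMN hv, h⟩)
  let φ := (LinearMap.proj b : (ι → CoordRing K r) →ₗ[CoordRing K r] CoordRing K r).domRestrict M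
  have h1 := (LinearMap.ker φ).finrank_quotient_add_finrank
  rw [φ.quotKerEquivRange.finrank_eq] at h1
  have h2 : 0 < Module.finrank (CoordRing K r) (LinearMap.range φ) := by
    have : Nontrivial (LinearMap.range φ) :=
      ⟨⟨⟨v b, ⟨v, hv⟩, rfl⟩, 0, fun h => hvb (congrArg Subtype.val h)⟩⟩
    exact Module.finrank_pos
  obtain ⟨n, hn⟩ : ∃ n : ℕ, ∀ p ∈ P, (X 0 : CoordRing K r) ^ n • p ∈ M := by
    obtain ⟨S, hS⟩ : P.FG := IsNoetherian.noetherian P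
    choose! e he using fun p hp => hPM 0 p hp
    refine ⟨S.sup e, ?_⟩
    suffices h : P ≤ M.comap (LinearMap.lsmul _ _ ((X 0 : CoordRing K r) ^ S.sup e)) from h
    conv_lhs => rw [← hS]
    refine Submodule.span_le.2 fun p hp => ?_
    have hpP : p ∈ P := hS ▸ Submodule.subset_span hp
    change (X 0 : CoordRing K r) ^ S.sup e • p ∈ M
    obtain ⟨c, hc⟩ := Nat.exists_eq_add_of_le (Finset.le_sup (f := e) hp)
    rw [hc, add_comm (e p), pow_add, mul_smul]
    exact M.smul_mem _ (he p hpP)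
  let ψ : P →ₗ[CoordRing K r] LinearMap.ker φ :=
    LinearMap.codRestrict _ (LinearMap.codRestrict M
      (LinearMap.lsmul _ _ ((X 0 : CoordRing K r) ^ n) ∘ₗ P.subtype) fun p => hn p p.2)
      fun p => by
        have hp : (p : ι → CoordRing K r) b = 0 := by
          have h : (p : ι → CoordRing K r) ∈ N ⊓ LinearMap.ker (LinearMap.proj b) :=
            hP.symm ▸ p.2
          exact h.2
        change (X 0 : CoordRing K r) ^ n * (p : ι → CoordRing K r) b = 0
        rw [hp, mul_zero]
  have hψ : Function.Injective ψ := by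
    intro p q h
    have h' : (X 0 : CoordRing K r) ^ n • (p : ι → CoordRing K r) = (X 0 : CoordRing K r) ^ n • q :=
      congrArg (fun x : LinearMap.ker φ => (x.1.1 : ι → CoordRing K r)) h
    exact Subtype.ext (smul_right_injective _ (pow_ne_zero n (X_ne_zero 0)) h')
  have h3 := LinearMap.finrank_le_finrank_of_injective hψ
  omega

end GradedPieces

/-! ### Gradedness and Hilbert polynomials of images of `δ` -/

namespace GradedFreeComplex

variable {K : Type u} [Field K] {r : ℕ} {C : GradedFreeComplex K r}

lemma piecePart_δ (n : ℤ) (v : C.ι → CoordRing K r) :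
    piecePart C.deg n (C.δ v) = C.δ (piecePart C.deg n v) := by
  funext a
  rw [piecePart_apply, δ_apply, δ_apply, map_sum]
  refine Finset.sum_congr rfl fun b _ => ?_
  rw [piecePart_apply, formPart_mul (C.d_deg a b)]
  ring

lemma δ_mem_gradedPiece {n : ℤ} {v : C.ι → CoordRing K r} (hv : v ∈ gradedPiece K r C.deg n) :
    C.δ v ∈ gradedPiece K r C.deg n := by
  rw [← piecePart_of_mem hv, ← piecePart_δ]
  exact piecePart_mem_gradedPiece _ _

lemma piecePart_mem_map_δ {B : Set C.ι} {v : C.ι → CoordRing K r}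
    (hv : v ∈ (ProjACM.supportedOn (CoordRing K r) B).map C.δ) (n : ℤ) :
    piecePart C.deg n v ∈ (ProjACM.supportedOn (CoordRing K r) B).map C.δ := by
  obtain ⟨w, hw, rfl⟩ := hv
  exact ⟨_, piecePart_mem_supportedOn hw n, (piecePart_δ n w).symm⟩

lemma isGradedSubmodule_map_δ (B : Set C.ι) :
    IsGradedSubmodule C.deg ((ProjACM.supportedOn (CoordRing K r) B).map C.δ) := by
  refine .of_le_span ?_
  rintro _ ⟨w, hw, rfl⟩
  have hsum : w = ∑ b, w b • Pi.single b (1 : CoordRing K r) := by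
    funext a
    simp [Finset.sum_apply, Pi.single_apply]
  rw [hsum, map_sum]
  refine Submodule.sum_mem _ fun b _ => ?_
  rw [map_smul]
  by_cases hb : b ∈ B
  · refine Submodule.smul_mem _ _ (Submodule.subset_span ⟨⟨_, ?_, rfl⟩, C.deg b,
      δ_mem_gradedPiece (mem_gradedPiece.2 fun a => ?_)⟩)
    · refine mem_supportedOn.2 fun a ha => Pi.single_eq_of_ne ?_ _
      rintro rfl
      exact ha hb
    · rcases eq_or_ne a b with rfl | h
      · rw [Pi.single_eq_same, sub_self]
        exact one_mem_forms
      · rw [Pi.single_eq_of_ne h]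
        exact Submodule.zero_mem _
  · rw [mem_supportedOn.1 hw b hb, zero_smul]
    exact Submodule.zero_mem _

lemma exists_isHilbertPolynomial_map_δ {B : Set C.ι} {q : Polynomial ℚ}
    (hq : IsHilbertPolynomial C.deg
      (ProjACM.supportedOn (CoordRing K r) B ⊓ LinearMap.ker C.δ) q) :
    ∃ q, IsHilbertPolynomial C.deg ((ProjACM.supportedOn (CoordRing K r) B).map C.δ) q := by
  obtain ⟨p, hp⟩ := exists_isHilbertPolynomial_supportedOn (K := K) (r := r) (deg := C.deg) B
  refine ⟨p - q, ?_⟩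
  filter_upwards [hp, hq] with n h1 h2
  let φ : (C.ι → CoordRing K r) →ₗ[K] (C.ι → CoordRing K r) := C.δ.restrictScalars K
  have h3 := LinearMap.finrank_map_add_finrank_inf_ker φ
    (component C.deg (ProjACM.supportedOn (CoordRing K r) B) n)
  have h4 : (component C.deg (ProjACM.supportedOn (CoordRing K r) B) n).map φ =
      component C.deg ((ProjACM.supportedOn (CoordRing K r) B).map C.δ) n := by
    apply le_antisymm
    · rintro _ ⟨v, hv, rfl⟩
      exact ⟨⟨v, hv.1, rfl⟩, δ_mem_gradedPiece hv.2⟩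
    · rintro _ ⟨⟨v, hv, rfl⟩, hn⟩
      refine ⟨piecePart C.deg n v,
        ⟨piecePart_mem_supportedOn hv n, piecePart_mem_gradedPiece n v⟩, ?_⟩
      exact (piecePart_δ n v).symm.trans (piecePart_of_mem hn)
  have h5 : component C.deg (ProjACM.supportedOn (CoordRing K r) B) n ⊓ LinearMap.ker φ =
      component C.deg (ProjACM.supportedOn (CoordRing K r) B ⊓ LinearMap.ker C.δ) n := by
    ext v
    exact and_right_comm
  rw [h4, h5] at h3
  rw [Polynomial.eval_sub, h1, h2, ← h3]
  push_cast
  ring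

/-- Descending induction from the zero end, by rank–nullity against the Hilbert polynomial of a free
module. -/
lemma exists_isHilbertPolynomial_of_chain {B : ℕ → Set C.ι} {n₀ L : ℕ}
    (hex : ∀ n, n₀ ≤ n → ProjACM.supportedOn (CoordRing K r) (B n) ⊓ LinearMap.ker C.δ =
      (ProjACM.supportedOn (CoordRing K r) (B (n + 1))).map C.δ)
    (hL : ∀ n, L < n → B n = ∅) (n : ℕ) (hn : n₀ ≤ n) :
    ∃ q, IsHilbertPolynomial C.deg ((ProjACM.supportedOn (CoordRing K r) (B n)).map C.δ) q := by
  obtain ⟨m, hm⟩ : ∃ m, L < n + m := ⟨L + 1, by omega⟩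
  induction m generalizing n with
  | zero =>
    have hbot : (ProjACM.supportedOn (CoordRing K r) (B n)).map C.δ =
        ProjACM.supportedOn (CoordRing K r) (∅ : Set C.ι) := by
      rw [hL n hm]
      have h0 : ProjACM.supportedOn (CoordRing K r) (∅ : Set C.ι) = ⊥ := by
        refine eq_bot_iff.2 fun v hv => ?_
        exact (Submodule.mem_bot _).2 (funext fun b => mem_supportedOn.1 hv b (Set.notMem_empty b))
      rw [h0, Submodule.map_bot]
    rw [hbot]
    exact exists_isHilbertPolynomial_supportedOn _
  | succ m ih =>
    obtain ⟨q, hq⟩ := ih (n + 1) (by omega) (by omega)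
    rw [← hex n hn] at hq
    exact exists_isHilbertPolynomial_map_δ hq

end GradedFreeComplex

/-! ### Freeness of the modules supported on a set of basis elements -/

section FreeOn

variable {R : Type u} {ι : Type} [CommRing R] {B : Set ι}

/-- The functions supported on `B` are the functions on `B`. -/
def supportedOnEquiv (R : Type u) [CommRing R] (B : Set ι) [DecidablePred (· ∈ B)] :
    supportedOn R B ≃ₗ[R] (B → R) where
  toFun v b := v.1 b
  map_add' _ _ := rfl
  map_smul' _ _ := rfl
  invFun w := ⟨fun b => if h : b ∈ B then w ⟨b, h⟩ else 0, mem_supportedOn.2 fun _ hb => dif_neg hb⟩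
  left_inv v := by
    refine Subtype.ext (funext fun b => ?_)
    by_cases h : b ∈ B
    · simp [h]
    · simp [h, mem_supportedOn.1 v.2 b h]
  right_inv w := by
    funext b
    exact dif_pos b.2

instance free_supportedOn [Finite ι] : Module.Free R (supportedOn R B) := by
  classical
  exact Module.Free.of_equiv (supportedOnEquiv R B).symm

instance finite_supportedOn [Finite ι] : Module.Finite R (supportedOn R B) := by
  classical
  exact Module.Finite.equiv (supportedOnEquiv R B).symm

lemma supportedOn_eq_bot (h : ∀ b, b ∉ B) : supportedOn R B = ⊥ :=
  eq_bot_iff.2 fun _ hv => (Submodule.mem_bot _).2 (funext fun b => mem_supportedOn.1 hv b (h b))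

lemma single_mem_supportedOn [DecidableEq ι] {b : ι} (hb : b ∈ B) (c : R) :
    Pi.single b c ∈ supportedOn R B := by
  refine mem_supportedOn.2 fun a ha => Pi.single_eq_of_ne ?_ _
  rintro rfl
  exact ha hb

lemma supportedOn_ne_bot [Nontrivial R] {b : ι} (hb : b ∈ B) : supportedOn R B ≠ ⊥ := by
  classical
  intro h
  have h1 := single_mem_supportedOn hb (1 : R)
  rw [h, Submodule.mem_bot] at h1
  have h2 := congrFun h1 b
  rw [Pi.single_eq_same] at h2
  exact one_ne_zero h2

lemma mem_smul_supportedOn [Fintype ι] {I : Ideal R} {v : ι → R} (hv : v ∈ supportedOn R B)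
    (hI : ∀ b, v b ∈ I) : v ∈ I • supportedOn R B := by
  classical
  have hsum : v = ∑ b, v b • Pi.single b (1 : R) := by
    funext a
    simp [Finset.sum_apply, Pi.single_apply]
  rw [hsum]
  refine Submodule.sum_mem _ fun b _ => ?_
  by_cases hb : b ∈ B
  · exact Submodule.smul_mem_smul (hI b) (single_mem_supportedOn hb 1)
  · rw [mem_supportedOn.1 hv b hb, zero_smul]
    exact Submodule.zero_mem _

end FreeOn

/-! ### Regularity of the forms modulo `I_D` -/

section Schemes

variable {K : Type u} [Field K] {r : ℕ}

lemma saturation_mono {I J : Ideal (CoordRing K r)} (h : I ≤ J) : saturation I ≤ saturation J :=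
  fun _ hg i => (hg i).imp fun _ hn => h hn

lemma saturation_sup_saturation (I J : Ideal (CoordRing K r)) :
    saturation (I ⊔ saturation J) = saturation (I ⊔ J) := by
  refine le_antisymm ?_ (saturation_mono (sup_le_sup_left (le_saturation J) I))
  rw [← saturation_saturation (I ⊔ J)]
  exact saturation_mono (sup_le (le_sup_left.trans (le_saturation _))
    (saturation_mono le_sup_right))

namespace ClosedSubscheme

variable {X : ClosedSubscheme K r} {c : ℕ}

lemma HasCodim.le_irrelevantIdeal (h : X.HasCodim c) : X.ideal ≤ irrelevantIdeal K r := by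
  refine X.homogeneous.le_irrelevantIdeal fun htop => ?_
  have hs : Subsingleton (CoordRing K r ⧸ X.ideal) := Ideal.Quotient.subsingleton_iff.2 htop
  rw [HasCodim, ringKrullDim_eq_bot_of_subsingleton, WithBot.bot_add] at h
  exact WithBot.bot_ne_coe h

lemma HasCodim.ringKrullDim_eq (h : X.HasCodim c) (hc : c ≤ r + 1) :
    ringKrullDim (CoordRing K r ⧸ X.ideal) = (r + 1 - c : ℕ) := by
  rw [HasCodim] at h
  have h1 : ((r + 1 : ℕ) : WithBot ℕ∞) = ((r + 1 - c : ℕ) : WithBot ℕ∞) + (c : WithBot ℕ∞) := by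
    rw [← Nat.cast_add, Nat.sub_add_cancel hc]
  rw [h1] at h
  refine le_antisymm ?_ ?_
  · exact (ENat.WithBot.add_le_add_natCast_right_iff).1 h.le
  · exact (ENat.WithBot.add_le_add_natCast_right_iff).1 h.ge

end ClosedSubscheme

variable {t : ℕ} {f : Fin t → CoordRing K r} {d : Fin t → ℕ} {I : Ideal (CoordRing K r)}

lemma GradedFreeComplex.partialIdeal_zero : partialIdeal I f 0 = I := by
  simp [partialIdeal]

lemma GradedFreeComplex.partialIdeal_succ (j : Fin t) :
    partialIdeal I f (j + 1) = partialIdeal I f j ⊔ Ideal.span {f j} := by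
  have h : {i : Fin t | (i : ℕ) < j + 1} = {i : Fin t | (i : ℕ) < j} ∪ {j} := by
    ext i
    simp only [Set.mem_ofPred_eq, Set.mem_union, Set.mem_singleton_iff, Fin.ext_iff]
    omega
  rw [partialIdeal, partialIdeal, h, Set.image_union, Set.image_singleton, Ideal.span_union,
    sup_assoc]

lemma GradedFreeComplex.partialIdeal_self :
    partialIdeal I f t = I ⊔ Ideal.span (Set.range f) := by
  have h : {i : Fin t | (i : ℕ) < t} = Set.univ := Set.eq_univ_of_forall fun i => i.2
  rw [partialIdeal, h, Set.image_univ]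

attribute [local instance] MvPolynomial.gradedAlgebra in
lemma GradedFreeComplex.isHomogeneousIdeal_partialIdeal (hI : IsHomogeneousIdeal I)
    (hf : ∀ i, (f i).IsHomogeneous (d i)) (j : ℕ) : IsHomogeneousIdeal (partialIdeal I f j) := by
  refine hI.sup (Ideal.homogeneous_span _ _ ?_)
  rintro _ ⟨i, -, rfl⟩
  exact ⟨d i, hf i⟩

open GradedFreeComplex

/-- If `R/I` has grade `c + t` and the quotient by `f_1, …, f_t` has dimension `c`, then
`f_1, …, f_t` is regular on `R/I`. -/
lemma mem_partialIdeal_of_mul_mem (hI : IsHomogeneousIdeal I)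
    (hf : ∀ i, (f i).IsHomogeneous (d i)) (hJm : partialIdeal I f t ≤ irrelevantIdeal K r) {c : ℕ}
    (hext : ExtVanishes (irrelevantIdeal K r) (CoordRing K r ⧸ I) (c + t))
    (hdim : ringKrullDim (CoordRing K r ⧸ partialIdeal I f t) = c) (j : Fin t)
    (g : CoordRing K r) (hg : f j * g ∈ partialIdeal I f j) : g ∈ partialIdeal I f j := by
  classical
  have hle (j : ℕ) : partialIdeal I f j ≤ partialIdeal I f t := by
    rw [partialIdeal_self]
    exact sup_le_sup_left (Ideal.span_mono (Set.image_subset_range _ _)) I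
  have hfm (i : Fin t) : f i ∈ irrelevantIdeal K r := by
    refine hJm ?_
    rw [partialIdeal_self]
    exact Ideal.mem_sup_right (Ideal.subset_span ⟨i, rfl⟩)
  have hreg (j : Fin t)
      (h : ExtVanishes (irrelevantIdeal K r) (CoordRing K r ⧸ partialIdeal I f j) (c + t - j))
      (g : CoordRing K r) (hg : f j * g ∈ partialIdeal I f j) : g ∈ partialIdeal I f j := by
    -- The remaining forms: at most `t - 1 - j` of them cut down to dimension `c`, and `c + (t - 1 -
    -- j) < c + t - j`.
    let S : Finset (CoordRing K r) := (Finset.Ioi j).image f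
    refine (isHomogeneousIdeal_partialIdeal hI hf j).regular_of_ringKrullDim_lt
      ((hle j).trans hJm) h (hf j) S ?_ (J' := partialIdeal I f t) ?_ ?_ g hg
    · intro x hx
      obtain ⟨i, -, rfl⟩ := Finset.mem_image.1 (Finset.mem_coe.1 hx)
      exact hfm i
    · rw [partialIdeal_self, partialIdeal]
      refine sup_le (le_sup_left.trans (le_sup_left.trans le_sup_left)) (Ideal.span_le.2 ?_)
      rintro _ ⟨i, rfl⟩
      rcases lt_trichotomy i j with h | rfl | h
      · exact Ideal.mem_sup_left (Ideal.mem_sup_left (Ideal.mem_sup_right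
          (Ideal.subset_span ⟨i, h, rfl⟩)))
      · exact Ideal.mem_sup_left (Ideal.mem_sup_right (Ideal.subset_span rfl))
      · exact Ideal.mem_sup_right (Ideal.subset_span
          (Finset.mem_coe.2 (Finset.mem_image_of_mem f (Finset.mem_Ioi.2 h))))
    · have hS : S.card ≤ t - 1 - j := Finset.card_image_le.trans (Fin.card_Ioi j).le
      have := j.2
      rw [hdim, ← Nat.cast_add]
      exact_mod_cast (by omega : c + S.card < c + t - j)
  -- Grade and regularity alternate: the grade at stage `j` makes `f_j` regular, which gives the
  -- grade at stage `j + 1`.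
  have hj : ∀ j ≤ t,
      ExtVanishes (irrelevantIdeal K r) (CoordRing K r ⧸ partialIdeal I f j) (c + t - j) := by
    intro j
    induction j with
    | zero =>
      intro _
      rwa [partialIdeal_zero]
    | succ j ih =>
      intro hj
      have h1 := ih (by omega)
      have h2 : c + t - j = c + t - (j + 1) + 1 := by omega
      have h3 := hreg ⟨j, hj⟩ h1
      rw [h2] at h1
      exact h1.quotient_of_regular h3 (partialIdeal_succ ⟨j, hj⟩)
  exact hreg j (hj j j.2.le) g hg

/-- Regularity is a statement about `R`, so although it is obtained at the irrelevant ideal it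
transports the grade at any `m`. -/
lemma extVanishes_partialIdeal {m : Ideal (CoordRing K r)}
    (hreg : ∀ (j : Fin t) (g : CoordRing K r), f j * g ∈ partialIdeal I f j →
      g ∈ partialIdeal I f j) {c : ℕ}
    (hext : ExtVanishes m (CoordRing K r ⧸ I) (c + t)) :
    ExtVanishes m (CoordRing K r ⧸ partialIdeal I f t) c := by
  have hj : ∀ j ≤ t, ExtVanishes m (CoordRing K r ⧸ partialIdeal I f j) (c + t - j) := by
    intro j
    induction j with
    | zero =>
      intro _
      rwa [partialIdeal_zero]
    | succ j ih =>
      intro hj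
      have h1 := ih (by omega)
      have h2 : c + t - j = c + t - (j + 1) + 1 := by omega
      rw [h2] at h1
      exact h1.quotient_of_regular (hreg ⟨j, hj⟩) (partialIdeal_succ ⟨j, hj⟩)
  simpa using hj t le_rfl

end Schemes

/-! ### Minimality, and grade from a free resolution -/

namespace GradedFreeComplex

variable {K : Type u} [Field K] {r : ℕ} {C : GradedFreeComplex K r} {I : Ideal (CoordRing K r)}

lemma map_δ_le_smul (hmin : ∀ a b, constantCoeff (C.d a b) = 0) {B B' : Set C.ι}
    (h : ∀ v ∈ ProjACM.supportedOn (CoordRing K r) B,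
      C.δ v ∈ ProjACM.supportedOn (CoordRing K r) B') :
    (ProjACM.supportedOn (CoordRing K r) B).map C.δ ≤
      irrelevantIdeal K r • ProjACM.supportedOn (CoordRing K r) B' := by
  rintro _ ⟨v, hv, rfl⟩
  refine mem_smul_supportedOn (h v hv) fun a => ?_
  rw [δ_apply]
  exact Submodule.sum_mem _ fun b _ => Ideal.mul_mem_right _ _ (hmin a b)

/-- The cokernel of a free resolution of length `L` has grade at least `r + 1 - L` at every
point. -/
lemma extVanishes_quotient {o : C.ι} (ho : ∀ b, C.hdeg b = 0 ↔ b = o)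
    (hI : (C.term 1).map (LinearMap.proj o ∘ₗ C.δ) = I)
    (hex : ∀ n, 1 ≤ n → C.syzygy n = (C.term (n + 1)).map C.δ) {L : ℕ} (hL : ∀ b, C.hdeg b ≤ L)
    (hLr : L ≤ r + 1) (a : Fin (r + 1) → K) :
    ExtVanishes (pointIdeal a) (CoordRing K r ⧸ I) (r + 1 - L) := by
  have h1 : ExtVanishes (pointIdeal a) ((C.term 1).map C.δ) (r + 1 + 1 - L) :=
    extVanishes_map_of_chain (F := C.term) (n₀ := 1) (L := L)
      (fun n => extVanishes_pointIdeal_of_free a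
        (ProjACM.supportedOn (CoordRing K r) {b | C.hdeg b = n})) hex
      (supportedOn_eq_bot (B := {b | C.hdeg b = L + 1}) fun b hb => by
        have h : C.hdeg b = L + 1 := hb
        have := hL b
        omega) L 1 le_rfl (by omega)
  -- The image of `C_1` lies in the rank one module `C_0`, so the coordinate `o` identifies it with
  -- `I`; one more shift passes to `R/I`.
  let φ : (C.term 1).map C.δ →ₗ[CoordRing K r] CoordRing K r :=
    (LinearMap.proj o).domRestrict _
  have hφ : Function.Injective φ := by
    rintro ⟨_, v, hv, rfl⟩ ⟨_, w, hw, rfl⟩ h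
    refine Subtype.ext (funext fun b => ?_)
    by_cases hb : b = o
    · subst hb
      exact h
    · have hb' : C.hdeg b ≠ 0 := fun h0 => hb ((ho b).1 h0)
      exact (C.mem_term.1 (C.δ_mem_term (n := 0) hv) b hb').trans
        (C.mem_term.1 (C.δ_mem_term (n := 0) hw) b hb').symm
  have hr : LinearMap.range φ = LinearMap.ker (Submodule.mkQ I) := by
    rw [LinearMap.range_domRestrict, Submodule.ker_mkQ, ← hI, Submodule.map_comp]
  refine ExtVanishes.of_exact hr hφ (Submodule.mkQ_surjective I)
    ((extVanishes_pointIdeal_of_free a (CoordRing K r)).mono (by omega)) ?_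
  rwa [show r + 1 - L + 1 = r + 1 + 1 - L by omega]

end GradedFreeComplex

/-! ### The resolution of `X`, and `P` and `N` through the top component -/

namespace GradedFreeComplex

variable {K : Type u} [Field K] {r t : ℕ} {f : Fin t → CoordRing K r} {d : Fin t → ℕ}
  {H : GradedFreeComplex K r} {o : H.ι} {I : Ideal (CoordRing K r)}

lemma mem_koszulTrunc_self (v : H.KoszulModule t) : v ∈ H.koszulTrunc t t :=
  mem_koszulTrunc.2 fun _ _ ⟨i, _, hi⟩ => absurd i.2 hi.not_gt

lemma tensor_koszul_syzygy (hf : ∀ i, (f i).IsHomogeneous (d i))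
    (ho : ∀ b, H.hdeg b = 0 ↔ b = o) (hI : (H.term 1).map (LinearMap.proj o ∘ₗ H.δ) = I)
    (hex : ∀ n, 1 ≤ n → H.syzygy n = (H.term (n + 1)).map H.δ)
    (hreg : ∀ (j : Fin t) (g : CoordRing K r), f j * g ∈ partialIdeal I f j →
      g ∈ partialIdeal I f j) {n : ℕ} (hn : 1 ≤ n) :
    (H.tensor (koszul f d hf)).syzygy n =
      ((H.tensor (koszul f d hf)).term (n + 1)).map (H.tensor (koszul f d hf)).δ := by
  apply le_antisymm
  · rintro v ⟨hv, hδ⟩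
    obtain ⟨w, ⟨-, hw⟩, hwv⟩ := exists_koszulδ_eq hf ho hI hex hreg t le_rfl hn
      (mem_koszulTrunc_self v) hv ((tensor_koszul_δ d hf v).symm.trans hδ)
    exact ⟨w, hw, (tensor_koszul_δ d hf w).trans hwv⟩
  · rintro _ ⟨w, hw, rfl⟩
    exact ⟨δ_mem_term _ hw, δ_δ _ w⟩

/-- A cycle of `G'` is `δ w` in `G`. The top component of `w` is then a cycle of `H`, so
`exists_mem_koszulLower` moves `w` into `G'`. -/
lemma koszulPart_inf_ker (hf : ∀ i, (f i).IsHomogeneous (d i))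
    (ho : ∀ b, H.hdeg b = 0 ↔ b = o) (hI : (H.term 1).map (LinearMap.proj o ∘ₗ H.δ) = I)
    (hex : ∀ n, 1 ≤ n → H.syzygy n = (H.term (n + 1)).map H.δ)
    (hreg : ∀ (j : Fin t) (g : CoordRing K r), f j * g ∈ partialIdeal I f j →
      g ∈ partialIdeal I f j) {n : ℕ} (hn : t + 1 ≤ n) :
    H.koszulPart f d hf n ⊓ LinearMap.ker (H.tensor (koszul f d hf)).δ =
      (H.koszulPart f d hf (n + 1)).map (H.tensor (koszul f d hf)).δ := by
  apply le_antisymm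
  · rintro v ⟨hv, hδ⟩
    have hv' := mem_koszulLower.1 (show v ∈ H.koszulLower t n from hv)
    obtain ⟨w, ⟨-, hw⟩, hwv⟩ := exists_koszulδ_eq hf ho hI hex hreg t le_rfl (by omega)
      (mem_koszulTrunc_self v) hv'.1 ((tensor_koszul_δ d hf v).symm.trans hδ)
    obtain ⟨w', hw', hww'⟩ := exists_mem_koszulLower hf hex (by omega) hw
      (by rw [← koszulTop_koszulδ, hwv, hv'.2])
    exact ⟨w', hw', (tensor_koszul_δ d hf w').trans (hww'.trans hwv)⟩
  · rintro _ ⟨w, hw, rfl⟩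
    refine ⟨?_, δ_δ _ w⟩
    have h := koszulδ_mem_koszulLower hf (show w ∈ H.koszulLower t (n + 1) from hw)
    exact (congrArg (· ∈ H.koszulLower t n) (tensor_koszul_δ d hf w)).mpr h

lemma map_proj_map_tensor_δ (hf : ∀ i, (f i).IsHomogeneous (d i))
    (hI : (H.term 1).map (LinearMap.proj o ∘ₗ H.δ) = I) :
    (((H.tensor (koszul f d hf)).term (t + 1)).map (H.tensor (koszul f d hf)).δ).map
      (LinearMap.proj (o, (Finset.univ : Finset (Fin t)))) = I := by
  apply le_antisymm
  · rintro _ ⟨_, ⟨w, hw, rfl⟩, rfl⟩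
    rw [← hI]
    refine ⟨koszulTop w, koszulTop_mem_term hw (add_comm t 1), ?_⟩
    have h := congrFun (koszulTop_koszulδ (f := f) w) o
    exact h.symm.trans (congrFun (tensor_koszul_δ d hf w).symm (o, Finset.univ))
  · rw [← hI]
    rintro _ ⟨x, hx, rfl⟩
    have h := koszulIncl_mem_koszulTerm (T := (Finset.univ : Finset (Fin t))) hx
    rw [Finset.card_univ, Fintype.card_fin, add_comm 1 t] at h
    refine ⟨_, ⟨koszulIncl Finset.univ x, h, rfl⟩, ?_⟩
    have h1 := congrFun (koszulTop_koszulδ (f := f) (koszulIncl Finset.univ x)) o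
    rw [koszulTop_koszulIncl] at h1
    exact (congrFun (tensor_koszul_δ d hf _) (o, Finset.univ)).trans h1

lemma map_tensor_δ_inf_ker_proj (hf : ∀ i, (f i).IsHomogeneous (d i))
    (ho : ∀ b, H.hdeg b = 0 ↔ b = o)
    (hex : ∀ n, 1 ≤ n → H.syzygy n = (H.term (n + 1)).map H.δ) :
    ((H.tensor (koszul f d hf)).term (t + 1)).map (H.tensor (koszul f d hf)).δ ⊓
      LinearMap.ker (LinearMap.proj (o, (Finset.univ : Finset (Fin t)))) =
      (H.koszulPart f d hf (t + 1)).map (H.tensor (koszul f d hf)).δ := by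
  apply le_antisymm
  · rintro _ ⟨⟨w, hw, rfl⟩, hker⟩
    -- The vector `δ (koszulTop w)` lies in `H_0`, where `o` is the only coordinate, so one
    -- vanishing coordinate makes the top component a cycle.
    have h0 : H.δ (koszulTop w) = 0 := by
      have h1 := H.δ_mem_term (koszulTop_mem_term (m := 0 + 1) hw (by omega))
      funext b
      by_cases hb : b = o
      · subst hb
        refine Eq.trans ?_ hker
        exact (congrFun (koszulTop_koszulδ (f := f) w) b).symm.trans
          (congrFun (tensor_koszul_δ d hf w).symm (b, Finset.univ))
      · exact H.mem_term.1 h1 b fun h => hb ((ho b).1 h)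
    obtain ⟨w', hw', hww'⟩ := exists_mem_koszulLower (f := f) hf hex le_rfl hw h0
    exact ⟨w', hw', (tensor_koszul_δ d hf w').trans (hww'.trans (tensor_koszul_δ d hf w).symm)⟩
  · rintro _ ⟨w, hw, rfl⟩
    have hw' := mem_koszulLower.1 (show w ∈ H.koszulLower t (t + 1) from hw)
    refine ⟨⟨w, hw'.1, rfl⟩, ?_⟩
    have h1 := congrFun (koszulTop_koszulδ (f := f) w) o
    rw [hw'.2, map_zero] at h1
    exact (congrFun (tensor_koszul_δ d hf w) (o, Finset.univ)).trans h1

lemma constantCoeff_tensor_koszul (hf : ∀ i, (f i).IsHomogeneous (d i))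
    (hH : ∀ a b, constantCoeff (H.d a b) = 0) (hfm : ∀ i, constantCoeff (f i) = 0)
    (x y : (H.tensor (koszul f d hf)).ι) :
    constantCoeff ((H.tensor (koszul f d hf)).d x y) = 0 := by
  have hk (U T : Finset (Fin t)) : constantCoeff ((koszul f d hf).d U T) = 0 := by
    change constantCoeff (∑ i ∈ T, if U = T.erase i then
      (-1) ^ {j ∈ T | j < i}.card * f i else 0) = 0
    rw [map_sum]
    refine Finset.sum_eq_zero fun i _ => ?_
    split_ifs
    · rw [map_mul, hfm, mul_zero]
    · rw [map_zero]
  have h1 (p : Prop) [Decidable p] (a b : H.ι) :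
      constantCoeff (if p then H.d a b else 0) = 0 := by
    split_ifs
    · exact hH a b
    · exact map_zero _
  have h2 (p : Prop) [Decidable p] (c : CoordRing K r) (U T : Finset (Fin t)) :
      constantCoeff (if p then c * (koszul f d hf).d U T else 0) = 0 := by
    split_ifs
    · rw [map_mul, hk, mul_zero]
    · exact map_zero _
  exact (map_add constantCoeff _ _).trans
    ((congrArg₂ (· + ·) (h1 _ _ _) (h2 _ _ _ _)).trans (add_zero 0))

lemma isMinimalFreeResolution_tensor_koszul {ℓ : ℕ} (hf : ∀ i, (f i).IsHomogeneous (d i))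
    (hH : H.IsMinimalFreeResolution I ℓ)
    (hreg : ∀ (j : Fin t) (g : CoordRing K r), f j * g ∈ partialIdeal I f j →
      g ∈ partialIdeal I f j) (hfm : ∀ i, constantCoeff (f i) = 0) :
    (H.tensor (koszul f d hf)).IsMinimalFreeResolution (partialIdeal I f t) (ℓ + t) := by
  obtain ⟨o, ho, hdo, hI⟩ := hH.augmented
  refine ⟨fun b => ?_, constantCoeff_tensor_koszul hf hH.minimal hfm,
    fun n hn => tensor_koszul_syzygy hf ho hI hH.exact hreg hn,
    (o, (∅ : Finset (Fin t))), fun b => ?_, ?_, ?_⟩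
  · have h : b.2.card ≤ t := by simpa using Finset.card_le_univ (b.2 : Finset (Fin t))
    exact add_le_add (hH.length b.1) h
  · obtain ⟨a, T⟩ : H.ι × Finset (Fin t) := b
    have h : H.hdeg a + T.card = 0 ↔ (a, T) = (o, ∅) := by
      rw [Nat.add_eq_zero_iff, ho, Finset.card_eq_zero, Prod.mk_inj]
    exact h
  · change H.deg o + ∑ i ∈ (∅ : Finset (Fin t)), (d i : ℤ) = 0
    rw [hdo, Finset.sum_empty, add_zero]
  · rw [← map_koszulTrunc_inf_koszulTerm_one ho hI t]
    apply le_antisymm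
    · rintro _ ⟨w, hw, rfl⟩
      exact ⟨w, ⟨mem_koszulTrunc_self w, hw⟩,
        (congrFun (tensor_koszul_δ d hf w) (o, (∅ : Finset (Fin t)))).symm⟩
    · rintro _ ⟨w, hw, rfl⟩
      exact ⟨w, hw.2, congrFun (tensor_koszul_δ d hf w) (o, (∅ : Finset (Fin t)))⟩

end GradedFreeComplex

/-! ### Projective dimensions and Hilbert polynomials of `P` and `N` -/

namespace GradedFreeComplex

variable {K : Type u} [Field K] {r s t : ℕ} {f : Fin t → CoordRing K r} {d : Fin t → ℕ}
  {H : GradedFreeComplex K r} {I : Ideal (CoordRing K r)}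

lemma IsMinimalFreeResolution.extVanishes_quotient {ℓ : ℕ} (hH : H.IsMinimalFreeResolution I ℓ)
    (hℓ : ℓ ≤ r + 1) (a : Fin (r + 1) → K) :
    ExtVanishes (pointIdeal a) (CoordRing K r ⧸ I) (r + 1 - ℓ) := by
  obtain ⟨o, ho, -, hI⟩ := hH.augmented
  exact GradedFreeComplex.extVanishes_quotient ho hI hH.exact hH.length hℓ a

/-- A resolution of length `s - 1` would give grade `r + 2 - s`, more than the dimension. -/
lemma IsMinimalFreeResolution.exists_hdeg_eq (hH : H.IsMinimalFreeResolution I s)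
    (hIm : I ≤ irrelevantIdeal K r) (hdim : ringKrullDim (CoordRing K r ⧸ I) = (r + 1 - s : ℕ))
    (hs : 1 ≤ s) (hsr : s ≤ r) : ∃ b, H.hdeg b = s := by
  by_contra! h
  obtain ⟨o, ho, -, hI⟩ := hH.augmented
  have h1 := GradedFreeComplex.extVanishes_quotient ho hI hH.exact (L := s - 1)
    (fun b => by have := hH.length b; have := h b; omega) (by omega) 0
  rw [← irrelevantIdeal_eq_pointIdeal] at h1
  have h2 := le_ringKrullDim_quotient h1 hIm
  rw [hdim] at h2
  have h3 : r + 1 - (s - 1) ≤ r + 1 - s := by exact_mod_cast h2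
  omega

lemma koszulPart_eq_bot (hf : ∀ i, (f i).IsHomogeneous (d i)) (hH : ∀ b, H.hdeg b ≤ s) {n : ℕ}
    (hn : s + t ≤ n) : H.koszulPart f d hf n = ⊥ := by
  refine supportedOn_eq_bot ?_
  rintro ⟨a, T⟩ ⟨h1, h2⟩
  have h3 : Finset.card (α := Fin t) T ≤ t := by simpa using Finset.card_le_univ (α := Fin t) T
  have h4 := hH a
  change H.hdeg a + Finset.card (α := Fin t) T = n at h1
  change ¬ Finset.card (α := Fin t) T = t at h2
  omega

/-- The only summand of degree `s + t` is `H_s ⊗ ⋀^t F`, absent from `G'`; one degree lower `H_s ⊗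
⋀^{t-1} F` survives. -/
lemma koszulPart_ne_bot (hf : ∀ i, (f i).IsHomogeneous (d i)) (hH : ∃ b, H.hdeg b = s)
    (ht : 1 ≤ t) : H.koszulPart f d hf (s + t - 1) ≠ ⊥ := by
  obtain ⟨b, hb⟩ := hH
  refine supportedOn_ne_bot (b := (b, (Finset.univ.erase ⟨0, ht⟩ : Finset (Fin t)))) ?_
  have h : (Finset.univ.erase ⟨0, ht⟩ : Finset (Fin t)).card = t - 1 := by
    rw [Finset.card_erase_of_mem (Finset.mem_univ _), Finset.card_univ, Fintype.card_fin]
  refine ⟨?_, ?_⟩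
  · rw [hb, h]
    omega
  · rw [h]
    omega

-- The minimal resolution of `P` runs from `G'_{t+1}` to `G'_{s+t-1}`, so it has length `s - 2`.
open CategoryTheory in
lemma pd_map_koszulPart (hf : ∀ i, (f i).IsHomogeneous (d i)) (hH : H.IsMinimalFreeResolution I s)
    (hreg : ∀ (j : Fin t) (g : CoordRing K r), f j * g ∈ partialIdeal I f j →
      g ∈ partialIdeal I f j) (hfm : ∀ i, constantCoeff (f i) = 0) (hb : ∃ b, H.hdeg b = s)
    (hs : 2 ≤ s) (ht : 1 ≤ t) :
    pd ((H.koszulPart f d hf (t + 1)).map (H.tensor (koszul f d hf)).δ) =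
      ((s - 2 : ℕ) : WithBot ℕ∞) := by
  obtain ⟨o, ho, -, hI⟩ := hH.augmented
  have hex (n : ℕ) (hn : t + 1 ≤ n) := koszulPart_inf_ker (d := d) hf ho hI hH.exact hreg hn
  have hfree (n : ℕ) : Module.Projective (CoordRing K r) (H.koszulPart f d hf n) :=
    inferInstanceAs (Module.Projective (CoordRing K r) (ProjACM.supportedOn (CoordRing K r) _))
  have hL := koszulPart_eq_bot hf hH.length (n := s + t - 1 + 1) (by omega)
  refine le_antisymm ((projectiveDimension_le_iff _ _).2 ?_)
    ((projectiveDimension_ge_iff _ _).2 ?_)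
  · exact hasProjectiveDimensionLT_map_of_chain hfree hex hL _ (t + 1) le_rfl (by omega)
  · refine not_hasProjectiveDimensionLT_map_of_chain isMaximal_irrelevantIdeal.ne_top hfree hex
      (fun n hn => ?_) hL (koszulPart_ne_bot hf hb ht) _ (t + 1) le_rfl (by omega)
    refine map_δ_le_smul (constantCoeff_tensor_koszul hf hH.minimal hfm) fun v hv => ?_
    exact (congrArg (· ∈ H.koszulLower t n) (tensor_koszul_δ d hf v)).mpr
      (koszulδ_mem_koszulLower hf hv)

open CategoryTheory in
lemma IsMinimalFreeResolution.pd_map_term_le {C : GradedFreeComplex K r} {ℓ : ℕ}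
    (hC : C.IsMinimalFreeResolution I ℓ) {n m : ℕ} (hn : 1 ≤ n) (hm : n + m = ℓ) :
    pd ((C.term n).map C.δ) ≤ m := by
  refine (projectiveDimension_le_iff _ _).2 ?_
  refine hasProjectiveDimensionLT_map_of_chain (F := C.term) (n₀ := 1) (L := ℓ)
    (fun n => inferInstanceAs (Module.Projective (CoordRing K r)
      (ProjACM.supportedOn (CoordRing K r) _))) hC.exact
    (supportedOn_eq_bot fun b hb => ?_) (m + 1) n hn (by omega)
  have h : C.hdeg b = ℓ + 1 := hb
  have := hC.length b
  omega

lemma IsMinimalFreeResolution.exists_isHilbertPolynomial {C : GradedFreeComplex K r} {ℓ : ℕ}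
    (hC : C.IsMinimalFreeResolution I ℓ) {n : ℕ} (hn : 1 ≤ n) :
    ∃ q, IsHilbertPolynomial C.deg ((C.term n).map C.δ) q := by
  refine exists_isHilbertPolynomial_of_chain (B := fun n => {b | C.hdeg b = n}) (n₀ := 1) (L := ℓ)
    hC.exact (fun n hn => Set.eq_empty_of_forall_notMem fun b hb => ?_) n hn
  have h : C.hdeg b = n := hb
  have := hC.length b
  omega

lemma exists_isHilbertPolynomial_koszulPart (hf : ∀ i, (f i).IsHomogeneous (d i))
    (hH : H.IsMinimalFreeResolution I s)
    (hreg : ∀ (j : Fin t) (g : CoordRing K r), f j * g ∈ partialIdeal I f j →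
      g ∈ partialIdeal I f j) :
    ∃ q, IsHilbertPolynomial (H.tensor (koszul f d hf)).deg
      ((H.koszulPart f d hf (t + 1)).map (H.tensor (koszul f d hf)).δ) q := by
  obtain ⟨o, ho, -, hI⟩ := hH.augmented
  refine exists_isHilbertPolynomial_of_chain (C := H.tensor (koszul f d hf))
    (B := fun n => {x : H.ι × Finset (Fin t) | H.hdeg x.1 + x.2.card = n ∧ x.2.card ≠ t})
    (n₀ := t + 1) (L := s + t)
    (fun n hn => koszulPart_inf_ker (d := d) hf ho hI hH.exact hreg hn)
    (fun n hn => Set.eq_empty_of_forall_notMem ?_) (t + 1) le_rfl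
  rintro ⟨a, T⟩ ⟨h1, h2⟩
  have h3 : T.card ≤ t := by simpa using Finset.card_le_univ T
  have h4 := hH.length a
  change H.hdeg a + T.card = n at h1
  omega

end GradedFreeComplex

end ProjACM

end

theorem mainTheorem6 {K : Type*} [Field K] [IsAlgClosed K] {r s t : ℕ}
    (hs : 2 ≤ s) (ht : 1 ≤ t) (hst : s + t ≤ r)
    (D : ClosedSubscheme K r) (hD : D.IsACM) (hDs : D.HasCodim s)
    (H : GradedFreeComplex K r) (hH : H.IsMinimalFreeResolution D.ideal s)
    (f : Fin t → CoordRing K r) (d : Fin t → ℕ) (hf : ∀ i, (f i).IsHomogeneous (d i))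
    (hS : (ClosedSubscheme.ofForms f d hf).HasCodim t)
    (X : ClosedSubscheme K r) (hX : X = D.inter (ClosedSubscheme.ofForms f d hf))
    (hXc : X.HasCodim (s + t)) :
    IsConstructedFrom D X s (s + t) (H.tensor (GradedFreeComplex.koszul f d hf))
      ((H.koszulPart f d hf (t + 1)).map (H.tensor (GradedFreeComplex.koszul f d hf)).δ)
      (-∑ i, (d i : ℤ)) ∧
    (∀ n, t + 1 ≤ n →
      H.koszulPart f d hf n ⊓ LinearMap.ker (H.tensor (GradedFreeComplex.koszul f d hf)).δ =
        (H.koszulPart f d hf (n + 1)).map (H.tensor (GradedFreeComplex.koszul f d hf)).δ) := by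
  open GradedFreeComplex in
  have hXI : X.ideal = saturation (partialIdeal D.ideal f t) := by
    rw [hX, partialIdeal_self]
    exact saturation_sup_saturation _ _
  have hIm := hDs.le_irrelevantIdeal
  have hdimI := hDs.ringKrullDim_eq (by omega)
  have hXm := hXc.le_irrelevantIdeal
  have hdimX := hXc.ringKrullDim_eq (by omega)
  rw [hXI] at hXm hdimX
  have hJm := (le_saturation _).trans hXm
  rw [ringKrullDim_quotient_saturation hXm] at hdimX
  -- The grade `r + 1 - s` is written as the dimension of `R/I_X` plus the number `t` of forms.
  have hext (a : Fin (r + 1) → K) :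
      ExtVanishes (pointIdeal a) (CoordRing K r ⧸ D.ideal) (r + 1 - (s + t) + t) := by
    have := hH.extVanishes_quotient (by omega) a
    rwa [show r + 1 - (s + t) + t = r + 1 - s by omega]
  have hext0 := hext 0
  rw [← irrelevantIdeal_eq_pointIdeal] at hext0
  have hreg := mem_partialIdeal_of_mul_mem D.homogeneous hf hJm hext0 hdimX
  -- The remaining grade `r + 1 - (s + t)` is at least `1` by `hst`, so `I_D + (f)` is already
  -- `I_X`.
  have hsat := saturation_eq_of_extVanishes
    ((extVanishes_partialIdeal hreg hext0).mono (by omega)) hJm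
  rw [hsat] at hXI
  have hfm (i : Fin t) : constantCoeff (f i) = 0 := by
    refine hJm ?_
    rw [partialIdeal_self]
    exact Ideal.mem_sup_right (Ideal.subset_span ⟨i, rfl⟩)
  have hG := isMinimalFreeResolution_tensor_koszul hf hH hreg hfm
  obtain ⟨o, ho, hdo, hI⟩ := hH.augmented
  have hN : (H.tensor (koszul f d hf)).syzygy (s + t - s) =
      ((H.tensor (koszul f d hf)).term (t + 1)).map (H.tensor (koszul f d hf)).δ := by
    rw [Nat.add_sub_cancel_left]
    exact hG.exact t ht
  have hPd := pd_map_koszulPart hf hH hreg hfm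
    (hH.exists_hdeg_eq hIm hdimI (by omega) (by omega)) hs ht
  have hrange := map_proj_map_tensor_δ hf hI
  have hker := map_tensor_δ_inf_ker_proj hf ho hH.exact
  -- The twist `k` comes from the generator of `H_0 ⊗ ⋀^t F`, of degree `∑ d_i`.
  have hk : -(H.tensor (koszul f d hf)).deg (o, (Finset.univ : Finset (Fin t))) =
      -∑ i, (d i : ℤ) := by
    change -(H.deg o + ∑ i, (d i : ℤ)) = _
    rw [hdo, zero_add]
  refine ⟨?_, fun n hn => koszulPart_inf_ker hf ho hI hH.exact hreg hn⟩
  constructor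
  case X_acm =>
    rw [ClosedSubscheme.IsACM, hXI]
    refine isCohenMacaulayRing_quotient hdimX.le fun m hm _ => ?_
    obtain ⟨a, rfl⟩ := exists_eq_pointIdeal m
    exact extVanishes_partialIdeal hreg (hext a)
  case X_codim => exact hXc
  case three_le => omega
  case le_dim => exact hst
  case two_le => exact hs
  case lt_codim => omega
  case resolution =>
    rw [hXI]
    exact hG
  case N_graded =>
    rw [hN]
    exact isGradedSubmodule_map_δ _
  case N_torsionFree => infer_instance
  case N_pd =>
    rw [hN, hPd]
    -- Resolving `N` by `G_{t+1}, …, G_{s+t}` bounds its projective dimension by `s - 1 = (s - 2) +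
    -- 1`.
    exact_mod_cast hG.pd_map_term_le (n := t + 1) (m := s - 2 + 1) (by omega) (by omega)
  case P_graded => exact isGradedSubmodule_map_δ _
  case P_torsionFree => infer_instance
  case P_pd => exact hPd
  case hilbert =>
    rw [hN, ← hk]
    refine hilbertCondition_of_proj hrange hker (fun v hv n => piecePart_mem_map_δ hv n)
      (hG.exists_isHilbertPolynomial (by omega))
      (exists_isHilbertPolynomial_koszulPart hf hH hreg) D.homogeneous hIm ?_ hdimI.le (by omega)
    rwa [show r + 1 - (s + t) + t = r + 1 - s by omega] at hext0
  case maximal =>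
    rw [hN]
    exact isMaximalSubsheaf_of_proj hker
  case exactSequence =>
    rw [hN, ← hk]
    exact hasExactSequence_of_proj hrange hker
  case D_acm => exact hD
  case D_codim => exact hDs
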